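/- **Setting.** Let $a_0\in(1,2)$ be such that $0$ is preperiodic (some iterate of $0$ is periodic, but $0$ itself is not) for $h(x)=a_0-x^2$, let $d\ge 16$ be an integer, $0<\eta<1/3$, and for $\epsilon>0$ let $$\phi(\omega,x)=(d\omega,\ a_0+\epsilon\sin(2\pi\omega)-x^2)\qquad\text{on } S^1\times\mathbb R,\quad S^1=\mathbb R/\mathbb Z .$$ Let $I$ be a nonempty compact interval with $\phi(S^1\times I)\subset S^1\times I$. For $r\ge 1$ put $I_r=(\sqrt\epsilon e^{-r},\sqrt\epsilon e^{-(r-1)})$ and $I_{-r}=-I_r$. A *rectangle* is an open region $R=\{(\omega,x): a<\omega<b,\ X^-(\omega)<x<X^+(\omega)\}$, where $0\le a<b\le 1$ and $X^\pm:[a,b]\to I$ are continuous with $X^-<X^+$ on $(a,b)$. Its basis is $(a,b)$, and the size of its left boundary is $X^+(a)-X^-(a)$. Saying that the basis is $S^1$ means $(a,b)=(0,1)$, and below $S^1\times A$ stands for $(0,1)\times A$. A rectangle is *admissible* if $X^\pm$ are $C^2$ on $(a,b)$ with $|(X^\pm)'|\le\epsilon$ and $|(X^\pm)''|\le\epsilon$.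 An admissible rectangle is *gentle* if it, or its mirror image under $(\omega,x)\mapsto(\omega,-x)$, either is contained in $S^1\times(\sqrt\epsilon,1)$ and contains $S^1\times(\sqrt\epsilon,2\sqrt\epsilon)$, or contains $S^1\times(I_r\cup\dots\cup I_{r+5})$ for some $r\ge1$. The distortion of $\phi^t$ on a set is bounded by $C$ if $|\det D\phi^t(z)|\le C\,|\det D\phi^t(w)|$ for all $z,w$ in the set. Partitions are modulo sets of Lebesgue measure $0$. **Statement.** For every sufficiently small $\epsilon>0$ (depending on $a_0,\eta,d$) and every $I$ as above there exist $q\in\mathbb N$ and $C>0$ such that, for any admissible rectangle $R\subset S^1\times I$ with basis $S^1$ and left boundary of size $\ge\epsilon^{1-\frac32\eta}$, there exist a partition of $R$ into finitely many rectangles $R_0,\dots,R_s,R'_0,\dots,R'_k$ and times $t_0,\dots,t_s,t'_0,\dots,t'_k\le q$ such that: 1. For $0\le i\le s$, $\phi^{t_i}$ maps $R_i$ bijectively onto $S^1\times\Lambda$ for $\Lambda=I_1$ or $\Lambda=I_{-1}$, with distortion bounded by $C$. 2. For $0\le i\le k$, $\phi^{t'_i}$ maps $R'_i$ bijectively onto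 an admissible and gentle rectangle whose left boundary has size $\ge\epsilon^{1-\frac32\eta}/C$, and the distortion of $\phi^{t'_i}$ on $R'_i$ is bounded by $C$. 3. $\mathrm{Leb}\left(\bigcup_i R_i\right)\ge \mathrm{Leb}(R)/C$. -/

import Mathlib

open Set Function MeasureTheory

noncomputable section

namespace Viana

/-- The phase space `S¹ × ℝ`, with `S¹ = ℝ / ℤ`; its `volume` is Lebesgue measure. -/
abbrev Phase : Type := UnitAddCircle × ℝ

/-- The quadratic map `h(x) = a₀ - x²`. -/
def quad (a₀ : ℝ) (x : ℝ) : ℝ := a₀ - x ^ 2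

/-- The point `0` is (strictly) preperiodic for `h`: it is not periodic,
but some iterate of it is periodic. -/
def CriticalPreperiodic (a₀ : ℝ) : Prop :=
  (0 : ℝ) ∉ periodicPts (quad a₀) ∧ ∃ n : ℕ, (quad a₀)^[n] 0 ∈ periodicPts (quad a₀)

theorem sin_two_pi_periodic : Function.Periodic (fun θ : ℝ => Real.sin (2 * Real.pi * θ)) 1 := by
  intro θ
  simp [mul_add, Real.sin_add_two_pi]

/-- The function `ω ↦ sin (2 π ω)` on the circle. -/
def circleSin : UnitAddCircle → ℝ := sin_two_pi_periodic.lift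

/-- The map `φ(ω, x) = (d ω, a₀ + ε sin (2 π ω) - x²)` of `S¹ × ℝ`. -/
def phi (d : ℕ) (a₀ ε : ℝ) (p : Phase) : Phase :=
  (d • p.1, a₀ + ε * circleSin p.1 - p.2 ^ 2)

/-- The covering projection `ℝ × ℝ → S¹ × ℝ`. -/
def proj (z : ℝ × ℝ) : Phase := ((z.1 : UnitAddCircle), z.2)

/-- The lift of `φ` to `ℝ × ℝ`. -/
def phiLift (d : ℕ) (a₀ ε : ℝ) (z : ℝ × ℝ) : ℝ × ℝ :=
  ((d : ℝ) * z.1, a₀ + ε * Real.sin (2 * Real.pi * z.1) - z.2 ^ 2)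

theorem phi_proj (d : ℕ) (a₀ ε : ℝ) (z : ℝ × ℝ) :
    phi d a₀ ε (proj z) = proj (phiLift d a₀ ε z) := by
  ext
  · simp only [phi, proj, phiLift]
    rw [← nsmul_eq_mul, AddCircle.coe_nsmul]
  · simp [phi, proj, phiLift, circleSin]

/-- The distortion of `φ^t` on `A` is at most `C`: the Jacobians `|det D φ^t|` at any two points
of `A` have a ratio of at most `C`. (The covering projection is a local isometry, so the
derivative can be computed in the lift, at any points above the two points of `A`.) -/
def DistortionLE (d : ℕ) (a₀ ε : ℝ) (t : ℕ) (A : Set Phase) (C : ℝ) : Prop :=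
  ∀ z w : ℝ × ℝ, proj z ∈ A → proj w ∈ A →
    |(fderiv ℝ (phiLift d a₀ ε)^[t] z).det| ≤ C * |(fderiv ℝ (phiLift d a₀ ε)^[t] w).det|

/-- `S¹ × A`, where, as for every rectangle over the whole circle, the basis is
the interval `(0, 1)`. -/
def strip (A : Set ℝ) : Set Phase :=
  ((fun θ : ℝ => (θ : UnitAddCircle)) '' Ioo 0 1) ×ˢ A

/-- `I_r = (√ε e^{-r}, √ε e^{-(r-1)})`, for `r ≥ 1`. -/
def core (ε : ℝ) (r : ℕ) : Set ℝ :=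
  Ioo (√ε * Real.exp (-(r : ℝ))) (√ε * Real.exp (-((r : ℝ) - 1)))

/-- `I_{-r} = -I_r`, for `r ≥ 1`. -/
def coreNeg (ε : ℝ) (r : ℕ) : Set ℝ := {x | -x ∈ core ε r}

/-- A rectangle in `S¹ × K`, given by two vertical lines and two horizontal curves
(the graphs of `bottom` and `top`). The boundary functions are extended continuously to the
endpoints of the basis `(left, right)`. -/
structure Rectangle (K : Set ℝ) where
  left : ℝ
  right : ℝ
  bottom : ℝ → ℝ
  top : ℝ → ℝ
  left_nonneg : 0 ≤ left
  left_lt_right : left < right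
  right_le_one : right ≤ 1
  continuousOn_bottom : ContinuousOn bottom (Icc left right)
  continuousOn_top : ContinuousOn top (Icc left right)
  bottom_mem : ∀ θ ∈ Icc left right, bottom θ ∈ K
  top_mem : ∀ θ ∈ Icc left right, top θ ∈ K
  bottom_lt_top : ∀ θ ∈ Ioo left right, bottom θ < top θ

namespace Rectangle

variable {K : Set ℝ}

/-- The (open) region bounded by the four sides. -/
def carrier (R : Rectangle K) : Set Phase :=
  {p | ∃ θ ∈ Ioo R.left R.right, p.1 = (θ : UnitAddCircle) ∧ p.2 ∈ Ioo (R.bottom θ) (R.top θ)}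

/-- The basis of the rectangle is `S¹`, meaning `(0, 1)`. -/
def HasFullBasis (R : Rectangle K) : Prop := R.left = 0 ∧ R.right = 1

/-- The length of the left side. -/
def leftSize (R : Rectangle K) : ℝ := R.top R.left - R.bottom R.left

end Rectangle

/-- The graph of `X` over `(a, b)` is an admissible curve:
`X` is `C²` with `|X'| ≤ ε` and `|X''| ≤ ε`. -/
def AdmissibleCurve (ε a b : ℝ) (X : ℝ → ℝ) : Prop :=
  ContDiffOn ℝ 2 X (Ioo a b) ∧ ∀ θ ∈ Ioo a b, |deriv X θ| ≤ ε ∧ |deriv (deriv X) θ| ≤ ε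

/-- A rectangle is admissible if both horizontal boundaries are admissible curves. -/
def Rectangle.Admissible {K : Set ℝ} (ε : ℝ) (R : Rectangle K) : Prop :=
  AdmissibleCurve ε R.left R.right R.bottom ∧ AdmissibleCurve ε R.left R.right R.top

/-- The set `A` lies in `S¹ × (√ε, 1)` and contains `S¹ × (√ε, 2√ε)`, or `A` contains
`S¹ × (I_r ∪ … ∪ I_{r+5})` for some `r ≥ 1`. -/
def GentleAbove (ε : ℝ) (A : Set Phase) : Prop :=
  (A ⊆ strip (Ioo (√ε) 1) ∧ strip (Ioo (√ε) (2 * √ε)) ⊆ A) ∨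
    ∃ r : ℕ, 1 ≤ r ∧ ∀ j : ℕ, j ≤ 5 → strip (core ε (r + j)) ⊆ A

/-- The set `A`, or its mirror image with respect to `S¹ × {0}`, satisfies `GentleAbove`.
(The intervals `I_r, …, I_{r+5}` with negative indices are those of the mirror image.) -/
def Gentle (ε : ℝ) (A : Set Phase) : Prop :=
  GentleAbove ε A ∨ GentleAbove ε {p | (p.1, -p.2) ∈ A}

/-- A partition of `A` modulo sets of Lebesgue measure zero. -/
def IsPartitionModZero {ι : Type*} (B : ι → Set Phase) (A : Set Phase) : Prop :=
  Pairwise (fun i j => Disjoint (B i) (B j)) ∧ (∀ i, B i ⊆ A) ∧ volume (A \ ⋃ i, B i) = 0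

end Viana

end

/-!
The dynamics of `φ` in the fibres are a perturbation of size `ε` of `h(x) = a₀ - x²`, and the
constants `q` and `C` may depend on `ε`. What has to be shown is that rectangles over the circle
whose fibres are longer than a small multiple of `ε ^ θ`, `θ = 1 - 3 η / 2 ∈ (1/2, 1)`, grow as long
as they keep away from the critical circle `x = 0`, up to the scale `ε ^ θ`.

*An expanding metric.* Let `P` be the finite orbit of the critical value. On the complement of `P ∪
{±2}` the inverse branches of `h` map gaps into gaps, and a quadratic map satisfies an explicit
Schwarz lemma (`exists_pullback_density`): `h` expands the hyperbolic density `N` of the gaps, at a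
uniform rate away from `P`. At a point `p ∈ P` the same lemma applies to the gap in which `p` has
been filled in, and gives weights `W p` with `|h'(p)| W (h p) > W p`; in particular the postcritical
cycle is repelling. The density `ρ = W ^ (1 - α) * N ^ α` is then uniformly expanded when `α < 1` is
close to `1`: near `P` by the first factor, elsewhere by the second, and near the critical point
because `α > 1/2`. Replacing `1 / N` by `1 / N + const * ε / W` makes this stable under
perturbations of size `ε`, and the value of `ρ` near `h(0)` becomes `ε ^ (-α)`, so that the
derivative `2 |x| ≥ const * ε ^ θ` near the critical point is more than made up for if `α > θ`
(`exists_isExpanding`).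

*The recursion.* A full admissible rectangle `R` that keeps away from the critical circle is cut
into `d` columns, each of which is mapped by `φ` onto a full admissible rectangle whose fibres are
longer in the metric `ρ |dx|` (`splits_of_images`); dissections of these images are pulled back by
the inverse branches (`splits_of_columns`). A rectangle that touches the critical circle reaches out
to a distance much larger than its distance to the circle and is gentle. As lengths are bounded,
this ends after a bounded time, with gentle rectangles only (`splits_gentle`). To obtain also
rectangles that return to `S¹ × I_{±1}`, one cuts a strip `S¹ × I_{±r}` out of a rectangle that
touches the critical circle, leaving gentle rectangles on both sides. If `r = 1` is possible this is
a return, otherwise the fibres of the strip grow under one iterate by a factor so large that they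
become longer than those of the original rectangle, and one continues with them (`splits_all`).

*Distortion and measure.* Orbits stay at a definite distance from the critical circle until they
return, and return times are bounded. So the distortion is bounded, and so is the measure of each
piece from below.
-/

noncomputable section

namespace Viana

/-! ### The postcritical set -/

/-- The forward orbit `{h(0), h²(0), …}` of the critical value of `h(x) = a₀ - x²`. -/
def postcritical (a₀ : ℝ) : Set ℝ := range fun n : ℕ => (quad a₀)^[n + 1] 0

theorem postcritical_finite {a₀ : ℝ} (h : CriticalPreperiodic a₀) : (postcritical a₀).Finite := by
  obtain ⟨-, n, m, hm, hp⟩ := h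
  have key : ∀ k, ∃ j < n + m, (quad a₀)^[k] 0 = (quad a₀)^[j] 0 := by
    intro k
    induction k using Nat.strong_induction_on with
    | _ k ih =>
      by_cases hk : k < n + m
      · exact ⟨k, hk, rfl⟩
      · obtain ⟨j, hj, e⟩ := ih (k - m) (by omega)
        refine ⟨j, hj, ?_⟩
        rw [← e]
        have h1 : k = (k - m - n) + (m + n) := by omega
        have h2 : k - m = (k - m - n) + n := by omega
        rw [h2]
        conv_lhs => rw [h1]
        rw [iterate_add_apply _ _ (m + n), iterate_add_apply _ m n, hp, ← iterate_add_apply]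
  refine ((Set.finite_Iio (n + m)).image fun j => (quad a₀)^[j] 0).subset ?_
  rintro _ ⟨k, rfl⟩
  obtain ⟨j, hj, e⟩ := key (k + 1)
  exact ⟨j, hj, e.symm⟩

theorem zero_notMem_postcritical {a₀ : ℝ} (h : CriticalPreperiodic a₀) :
    (0 : ℝ) ∉ postcritical a₀ := by
  rintro ⟨n, hn⟩
  exact h.1 ⟨n + 1, n.succ_pos, hn⟩

theorem critical_value_mem_postcritical (a₀ : ℝ) : a₀ ∈ postcritical a₀ :=
  ⟨0, by simp [quad]⟩

theorem quad_mem_postcritical {a₀ p : ℝ} (h : p ∈ postcritical a₀) :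
    quad a₀ p ∈ postcritical a₀ := by
  obtain ⟨n, rfl⟩ := h
  exact ⟨n + 1, iterate_succ_apply' _ _ _⟩

theorem postcritical_subset {a₀ p : ℝ} (ha : a₀ ∈ Ioo (1 : ℝ) 2) (h : p ∈ postcritical a₀) :
    p ∈ Icc (a₀ - a₀ ^ 2) a₀ := by
  obtain ⟨n, rfl⟩ := h
  obtain ⟨h1, h2⟩ := ha
  induction n with
  | zero => simp only [quad, iterate_one, zero_add]; constructor <;> nlinarith
  | succ n ih =>
    simp only [iterate_succ_apply' _ (n + 1)] at ih ⊢
    set p := (quad a₀)^[n + 1] 0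
    obtain ⟨h3, h4⟩ := ih
    have h5 : p ^ 2 ≤ a₀ ^ 2 := sq_le_sq' (by nlinarith) h4
    simp only [quad]
    constructor <;> nlinarith

theorem abs_lt_two_of_mem_postcritical {a₀ p : ℝ} (ha : a₀ ∈ Ioo (1 : ℝ) 2)
    (h : p ∈ postcritical a₀) : |p| < 2 := by
  have h1 := postcritical_subset ha h
  obtain ⟨h2, h3⟩ := ha
  rw [abs_lt]
  constructor <;> nlinarith [h1.1, h1.2]

/-! ### The hyperbolic density of the complement of a finite set -/

/-- The largest point of `S` to the left of `x`. -/
def lowerNbr (S : Set ℝ) (x : ℝ) : ℝ := sSup {s ∈ S | s < x}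

/-- The smallest point of `S` to the right of `x`. -/
def upperNbr (S : Set ℝ) (x : ℝ) : ℝ := sInf {s ∈ S | x < s}

/-- The density at `x` of the hyperbolic metric of the interval between the points of `S` next to
`x`. A point `x` of `S` is not counted as its own neighbour, so that the value at such a point
is the density of the larger interval in which `x` has been filled in. -/
def hypDensity (S : Set ℝ) (x : ℝ) : ℝ := (x - lowerNbr S x)⁻¹ + (upperNbr S x - x)⁻¹

/-- A finite set of points of `[-2, 2]` that contains both endpoints. -/
structure Marking (S : Set ℝ) : Prop where
  finite : S.Finite
  two_mem : (2 : ℝ) ∈ S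
  neg_two_mem : (-2 : ℝ) ∈ S

section Marking

variable {S : Set ℝ} {x : ℝ}

theorem Marking.lowerNbr_spec (hS : Marking S) (hx : |x| < 2) :
    lowerNbr S x ∈ S ∧ lowerNbr S x < x := by
  have h : lowerNbr S x ∈ {s ∈ S | s < x} :=
    Set.Nonempty.csSup_mem ⟨-2, hS.neg_two_mem, (abs_lt.1 hx).1⟩ (hS.finite.subset (sep_subset _ _))
  exact h

theorem Marking.upperNbr_spec (hS : Marking S) (hx : |x| < 2) :
    upperNbr S x ∈ S ∧ x < upperNbr S x := by
  have h : upperNbr S x ∈ {s ∈ S | x < s} :=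
    Set.Nonempty.csInf_mem ⟨2, hS.two_mem, (abs_lt.1 hx).2⟩ (hS.finite.subset (sep_subset _ _))
  exact h

theorem Marking.le_lowerNbr (hS : Marking S) {s : ℝ} (hs : s ∈ S) (h : s < x) :
    s ≤ lowerNbr S x :=
  le_csSup (hS.finite.subset (sep_subset _ _)).bddAbove ⟨hs, h⟩

theorem Marking.upperNbr_le (hS : Marking S) {s : ℝ} (hs : s ∈ S) (h : x < s) :
    upperNbr S x ≤ s :=
  csInf_le (hS.finite.subset (sep_subset _ _)).bddBelow ⟨hs, h⟩

theorem Marking.hypDensity_pos (hS : Marking S) (hx : |x| < 2) : 0 < hypDensity S x := by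
  have h1 := (hS.lowerNbr_spec hx).2
  have h2 := (hS.upperNbr_spec hx).2
  unfold hypDensity
  have := sub_pos.2 h1
  have := sub_pos.2 h2
  positivity

/-- The density is at least the reciprocal of the distance to any other marked point. -/
theorem Marking.one_le_dist_mul_hypDensity (hS : Marking S) (hx : |x| < 2) {s : ℝ} (hs : s ∈ S)
    (hne : s ≠ x) : 1 ≤ |x - s| * hypDensity S x := by
  have h1 := sub_pos.2 (hS.lowerNbr_spec hx).2
  have h2 := sub_pos.2 (hS.upperNbr_spec hx).2
  unfold hypDensity
  rcases lt_or_gt_of_ne hne with h | h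
  · have h3 := hS.le_lowerNbr hs h
    rw [abs_of_pos (sub_pos.2 h)]
    calc (1 : ℝ) = (x - lowerNbr S x) * (x - lowerNbr S x)⁻¹ := (mul_inv_cancel₀ h1.ne').symm
      _ ≤ (x - s) * ((x - lowerNbr S x)⁻¹ + (upperNbr S x - x)⁻¹) := by
        gcongr
        exact le_add_of_nonneg_right (inv_nonneg.2 h2.le)
  · have h3 := hS.upperNbr_le hs h
    rw [abs_of_neg (sub_neg.2 h)]
    calc (1 : ℝ) = (upperNbr S x - x) * (upperNbr S x - x)⁻¹ := (mul_inv_cancel₀ h2.ne').symm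
      _ ≤ (-(x - s)) * ((x - lowerNbr S x)⁻¹ + (upperNbr S x - x)⁻¹) := by
        refine mul_le_mul (by linarith) (le_add_of_nonneg_left (inv_nonneg.2 h1.le))
          (inv_nonneg.2 h2.le) (by linarith)

theorem Marking.hypDensity_le (hS : Marking S) (hx : |x| < 2) {r : ℝ} (hr : 0 < r)
    (h : ∀ s ∈ S, r ≤ |x - s|) : hypDensity S x ≤ 2 / r := by
  obtain ⟨h1, h1'⟩ := hS.lowerNbr_spec hx
  obtain ⟨h2, h2'⟩ := hS.upperNbr_spec hx
  have h3 := h _ h1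
  have h4 := h _ h2
  rw [abs_of_pos (sub_pos.2 h1')] at h3
  rw [abs_of_neg (sub_neg.2 h2'), neg_sub] at h4
  unfold hypDensity
  have := inv_anti₀ hr h3
  have := inv_anti₀ hr h4
  rw [div_eq_mul_inv]
  linarith

end Marking

/-- The postcritical set together with the points `2` and `-2`, which lie outside
the bounded dynamics of `h`. -/
def marks (a₀ : ℝ) : Set ℝ := insert 2 (insert (-2) (postcritical a₀))

theorem marking_marks {a₀ : ℝ} (h : CriticalPreperiodic a₀) : Marking (marks a₀) :=
  ⟨((postcritical_finite h).insert _).insert _, by simp [marks], by simp [marks]⟩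

theorem postcritical_subset_marks (a₀ : ℝ) : postcritical a₀ ⊆ marks a₀ :=
  fun _ h => Or.inr (Or.inr h)

theorem mem_postcritical_of_mem_marks {a₀ s : ℝ} (h : s ∈ marks a₀) (hs : |s| < 2) :
    s ∈ postcritical a₀ := by
  rcases h with rfl | rfl | h
  · norm_num at hs
  · norm_num at hs
  · exact h

/-- Schwarz lemma for the inverse branches of `h`. The interval between the marked neighbours of
`h(x)` pulls back to an interval `(x - u, x + v)` or `(x - v, x + u)` which contains no marked point
other than `x`, and `h` expands the hyperbolic density of that interval by a definite factor. -/
theorem exists_pullback_density {a₀ x : ℝ} (ha : a₀ ∈ Ioo (1 : ℝ) 2) (hpre : CriticalPreperiodic a₀)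
    (hx0 : x ≠ 0) (hx : |x| < 2) (hy : -2 < quad a₀ x) :
    ∃ u v : ℝ, 0 < u ∧ 0 < v ∧
      (u ≤ x - lowerNbr (marks a₀) x ∧ v ≤ upperNbr (marks a₀) x - x ∨
        v ≤ x - lowerNbr (marks a₀) x ∧ u ≤ upperNbr (marks a₀) x - x) ∧
      (u⁻¹ + v⁻¹) * (1 + u * v / 16) ≤ 2 * |x| * hypDensity (marks a₀) (quad a₀ x) := by
  have hS := marking_marks hpre
  have hX : 0 < |x| := abs_pos.2 hx0
  have hya : quad a₀ x < a₀ := by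
    have : 0 < x ^ 2 := by positivity
    simp only [quad]; linarith
  have hy2 : |quad a₀ x| < 2 := abs_lt.2 ⟨hy, hya.trans ha.2⟩
  obtain ⟨haS, hay⟩ := hS.lowerNbr_spec hy2
  obtain ⟨hbS, hby⟩ := hS.upperNbr_spec hy2
  have hba : upperNbr (marks a₀) (quad a₀ x) ≤ a₀ :=
    hS.upperNbr_le (postcritical_subset_marks _ (critical_value_mem_postcritical a₀)) hya
  have hlow : -2 ≤ lowerNbr (marks a₀) (quad a₀ x) := hS.le_lowerNbr hS.neg_two_mem hy
  have hgap : ∀ s ∈ marks a₀, s ≠ quad a₀ x → lowerNbr (marks a₀) (quad a₀ x) < s →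
      ¬ s < upperNbr (marks a₀) (quad a₀ x) := by
    intro s hs hne h1 h2
    rcases lt_or_gt_of_ne hne with h | h
    · exact absurd (hS.le_lowerNbr hs h) (not_le.2 h1)
    · exact absurd (hS.upperNbr_le hs h) (not_le.2 h2)
  unfold hypDensity
  set a := lowerNbr (marks a₀) (quad a₀ x)
  set b := upperNbr (marks a₀) (quad a₀ x)
  obtain ⟨k, hk, hk2⟩ : ∃ k, 0 ≤ k ∧ k ^ 2 = a₀ - b :=
    ⟨_, Real.sqrt_nonneg _, Real.sq_sqrt (by linarith)⟩
  obtain ⟨l, hl, hl2⟩ : ∃ k, 0 ≤ k ∧ k ^ 2 = a₀ - a :=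
    ⟨_, Real.sqrt_nonneg _, Real.sq_sqrt (by linarith [hay.trans hya])⟩
  have hyx : quad a₀ x = a₀ - |x| ^ 2 := by simp [quad]
  have hkx : k < |x| := by
    apply lt_of_pow_lt_pow_left₀ 2 hX.le; linarith
  have hxl : |x| < l := by
    apply lt_of_pow_lt_pow_left₀ 2 hl; linarith
  have hl2' : l < 2 := by
    apply lt_of_pow_lt_pow_left₀ 2 (by norm_num); linarith [ha.2]
  -- no marked point other than `x` lies on the same side of `0` at a distance between `k` and `l`
  have hnone : ∀ s ∈ marks a₀, |s| ≠ |x| → k < |s| → ¬ |s| < l := by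
    intro s hs hne h1 h2
    have hs' := mem_postcritical_of_mem_marks hs (h2.trans hl2')
    have hsq : quad a₀ s = a₀ - |s| ^ 2 := by simp [quad]
    refine hgap _ (postcritical_subset_marks _ (quad_mem_postcritical hs')) ?_ ?_ ?_
    · intro h
      exact hne (by
        have : |s| ^ 2 = |x| ^ 2 := by linarith
        exact (pow_left_inj₀ (abs_nonneg _) (abs_nonneg _) two_ne_zero).1 this)
    · have : |s| ^ 2 < l ^ 2 := by gcongr
      linarith
    · have : k ^ 2 < |s| ^ 2 := by gcongr
      linarith
  obtain ⟨hpS, hpx⟩ := hS.lowerNbr_spec hx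
  obtain ⟨hqS, hqx⟩ := hS.upperNbr_spec hx
  refine ⟨|x| - k, l - |x|, by linarith, by linarith, ?_, ?_⟩
  · rcases lt_or_gt_of_ne hx0 with h | h
    · right
      rw [abs_of_neg h] at *
      constructor
      · by_contra! hc
        have h1 : |lowerNbr (marks a₀) x| = -lowerNbr (marks a₀) x := abs_of_neg (by linarith)
        exact hnone _ hpS (by rw [h1]; linarith) (by rw [h1]; linarith) (by rw [h1]; linarith)
      · by_contra! hc
        have h1 : |upperNbr (marks a₀) x| = -upperNbr (marks a₀) x := abs_of_neg (by linarith)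
        exact hnone _ hqS (by rw [h1]; linarith) (by rw [h1]; linarith) (by rw [h1]; linarith)
    · left
      rw [abs_of_pos h] at *
      constructor
      · by_contra! hc
        have h1 : |lowerNbr (marks a₀) x| = lowerNbr (marks a₀) x := abs_of_pos (by linarith)
        exact hnone _ hpS (by rw [h1]; linarith) (by rw [h1]; linarith) (by rw [h1]; linarith)
      · by_contra! hc
        have h1 : |upperNbr (marks a₀) x| = upperNbr (marks a₀) x := abs_of_pos (by linarith)
        exact hnone _ hqS (by rw [h1]; linarith) (by rw [h1]; linarith) (by rw [h1]; linarith)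
  · have h1 : quad a₀ x - a = (l - |x|) * (l + |x|) := by linarith
    have h2 : b - quad a₀ x = (|x| - k) * (|x| + k) := by linarith
    rw [h1, h2]
    have hu : 0 < |x| - k := by linarith
    have hv : 0 < l - |x| := by linarith
    have hw : 0 < l + |x| := by linarith
    have hz : 0 < |x| + k := by linarith
    have h3 : 2 * |x| * (((l - |x|) * (l + |x|))⁻¹ + ((|x| - k) * (|x| + k))⁻¹)
        = ((|x| - k)⁻¹ + (l - |x|)⁻¹) * (1 + (|x| - k) * (l - |x|) / ((l + |x|) * (|x| + k))) := by
      field_simp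
      ring
    rw [h3]
    gcongr
    nlinarith

theorem two_mul_abs_mul_hypDensity_gt {a₀ x : ℝ} (ha : a₀ ∈ Ioo (1 : ℝ) 2)
    (hpre : CriticalPreperiodic a₀) (hx0 : x ≠ 0) (hx : |x| < 2) (hy : -2 < quad a₀ x) :
    hypDensity (marks a₀) x < 2 * |x| * hypDensity (marks a₀) (quad a₀ x) := by
  obtain ⟨u, v, hu, hv, huv, h⟩ := exists_pullback_density ha hpre hx0 hx hy
  refine lt_of_lt_of_le ?_ h
  have h1 : hypDensity (marks a₀) x ≤ u⁻¹ + v⁻¹ := by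
    unfold hypDensity
    rcases huv with ⟨h2, h3⟩ | ⟨h2, h3⟩
    · exact add_le_add (inv_anti₀ hu h2) (inv_anti₀ hv h3)
    · rw [add_comm]
      exact add_le_add (inv_anti₀ hu h3) (inv_anti₀ hv h2)
  have h2 : 0 < u⁻¹ + v⁻¹ := by positivity
  have h3 : 0 < u * v := by positivity
  nlinarith

/-- Away from the marked points the expansion of the hyperbolic density is uniform. -/
theorem two_mul_abs_mul_hypDensity_ge {a₀ x r : ℝ} (ha : a₀ ∈ Ioo (1 : ℝ) 2)
    (hpre : CriticalPreperiodic a₀) (hx0 : x ≠ 0) (hx : |x| < 2) (hy : -2 < quad a₀ x)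
    (hr : 0 < r) (hr1 : r ≤ 1) (hrx : ∀ s ∈ marks a₀, r ≤ |x - s|) :
    (1 + r ^ 2 / 64) * hypDensity (marks a₀) x ≤
      2 * |x| * hypDensity (marks a₀) (quad a₀ x) := by
  have hS := marking_marks hpre
  obtain ⟨u, v, hu, hv, huv, h⟩ := exists_pullback_density ha hpre hx0 hx hy
  refine le_trans ?_ h
  have hp : r ≤ x - lowerNbr (marks a₀) x := by
    have h1 := hS.lowerNbr_spec hx
    simpa [abs_of_pos (sub_pos.2 h1.2)] using hrx _ h1.1
  have hq : r ≤ upperNbr (marks a₀) x - x := by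
    have h1 := hS.upperNbr_spec hx
    simpa [abs_of_neg (sub_neg.2 h1.2)] using hrx _ h1.1
  -- the statement for the distances `P`, `Q` of `x` to its neighbours, in the right order
  have key : ∀ P Q : ℝ, u ≤ P → v ≤ Q → r ≤ P → r ≤ Q →
      (1 + r ^ 2 / 64) * (P⁻¹ + Q⁻¹) ≤ (u⁻¹ + v⁻¹) * (1 + u * v / 16) := by
    intro P Q huP hvQ hrP hrQ
    have i1 := inv_anti₀ hu huP
    have i2 := inv_anti₀ hv hvQ
    have i3 := inv_anti₀ hr hrP
    have i4 := inv_anti₀ hr hrQ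
    have hP : 0 < P⁻¹ := inv_pos.2 (hu.trans_le huP)
    have hQ : 0 < Q⁻¹ := inv_pos.2 (hv.trans_le hvQ)
    have huv0 : 0 < u * v := by positivity
    have hr2 : r ^ 2 ≤ 1 := by nlinarith
    have small : ∀ w : ℝ, 0 < w → w < r / 2 → 2 * r⁻¹ ≤ w⁻¹ := by
      intro w hw hwr
      have := inv_anti₀ hw hwr.le
      have e : (r / 2)⁻¹ = 2 * r⁻¹ := by field_simp
      linarith
    by_cases hc : r / 2 ≤ u ∧ r / 2 ≤ v
    · have : (r / 2) * (r / 2) ≤ u * v := mul_le_mul hc.1 hc.2 (by positivity) hu.le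
      rw [mul_comm]
      refine mul_le_mul (add_le_add i1 i2) ?_ (by positivity) (by positivity)
      nlinarith
    · have h3 : 3 / 2 * (P⁻¹ + Q⁻¹) ≤ u⁻¹ + v⁻¹ := by
        rw [not_and_or, not_le, not_le] at hc
        rcases hc with hc | hc
        · have := small u hu hc
          linarith
        · have := small v hv hc
          linarith
      have h4 : 0 < u⁻¹ + v⁻¹ := by positivity
      nlinarith
  unfold hypDensity
  rcases huv with ⟨h2, h3⟩ | ⟨h2, h3⟩
  · exact key _ _ h2 h3 hp hq
  · rw [add_comm (x - _)⁻¹]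
    exact key _ _ h3 h2 hq hp

open Filter Topology

/-! ### An expanding metric adapted to the critical orbit -/

/-- The reciprocal of the hyperbolic density of the complement of `S`, extended by `0` to `S`. It is
comparable to the distance to `S`. -/
def hypRadius (S : Set ℝ) (x : ℝ) : ℝ :=
  open Classical in if x ∈ S then 0 else (hypDensity S x)⁻¹

section Marking

variable {S : Set ℝ} {x y : ℝ}

theorem hypRadius_of_mem (h : x ∈ S) : hypRadius S x = 0 := if_pos h

theorem hypRadius_of_notMem (h : x ∉ S) : hypRadius S x = (hypDensity S x)⁻¹ := if_neg h

theorem Marking.hypRadius_nonneg (hS : Marking S) (hx : |x| < 2) : 0 ≤ hypRadius S x := by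
  by_cases h : x ∈ S
  · rw [hypRadius_of_mem h]
  · rw [hypRadius_of_notMem h]
    exact inv_nonneg.2 (hS.hypDensity_pos hx).le

theorem Marking.hypRadius_le_dist (hS : Marking S) (hx : |x| < 2) {s : ℝ} (hs : s ∈ S) :
    hypRadius S x ≤ |x - s| := by
  by_cases h : x ∈ S
  · rw [hypRadius_of_mem h]; positivity
  · rw [hypRadius_of_notMem h, inv_le_iff_one_le_mul₀ (hS.hypDensity_pos hx)]
    exact hS.one_le_dist_mul_hypDensity hx hs (fun e => h (e ▸ hs))

theorem Marking.le_hypRadius (hS : Marking S) (hx : |x| < 2) {r : ℝ} (hr : 0 < r)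
    (h : ∀ s ∈ S, r ≤ |x - s|) : r / 2 ≤ hypRadius S x := by
  have hxS : x ∉ S := fun hxS => by
    have := h x hxS
    simp at this
    linarith
  rw [hypRadius_of_notMem hxS, le_inv_comm₀ (by positivity) (hS.hypDensity_pos hx), inv_div]
  exact hS.hypDensity_le hx hr h

theorem Marking.hypRadius_le_add (hS : Marking S) (hx : |x| < 2) (hy : |y| < 2) :
    hypRadius S y ≤ hypRadius S x + |y - x| := by
  have hn := hS.hypRadius_nonneg hx
  by_cases hs : ∃ s ∈ S, |y - s| ≤ |y - x|
  · obtain ⟨s, hs, h⟩ := hs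
    linarith [hS.hypRadius_le_dist hy hs]
  · push Not at hs
    have hyS : y ∉ S := fun h => by
      have := hs y h
      simp at this
      linarith [abs_nonneg (y - x)]
    have hxS : x ∉ S := fun h => lt_irrefl _ (hs x h)
    -- no marked point between `x` and `y`, so both have the same neighbours
    have hside : ∀ s ∈ S, (s < x ↔ s < y) := by
      intro s h
      have h1 := hs s h
      constructor <;> intro h2 <;> by_contra! h3 <;> refine absurd h1 (not_lt.2 ?_)
      · rw [abs_of_nonpos (by linarith), abs_of_nonpos (by linarith)]; linarith
      · rw [abs_of_nonneg (by linarith), abs_of_nonneg (by linarith)]; linarith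
    have e1 : lowerNbr S x = lowerNbr S y := by
      unfold lowerNbr
      congr 1
      ext s
      exact and_congr_right fun h => hside s h
    have e2 : upperNbr S x = upperNbr S y := by
      unfold upperNbr
      congr 1
      ext s
      refine and_congr_right fun h => ?_
      have h1 := hside s h
      have h2 : s ≠ x := fun e => hxS (e ▸ h)
      have h3 : s ≠ y := fun e => hyS (e ▸ h)
      constructor <;> intro h4
      · exact lt_of_le_of_ne (not_lt.1 fun h5 => absurd (h1.2 h5) (not_lt.2 h4.le)) h3.symm
      · exact lt_of_le_of_ne (not_lt.1 fun h5 => absurd (h1.1 h5) (not_lt.2 h4.le)) h2.symm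
    have a1 := (hS.lowerNbr_spec hx).2
    have a2 := (hS.upperNbr_spec hx).2
    have b1 := (hS.lowerNbr_spec hy).2
    have b2 := (hS.upperNbr_spec hy).2
    rw [hypRadius_of_notMem hxS, hypRadius_of_notMem hyS]
    unfold hypDensity
    rw [← e1] at b1 ⊢
    rw [← e2] at b2 ⊢
    set a := lowerNbr S x
    set b := upperNbr S x
    have hform : ∀ z, a < z → z < b → ((z - a)⁻¹ + (b - z)⁻¹)⁻¹ = (z - a) * (b - z) / (b - a) := by
      intro z h1 h2
      have : z - a ≠ 0 := (sub_pos.2 h1).ne'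
      have : b - z ≠ 0 := (sub_pos.2 h2).ne'
      rw [inv_add_inv (by assumption) (by assumption), inv_div]
      congr 1
      ring
    rw [hform x a1 a2, hform y b1 b2]
    have hab : 0 < b - a := by linarith
    rw [div_le_iff₀ hab, add_mul, div_mul_cancel₀ _ hab.ne']
    have h1 : (y - a) * (b - y) - (x - a) * (b - x) = (y - x) * (a + b - x - y) := by ring
    have h2 : |a + b - x - y| ≤ b - a := abs_le.2 ⟨by linarith, by linarith⟩
    have h3 : (y - x) * (a + b - x - y) ≤ |y - x| * (b - a) := by
      refine (le_abs_self _).trans ?_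
      rw [abs_mul]
      gcongr
    linarith

end Marking

theorem hypRadius_quad_le {a₀ x : ℝ} (ha : a₀ ∈ Ioo (1 : ℝ) 2) (hpre : CriticalPreperiodic a₀)
    (hx0 : x ≠ 0) (hx : |x| < 2) (hy : -2 < quad a₀ x) {c : ℝ}
    (hc : c * hypDensity (marks a₀) x ≤ 2 * |x| * hypDensity (marks a₀) (quad a₀ x)) :
    c * hypRadius (marks a₀) (quad a₀ x) ≤ 2 * |x| * hypRadius (marks a₀) x := by
  have hS := marking_marks hpre
  have hy2 : |quad a₀ x| < 2 := abs_lt.2 ⟨hy, by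
    simp only [quad]; nlinarith [ha.2, sq_nonneg x]⟩
  by_cases h : quad a₀ x ∈ marks a₀
  · rw [hypRadius_of_mem h, mul_zero]
    exact mul_nonneg (by positivity) (hS.hypRadius_nonneg hx)
  · have hxS : x ∉ marks a₀ := fun hm => h (postcritical_subset_marks _
      (quad_mem_postcritical (mem_postcritical_of_mem_marks hm hx)))
    rw [hypRadius_of_notMem h, hypRadius_of_notMem hxS]
    have h1 := hS.hypDensity_pos hx
    have h2 := hS.hypDensity_pos hy2
    rw [← div_eq_mul_inv, ← div_eq_mul_inv, div_le_div_iff₀ h2 h1]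
    exact hc

/-- `W` is a weight that is locally constant near the postcritical set and is increased by `h`
along that set, when measured with the derivative of `h`. The number `t` serves as a
scale, as a bound for `W` and `W⁻¹`, and as the gain of `W`. -/
structure IsWeight (a₀ t : ℝ) (W : ℝ → ℝ) : Prop where
  pos : 0 < t
  le_one : t ≤ 1
  le_weight : ∀ x, t ≤ W x
  weight_le : ∀ x, W x ≤ t⁻¹
  const : ∀ p ∈ postcritical a₀, ∀ x, |x - p| ≤ t → W x = W p
  gain : ∀ p ∈ postcritical a₀, ∀ x, |x - p| ≤ t → (1 + t) * W p ≤ 2 * |x| * W (quad a₀ p)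
  two_mul_le : ∀ s ∈ marks a₀, 2 * t ≤ |s|

theorem two_mul_le_abs_postcritical {a₀ t : ℝ} {W : ℝ → ℝ} (h : IsWeight a₀ t W) {p : ℝ}
    (hp : p ∈ postcritical a₀) : 2 * t ≤ |p| := h.two_mul_le p (postcritical_subset_marks _ hp)

/-- The hyperbolic density, with each postcritical point filled in, is a weight: this is the strict
Schwarz lemma at the postcritical points. In particular the postcritical cycle is repelling. -/
theorem exists_isWeight {a₀ : ℝ} (ha : a₀ ∈ Ioo (1 : ℝ) 2) (hpre : CriticalPreperiodic a₀) :
    ∃ t W, IsWeight a₀ t W := by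
  have hS := marking_marks hpre
  have hfin := postcritical_finite hpre
  have h0 := zero_notMem_postcritical hpre
  have hid : Tendsto (fun t : ℝ => t) (𝓝[>] 0) (𝓝 0) :=
    tendsto_nhdsWithin_of_tendsto_nhds tendsto_id
  have hpos : ∀ p ∈ postcritical a₀, 0 < hypDensity (marks a₀) p := fun p hp =>
    hS.hypDensity_pos (abs_lt_two_of_mem_postcritical ha hp)
  have e1 : ∀ᶠ t : ℝ in 𝓝[>] 0, ∀ p ∈ postcritical a₀, t ≤ hypDensity (marks a₀) p :=
    (hfin.eventually_all).2 fun p hp => (hid.eventually_lt_const (hpos p hp)).mono fun _ h => h.le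
  have e2 : ∀ᶠ t : ℝ in 𝓝[>] 0, ∀ p ∈ postcritical a₀, t ≤ (hypDensity (marks a₀) p)⁻¹ :=
    (hfin.eventually_all).2 fun p hp =>
      (hid.eventually_lt_const (inv_pos.2 (hpos p hp))).mono fun _ h => h.le
  have e3 : ∀ᶠ t : ℝ in 𝓝[>] 0, ∀ p ∈ postcritical a₀, ∀ q ∈ postcritical a₀, p ≠ q →
      2 * t < |p - q| := by
    refine (hfin.eventually_all).2 fun p _ => (hfin.eventually_all).2 fun q _ => ?_
    by_cases h : p = q
    · exact Eventually.of_forall fun _ h' => absurd h h'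
    · have h1 : Tendsto (fun t : ℝ => 2 * t) (𝓝[>] 0) (𝓝 (2 * 0)) := hid.const_mul 2
      refine (h1.eventually_lt_const (u := |p - q|) ?_).mono fun _ h _ => h
      simpa [sub_eq_zero] using h
  have e4 : ∀ᶠ t : ℝ in 𝓝[>] 0, ∀ p ∈ postcritical a₀,
      (1 + t) * hypDensity (marks a₀) p
        < 2 * (|p| - t) * hypDensity (marks a₀) (quad a₀ p) := by
    refine (hfin.eventually_all).2 fun p hp => ?_
    have h1 : Tendsto (fun t : ℝ => (1 + t) * hypDensity (marks a₀) p) (𝓝[>] 0)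
        (𝓝 ((1 + 0) * hypDensity (marks a₀) p)) := (hid.const_add 1).mul_const _
    have h2 : Tendsto (fun t : ℝ => 2 * (|p| - t) * hypDensity (marks a₀) (quad a₀ p)) (𝓝[>] 0)
        (𝓝 (2 * (|p| - 0) * hypDensity (marks a₀) (quad a₀ p))) :=
      ((hid.const_sub _).const_mul 2).mul_const _
    refine h1.eventually_lt h2 ?_
    rw [add_zero, one_mul, sub_zero]
    exact two_mul_abs_mul_hypDensity_gt ha hpre (fun e => h0 (e ▸ hp))
      (abs_lt_two_of_mem_postcritical ha hp)
      (abs_lt.1 (abs_lt_two_of_mem_postcritical ha (quad_mem_postcritical hp))).1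
  have e5 : ∀ᶠ t : ℝ in 𝓝[>] 0, ∀ s ∈ marks a₀, 2 * t ≤ |s| := by
    refine (hS.finite.eventually_all).2 fun s hs => ?_
    have h1 : Tendsto (fun t : ℝ => 2 * t) (𝓝[>] 0) (𝓝 (2 * 0)) := hid.const_mul 2
    refine (h1.eventually_lt_const (u := |s|) ?_).mono fun _ h => h.le
    rw [mul_zero, abs_pos]
    rintro rfl
    exact h0 (mem_postcritical_of_mem_marks hs (by norm_num))
  have e6 : ∀ᶠ t : ℝ in 𝓝[>] 0, t < 1 := hid.eventually_lt_const one_pos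
  obtain ⟨t, h1, h2, h3, h4, h5, h6, h7⟩ :=
    (e1.and (e2.and (e3.and (e4.and (e5.and (e6.and self_mem_nhdsWithin)))))).exists
  have h7 : 0 < t := h7
  classical
  let W : ℝ → ℝ := fun x => if h : ∃ p ∈ postcritical a₀, |x - p| ≤ t
    then hypDensity (marks a₀) h.choose else 1
  have hW : ∀ p ∈ postcritical a₀, ∀ x, |x - p| ≤ t → W x = hypDensity (marks a₀) p := by
    intro p hp x hx
    have hex : ∃ p ∈ postcritical a₀, |x - p| ≤ t := ⟨p, hp, hx⟩
    simp only [W, dif_pos hex]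
    congr 1
    by_contra hne
    have h8 := h3 _ hex.choose_spec.1 p hp hne
    have h9 := hex.choose_spec.2
    have : |hex.choose - p| ≤ |x - p| + |x - hex.choose| := by
      rw [show hex.choose - p = (x - p) - (x - hex.choose) by ring]
      exact abs_sub _ _
    linarith
  have hWp : ∀ p ∈ postcritical a₀, W p = hypDensity (marks a₀) p := fun p hp =>
    hW p hp p (by simpa using h7.le)
  refine ⟨t, W, h7, h6.le, fun x => ?_, fun x => ?_, fun p hp x hx => ?_, fun p hp x hx => ?_, h5⟩
  · by_cases h : ∃ p ∈ postcritical a₀, |x - p| ≤ t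
    · obtain ⟨p, hp, hx⟩ := h
      rw [hW p hp x hx]; exact h1 p hp
    · simp only [W, dif_neg h]; exact h6.le
  · by_cases h : ∃ p ∈ postcritical a₀, |x - p| ≤ t
    · obtain ⟨p, hp, hx⟩ := h
      rw [hW p hp x hx, le_inv_comm₀ (hpos p hp) h7]; exact h2 p hp
    · simp only [W, dif_neg h]; exact (one_le_inv₀ h7).2 h6.le
  · rw [hW p hp x hx, hWp p hp]
  · rw [hWp p hp, hWp _ (quad_mem_postcritical hp)]
    refine (h4 p hp).le.trans ?_
    have h8 : |p| - t ≤ |x| := by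
      have := abs_sub_abs_le_abs_sub p x
      rw [abs_sub_comm] at this
      linarith
    have := (hpos _ (quad_mem_postcritical hp)).le
    gcongr

/-- The hyperbolic radius, kept away from `0` at the scale `ε` of the perturbation. -/
def softRadius (a₀ t : ℝ) (W : ℝ → ℝ) (ε x : ℝ) : ℝ :=
  hypRadius (marks a₀) x + ε / (t ^ 2 * W x)

/-- A density with the singularity `|x - p| ^ (-α)` at the postcritical points `p`, softened at
scale `ε`. -/
def density (a₀ t : ℝ) (W : ℝ → ℝ) (α ε x : ℝ) : ℝ :=
  W x ^ (1 - α) * softRadius a₀ t W ε x ^ (-α)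

/-- Interpolation between the expansion of two densities `W` and `1 / D`. -/
theorem rpow_mul_rpow_expand {X Wx Wy Dx Dy μ ν α : ℝ} (hX : 0 < X) (hWx : 0 < Wx) (hWy : 0 < Wy)
    (hDx : 0 < Dx) (hDy : 0 < Dy) (hμ : 0 < μ) (hν : 0 < ν) (hα0 : 0 ≤ α) (hα1 : α ≤ 1)
    (hW : ν * Wx ≤ X * Wy) (hD : μ * Dy ≤ X * Dx) :
    ν ^ (1 - α) * μ ^ α * (Wx ^ (1 - α) * Dx ^ (-α)) ≤ X * (Wy ^ (1 - α) * Dy ^ (-α)) := by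
  have h1 : ν ^ (1 - α) * Wx ^ (1 - α) ≤ X ^ (1 - α) * Wy ^ (1 - α) := by
    rw [← Real.mul_rpow hν.le hWx.le, ← Real.mul_rpow hX.le hWy.le]
    exact Real.rpow_le_rpow (by positivity) hW (by linarith)
  have h2 : μ ^ α * Dx ^ (-α) ≤ X ^ α * Dy ^ (-α) := by
    have h3 : μ ^ α * Dy ^ α ≤ X ^ α * Dx ^ α := by
      rw [← Real.mul_rpow hμ.le hDy.le, ← Real.mul_rpow hX.le hDx.le]
      exact Real.rpow_le_rpow (by positivity) hD hα0
    rw [Real.rpow_neg hDx.le, Real.rpow_neg hDy.le, ← div_eq_mul_inv, ← div_eq_mul_inv,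
      div_le_div_iff₀ (by positivity) (by positivity)]
    exact h3
  have hXX : X ^ (1 - α) * X ^ α = X := by
    rw [← Real.rpow_add hX]; simp
  calc ν ^ (1 - α) * μ ^ α * (Wx ^ (1 - α) * Dx ^ (-α))
      = (ν ^ (1 - α) * Wx ^ (1 - α)) * (μ ^ α * Dx ^ (-α)) := by ring
    _ ≤ (X ^ (1 - α) * Wy ^ (1 - α)) * (X ^ α * Dy ^ (-α)) :=
        mul_le_mul h1 h2 (by positivity) (by positivity)
    _ = (X ^ (1 - α) * X ^ α) * (Wy ^ (1 - α) * Dy ^ (-α)) := by ring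
    _ = _ := by rw [hXX]

section Density

variable {a₀ t α ε x y : ℝ} {W : ℝ → ℝ}

theorem IsWeight.weight_pos (h : IsWeight a₀ t W) (x : ℝ) : 0 < W x :=
  h.pos.trans_le (h.le_weight x)

theorem softRadius_le (h : IsWeight a₀ t W) (hε : 0 < ε) (x : ℝ) :
    softRadius a₀ t W ε x ≤ hypRadius (marks a₀) x + ε / t ^ 3 := by
  unfold softRadius
  have := h.le_weight x
  have := h.pos
  gcongr
  nlinarith [sq_nonneg t]

theorem le_softRadius (hpre : CriticalPreperiodic a₀) (h : IsWeight a₀ t W) (hε : 0 < ε)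
    (hx : |x| < 2) : ε / t ≤ softRadius a₀ t W ε x := by
  unfold softRadius
  have h1 := (marking_marks hpre).hypRadius_nonneg hx
  have h2 : ε / t ≤ ε / (t ^ 2 * W x) := by
    have := h.weight_le x
    have := h.weight_pos x
    have := h.pos
    have h3 : t ^ 2 * W x ≤ t ^ 2 * t⁻¹ := by gcongr
    have h4 : t ^ 2 * t⁻¹ = t := by field_simp
    gcongr
    linarith
  linarith

theorem softRadius_pos (hpre : CriticalPreperiodic a₀) (h : IsWeight a₀ t W) (hε : 0 < ε)
    (hx : |x| < 2) : 0 < softRadius a₀ t W ε x :=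
  (div_pos hε h.pos).trans_le (le_softRadius hpre h hε hx)

/-- Near the postcritical set the density is expanded because the weight is. -/
theorem density_expand_near (ha : a₀ ∈ Ioo (1 : ℝ) 2) (hpre : CriticalPreperiodic a₀)
    (h : IsWeight a₀ t W) (hα0 : 0 ≤ α) (hα1 : α ≤ 1) (hε : 0 < ε) (hεt : ε ≤ t / 8)
    (hx : |x| < 2) (hy : |y| < 2) (hxy : |y - quad a₀ x| ≤ ε) (hq : -2 < quad a₀ x) {p : ℝ}
    (hp : p ∈ postcritical a₀) (hxp : |x - p| ≤ t / 8) :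
    (1 + t) ^ (1 - α) * density a₀ t W α ε x ≤ 2 * |x| * density a₀ t W α ε y := by
  have hS := marking_marks hpre
  have ht := h.pos
  have hpa := two_mul_le_abs_postcritical h hp
  have hx0 : 0 < |x| := by
    have := abs_sub_abs_le_abs_sub p x
    rw [abs_sub_comm] at this
    linarith
  have hp2 := abs_lt_two_of_mem_postcritical ha hp
  have hyp : |y - quad a₀ p| ≤ t := by
    have h1 : |quad a₀ x - quad a₀ p| ≤ 4 * (t / 8) := by
      have : quad a₀ x - quad a₀ p = -((x + p) * (x - p)) := by simp only [quad]; ring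
      rw [this, abs_neg, abs_mul]
      have h2 : |x + p| ≤ 4 := (abs_add_le _ _).trans (by linarith)
      gcongr
    have := abs_sub_le y (quad a₀ x) (quad a₀ p)
    linarith
  have hWx : W x = W p := h.const p hp x (by linarith)
  have hWy : W y = W (quad a₀ p) := h.const _ (quad_mem_postcritical hp) y hyp
  have hgain := h.gain p hp x (by linarith)
  have hWp := h.weight_pos p
  have hWq := h.weight_pos (quad a₀ p)
  have hrad : hypRadius (marks a₀) y ≤ 2 * |x| * hypRadius (marks a₀) x + ε := by
    have hq2 : |quad a₀ x| < 2 := abs_lt.2 ⟨hq, by simp only [quad]; nlinarith [ha.2, sq_nonneg x]⟩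
    have h1 := hS.hypRadius_le_add hq2 hy
    have h2 := hypRadius_quad_le ha hpre (abs_pos.1 hx0) hx hq (c := 1) (by
      rw [one_mul]; exact (two_mul_abs_mul_hypDensity_gt ha hpre (abs_pos.1 hx0) hx hq).le)
    linarith
  have hsoft : 1 * softRadius a₀ t W ε y ≤ 2 * |x| * softRadius a₀ t W ε x := by
    unfold softRadius
    rw [hWx, hWy, one_mul, mul_add]
    have h1 : ε + ε / (t ^ 2 * W (quad a₀ p)) ≤ 2 * |x| * (ε / (t ^ 2 * W p)) := by
      have h2 : t * W (quad a₀ p) ≤ 1 := by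
        have := h.weight_le (quad a₀ p)
        calc t * W (quad a₀ p) ≤ t * t⁻¹ := by gcongr
          _ = 1 := mul_inv_cancel₀ ht.ne'
      have h3 : ε + ε / (t ^ 2 * W (quad a₀ p))
          = ε * (1 + t * (t * W (quad a₀ p))) / (t ^ 2 * W (quad a₀ p)) := by
        field_simp; ring
      have h4 : 2 * |x| * (ε / (t ^ 2 * W p)) = ε * (2 * |x|) / (t ^ 2 * W p) := by ring
      rw [h3, h4, div_le_div_iff₀ (by positivity) (by positivity)]
      have h5 : (1 + t * (t * W (quad a₀ p))) * W p ≤ 2 * |x| * W (quad a₀ p) := by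
        refine le_trans ?_ hgain
        gcongr
        nlinarith
      have h6 : 0 ≤ ε * t ^ 2 := by positivity
      nlinarith [mul_le_mul_of_nonneg_left h5 h6]
    linarith
  have key := rpow_mul_rpow_expand (α := α) (by positivity : 0 < 2 * |x|) (h.weight_pos x)
    (h.weight_pos y) (softRadius_pos hpre h hε hx) (softRadius_pos hpre h hε hy) one_pos
    (by linarith : 0 < 1 + t) hα0 hα1 (by rw [hWx, hWy]; exact hgain) hsoft
  rwa [Real.one_rpow, mul_one] at key

/-- Away from the postcritical set and from the critical point, the density is expanded because the
hyperbolic density is. -/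
theorem density_expand_middle (ha : a₀ ∈ Ioo (1 : ℝ) 2) (hpre : CriticalPreperiodic a₀)
    (h : IsWeight a₀ t W) (hα0 : 0 ≤ α) (hα1 : α ≤ 1) {r δ : ℝ} (hδ : 0 < δ) (hr : 0 < r)
    (hr1 : r ≤ 1) (hε : 0 < ε) (hεr : (1 + (t ^ 3)⁻¹) * ε ≤ δ * r ^ 3 / 512)
    (hx : |x| < 2) (hy : |y| < 2) (hxy : |y - quad a₀ x| ≤ ε) (hq : -2 < quad a₀ x)
    (hδx : δ ≤ |x|) (hrx : ∀ s ∈ marks a₀, r ≤ |x - s|) :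
    (2 * δ * t ^ 2) ^ (1 - α) * (1 + r ^ 2 / 128) ^ α * density a₀ t W α ε x ≤
      2 * |x| * density a₀ t W α ε y := by
  have hS := marking_marks hpre
  have ht := h.pos
  have hx0 : 0 < |x| := hδ.trans_le hδx
  have hq2 : |quad a₀ x| < 2 := abs_lt.2 ⟨hq, by simp only [quad]; nlinarith [ha.2, sq_nonneg x]⟩
  have h1 := hS.hypRadius_le_add hq2 hy
  have h2 := hypRadius_quad_le ha hpre (abs_pos.1 hx0) hx hq
    (two_mul_abs_mul_hypDensity_ge ha hpre (abs_pos.1 hx0) hx hq hr hr1 hrx)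
  have h3 := hS.le_hypRadius hx hr hrx
  have h4 := softRadius_le h hε y
  have h5 : hypRadius (marks a₀) x ≤ softRadius a₀ t W ε x := by
    unfold softRadius
    have := h.weight_pos x
    have : 0 < ε / (t ^ 2 * W x) := by positivity
    linarith
  have h6 := hS.hypRadius_nonneg hq2
  refine rpow_mul_rpow_expand (by positivity) (h.weight_pos x)
    (h.weight_pos y) (softRadius_pos hpre h hε hx) (softRadius_pos hpre h hε hy) (by positivity)
    (by positivity) hα0 hα1 ?_ ?_
  · calc 2 * δ * t ^ 2 * W x ≤ 2 * δ * t ^ 2 * t⁻¹ := by gcongr; exact h.weight_le x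
      _ = 2 * δ * t := by field_simp
      _ ≤ 2 * |x| * W y := by gcongr; exact h.le_weight y
  · refine le_trans ?_ (mul_le_mul_of_nonneg_left h5 (by positivity))
    have h7 : softRadius a₀ t W ε y ≤ hypRadius (marks a₀) (quad a₀ x) + δ * r ^ 3 / 512 := by
      have : ε / t ^ 3 = (t ^ 3)⁻¹ * ε := by rw [div_eq_inv_mul]
      linarith
    have h8 : δ * r ≤ 2 * |x| * hypRadius (marks a₀) x := by
      calc δ * r = 2 * δ * (r / 2) := by ring
        _ ≤ _ := by gcongr
    set n := hypRadius (marks a₀) (quad a₀ x)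
    set E := 2 * |x| * hypRadius (marks a₀) x
    have hr2 : r ^ 2 ≤ 1 := by nlinarith
    have h9 : (1 + r ^ 2 / 128) * softRadius a₀ t W ε y ≤
        (1 + r ^ 2 / 128) * (n + E * r ^ 2 / 512) := by
      gcongr
      have : δ * r ^ 3 / 512 = (δ * r) * r ^ 2 / 512 := by ring
      rw [this] at h7
      have : (δ * r) * r ^ 2 / 512 ≤ E * r ^ 2 / 512 := by gcongr
      linarith
    refine h9.trans ?_
    have hE : 0 ≤ E := mul_nonneg (by positivity) (hS.hypRadius_nonneg hx)
    have hn : n ≤ E / (1 + r ^ 2 / 64) := by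
      rw [le_div_iff₀ (by positivity), mul_comm]; exact h2
    calc (1 + r ^ 2 / 128) * (n + E * r ^ 2 / 512)
        ≤ (1 + r ^ 2 / 128) * (E / (1 + r ^ 2 / 64) + E * r ^ 2 / 512) := by gcongr
      _ = E * ((1 + r ^ 2 / 128) * (1 / (1 + r ^ 2 / 64) + r ^ 2 / 512)) := by ring
      _ ≤ E * 1 := by
        gcongr
        have h10 : 1 / (1 + r ^ 2 / 64) + r ^ 2 / 512 ≤ 1 / (1 + r ^ 2 / 128) := by
          rw [div_add' _ _ _ (by positivity), div_le_div_iff₀ (by positivity) (by positivity)]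
          nlinarith [sq_nonneg r, sq_nonneg (r ^ 2), mul_nonneg (sq_nonneg r) (sq_nonneg (r ^ 2)),
            mul_le_mul_of_nonneg_left hr2 (sq_nonneg r),
            mul_le_mul_of_nonneg_left hr2 (mul_nonneg (sq_nonneg r) (sq_nonneg r))]
        calc (1 + r ^ 2 / 128) * (1 / (1 + r ^ 2 / 64) + r ^ 2 / 512)
            ≤ (1 + r ^ 2 / 128) * (1 / (1 + r ^ 2 / 128)) := by gcongr
          _ = 1 := by field_simp
      _ = E := mul_one E

theorem density_le_of_abs_le (hpre : CriticalPreperiodic a₀)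
    (h : IsWeight a₀ t W) (hα0 : 0 ≤ α) (hα1 : α ≤ 1) (hε : 0 < ε) (hx : |x| ≤ t) :
    density a₀ t W α ε x ≤ 2 / t ^ 2 := by
  have hS := marking_marks hpre
  have ht := h.pos
  have ht1 := h.le_one
  have hx2 : |x| < 2 := by linarith
  have h1 : t / 2 ≤ softRadius a₀ t W ε x := by
    have h2 := hS.le_hypRadius hx2 ht fun s hs => by
      have := h.two_mul_le s hs
      have := abs_sub_abs_le_abs_sub s x
      rw [abs_sub_comm] at this
      linarith
    have := h.weight_pos x
    have : 0 < ε / (t ^ 2 * W x) := by positivity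
    unfold softRadius
    linarith
  have h2 : W x ^ (1 - α) ≤ t⁻¹ := by
    calc W x ^ (1 - α) ≤ (t⁻¹) ^ (1 - α) :=
          Real.rpow_le_rpow (h.weight_pos x).le (h.weight_le x) (by linarith)
      _ ≤ (t⁻¹) ^ (1 : ℝ) :=
          Real.rpow_le_rpow_of_exponent_le ((one_le_inv₀ ht).2 ht1) (by linarith)
      _ = _ := Real.rpow_one _
  have h3 : softRadius a₀ t W ε x ^ (-α) ≤ (t / 2)⁻¹ := by
    calc softRadius a₀ t W ε x ^ (-α) ≤ (t / 2) ^ (-α) :=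
          Real.rpow_le_rpow_of_nonpos (by positivity) h1 (by linarith)
      _ ≤ (t / 2) ^ (-1 : ℝ) :=
          Real.rpow_le_rpow_of_exponent_ge (by positivity) (by linarith) (by linarith)
      _ = _ := Real.rpow_neg_one _
  have hs := softRadius_pos hpre h hε hx2
  calc density a₀ t W α ε x ≤ t⁻¹ * (t / 2)⁻¹ :=
        mul_le_mul h2 h3 (by positivity) (by positivity)
    _ = _ := by field_simp

/-- The density at the image of a point close to the critical point is large. -/
theorem density_ge_near_critical_value (hpre : CriticalPreperiodic a₀)
    (h : IsWeight a₀ t W) (hα0 : 0 ≤ α) (hα1 : α ≤ 1) (hε : 0 < ε)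
    (hy : |y| < 2) (hxy : |y - quad a₀ x| ≤ ε) {B : ℝ}
    (hB : x ^ 2 + (1 + (t ^ 3)⁻¹) * ε ≤ B) :
    t * B ^ (-α) ≤ density a₀ t W α ε y := by
  have hS := marking_marks hpre
  have ht := h.pos
  have h1 : |y - a₀| ≤ x ^ 2 + ε := by
    have h2 := abs_sub_le y (quad a₀ x) a₀
    have h3 : |quad a₀ x - a₀| = x ^ 2 := by simp [quad]
    linarith
  have h2 := hS.hypRadius_le_dist hy
    (postcritical_subset_marks _ (critical_value_mem_postcritical a₀))
  have h3 := softRadius_le h hε y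
  have h4 : softRadius a₀ t W ε y ≤ B := by
    have : ε / t ^ 3 = (t ^ 3)⁻¹ * ε := by rw [div_eq_inv_mul]
    linarith
  have hs := softRadius_pos hpre h hε hy
  unfold density
  refine mul_le_mul ?_ (Real.rpow_le_rpow_of_nonpos hs h4 (by linarith))
    (Real.rpow_nonneg (hs.le.trans h4) _) (Real.rpow_nonneg (h.weight_pos y).le _)
  calc t = t ^ (1 : ℝ) := (Real.rpow_one t).symm
    _ ≤ t ^ (1 - α) := Real.rpow_le_rpow_of_exponent_ge ht h.le_one (by linarith)
    _ ≤ _ := Real.rpow_le_rpow ht.le (h.le_weight y) (by linarith)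

end Density

/-- The metric `ρ |dx|` on `(-2, 2)` is expanded by the factor `lam` at every step of an orbit of
an `ε`-perturbation of `h` in `[-b, b]` that is at a distance at least `c` from the critical
point, and by the factor `Lam` if that distance is also at most `10 √ε`. -/
structure IsExpanding (a₀ b ε c lam Lam κ C M : ℝ) (ρ : ℝ → ℝ) : Prop where
  le : ∀ x, |x| < 2 → κ ≤ ρ x
  le_bound : ∀ x, |x| < 2 → ρ x ≤ M
  le_near : ∀ x, |x| ≤ 10 * √ε → ρ x ≤ C
  expand : ∀ x y, |x| ≤ b → |y| ≤ b → |y - quad a₀ x| ≤ ε → c ≤ |x| → lam * ρ x ≤ 2 * |x| * ρ y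
  expand_near : ∀ x y, |x| ≤ b → |y| ≤ b → |y - quad a₀ x| ≤ ε → c ≤ |x| → |x| ≤ 10 * √ε →
    Lam * ρ x ≤ 2 * |x| * ρ y

/-- Next to the critical point, at distances at which the perturbation is not felt, the singularity
of order `α > 1 / 2` at the critical value makes up for the small derivative. -/
theorem density_expand_near_critical_point {a₀ t α ε x y : ℝ} {W : ℝ → ℝ}
    (hpre : CriticalPreperiodic a₀)
    (h : IsWeight a₀ t W) (hα0 : 3 / 4 ≤ α) (hα1 : α ≤ 1) (hε : 0 < ε)
    (hy : |y| < 2) (hxy : |y - quad a₀ x| ≤ ε) (hx : |x| ≤ t ^ 12 / 36) (hεx : ε ≤ x ^ 2) :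
    2 * density a₀ t W α ε x ≤ 2 * |x| * density a₀ t W α ε y := by
  have ht := h.pos
  have ht1 := h.le_one
  have hx0 : 0 < |x| := by
    apply abs_pos.2
    rintro rfl
    norm_num at hεx
    linarith
  have ht12 : t ^ 12 ≤ t := pow_le_of_le_one ht.le ht1 (by norm_num)
  have hxt : |x| ≤ t := by linarith
  have hx1 : |x| ≤ 1 := hxt.trans ht1
  have h1 := density_le_of_abs_le hpre h (by linarith) hα1 hε hxt
  set G : ℝ := 2 + (t ^ 3)⁻¹ with hG
  have hG1 : 1 ≤ G := by
    have : 0 < (t ^ 3)⁻¹ := by positivity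
    linarith
  have h2 := density_ge_near_critical_value (α := α) (B := G * x ^ 2) hpre h (by linarith) hα1 hε hy hxy (by
    have : (1 + (t ^ 3)⁻¹) * ε ≤ (1 + (t ^ 3)⁻¹) * x ^ 2 := by gcongr
    rw [hG]; linarith)
  have h3 : (G * x ^ 2) ^ α ≤ G * (|x| * √|x|) := by
    rw [Real.mul_rpow (by linarith) (by positivity)]
    refine mul_le_mul ?_ ?_ (by positivity) (by linarith)
    · calc G ^ α ≤ G ^ (1 : ℝ) := Real.rpow_le_rpow_of_exponent_le hG1 hα1
        _ = G := Real.rpow_one G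
    · rw [← sq_abs, ← Real.rpow_natCast, ← Real.rpow_mul hx0.le, Real.sqrt_eq_rpow,
        show |x| * |x| ^ (1 / 2 : ℝ) = |x| ^ (1 + 1 / 2 : ℝ) by
          rw [Real.rpow_add hx0, Real.rpow_one]]
      apply Real.rpow_le_rpow_of_exponent_ge hx0 hx1
      push_cast
      linarith
  have h4 : √|x| ≤ t ^ 6 / 6 := by
    rw [Real.sqrt_le_left (by positivity)]
    calc |x| ≤ t ^ 12 / 36 := hx
      _ = _ := by ring
  have hs : 0 < √|x| := Real.sqrt_pos.2 hx0
  have h5 : (G * (|x| * √|x|))⁻¹ ≤ (G * x ^ 2) ^ (-α) := by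
    have hx2 : 0 < x ^ 2 := hε.trans_le hεx
    rw [Real.rpow_neg (by positivity)]
    exact inv_anti₀ (by positivity) h3
  have h6 : 2 * (2 / t ^ 2) ≤ 2 * |x| * (t * (G * (|x| * √|x|))⁻¹) := by
    have e : 2 * |x| * (t * (G * (|x| * √|x|))⁻¹) = 2 * t / (G * √|x|) := by field_simp
    rw [e, mul_div_assoc', div_le_div_iff₀ (by positivity) (by positivity)]
    have hGt : G * t ^ 3 ≤ 3 := by
      have e2 : G * t ^ 3 = 2 * t ^ 3 + 1 := by rw [hG]; field_simp
      have : t ^ 3 ≤ 1 := pow_le_one₀ ht.le ht1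
      linarith
    calc 2 * 2 * (G * √|x|) ≤ 2 * 2 * (G * (t ^ 6 / 6)) := by gcongr
      _ = 2 / 3 * t ^ 3 * (G * t ^ 3) := by ring
      _ ≤ 2 / 3 * t ^ 3 * 3 := by gcongr
      _ = 2 * t * t ^ 2 := by ring
  calc 2 * density a₀ t W α ε x ≤ 2 * (2 / t ^ 2) := by gcongr
    _ ≤ _ := h6
    _ ≤ 2 * |x| * (t * (G * x ^ 2) ^ (-α)) := by gcongr
    _ ≤ _ := by gcongr

/-- At distance between `c ε ^ θ` and `10 √ε` from the critical point, the density at the image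
is at least of order `ε ^ (-α)`, and the expansion at least of order `ε ^ (θ - α)`. -/
theorem density_expand_core {a₀ t α ε x y c θ Lam : ℝ} {W : ℝ → ℝ}
    (hpre : CriticalPreperiodic a₀)
    (h : IsWeight a₀ t W) (hα0 : 0 ≤ α) (hα1 : α ≤ 1) (hε : 0 < ε) (hc : 0 < c) (hLam : 0 < Lam)
    (hy : |y| < 2) (hxy : |y - quad a₀ x| ≤ ε) (hxt : |x| ≤ t) (hx : |x| ≤ 10 * √ε)
    (hcx : c * ε ^ θ ≤ |x|)
    (hsmall : ε ^ (α - θ) ≤ c * t ^ 3 / (Lam * (101 + (t ^ 3)⁻¹))) :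
    Lam * density a₀ t W α ε x ≤ 2 * |x| * density a₀ t W α ε y := by
  have ht := h.pos
  have h1 := density_le_of_abs_le hpre h hα0 hα1 hε hxt
  set G : ℝ := 101 + (t ^ 3)⁻¹ with hG
  have hG1 : 1 ≤ G := by
    have : 0 < (t ^ 3)⁻¹ := by positivity
    linarith
  have hx2 : x ^ 2 ≤ 100 * ε := by
    calc x ^ 2 = |x| ^ 2 := (sq_abs x).symm
      _ ≤ (10 * √ε) ^ 2 := by gcongr
      _ = _ := by rw [mul_pow, Real.sq_sqrt hε.le]; norm_num
  have h2 := density_ge_near_critical_value (α := α) (B := G * ε) hpre h hα0 hα1 hε hy hxy (by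
    rw [hG]; linarith)
  have h3 : (G * ε) ^ α ≤ G * ε ^ α := by
    rw [Real.mul_rpow (by linarith) hε.le]
    gcongr
    calc G ^ α ≤ G ^ (1 : ℝ) := Real.rpow_le_rpow_of_exponent_le hG1 hα1
        _ = G := Real.rpow_one G
  have h5 : (G * ε ^ α)⁻¹ ≤ (G * ε) ^ (-α) := by
    rw [Real.rpow_neg (by positivity)]
    exact inv_anti₀ (by positivity) h3
  have hαθ : ε ^ α = ε ^ θ * ε ^ (α - θ) := by rw [← Real.rpow_add hε]; congr 1; ring
  have h6 : Lam * (2 / t ^ 2) ≤ 2 * (c * ε ^ θ) * (t * (G * ε ^ α)⁻¹) := by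
    have e : 2 * (c * ε ^ θ) * (t * (G * ε ^ α)⁻¹) = 2 * c * t / (G * ε ^ (α - θ)) := by
      rw [hαθ]; field_simp
    rw [e, mul_div_assoc', div_le_div_iff₀ (by positivity) (by positivity)]
    calc Lam * 2 * (G * ε ^ (α - θ)) ≤ Lam * 2 * (G * (c * t ^ 3 / (Lam * G))) := by gcongr
      _ = 2 * c * t * t ^ 2 := by field_simp
  calc Lam * density a₀ t W α ε x ≤ Lam * (2 / t ^ 2) := by gcongr
    _ ≤ _ := h6
    _ ≤ 2 * |x| * (t * (G * ε) ^ (-α)) := by gcongr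
    _ ≤ _ := by gcongr

/-- The expanding metric. Its rate `lam` and its bounds on `(-2, 2)` from below and next to the
critical point from above do not depend on `ε`; the constants `c` and `Lam`, chosen afterwards, may
be as small and as large as needed, provided that `ε` is small. -/
theorem exists_isExpanding {a₀ b θ : ℝ} (ha : a₀ ∈ Ioo (1 : ℝ) 2) (hpre : CriticalPreperiodic a₀)
    (hb : b < 2) (hθ : θ < 1) :
    ∃ lam κ C : ℝ, 1 < lam ∧ 0 < κ ∧ 0 < C ∧ ∀ c Lam : ℝ, 0 < c → ∀ᶠ ε in 𝓝[>] (0 : ℝ),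
      ∃ (ρ : ℝ → ℝ) (M : ℝ), IsExpanding a₀ b ε (c * ε ^ θ) lam Lam κ C M ρ := by
  have hS := marking_marks hpre
  obtain ⟨t, W, h⟩ := exists_isWeight ha hpre
  have ht := h.pos
  have ht1 := h.le_one
  set δ : ℝ := t ^ 12 / 36 with hδdef
  have hδ : 0 < δ := by positivity
  have hδt : δ ≤ t := by
    have : t ^ 12 ≤ t := pow_le_of_le_one ht.le ht1 (by norm_num)
    linarith
  set r : ℝ := min (t / 8) (2 - b) with hrdef
  have hr : 0 < r := lt_min (by positivity) (by linarith)
  have hr1 : r ≤ 1 := (min_le_left _ _).trans (by linarith)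
  -- the exponent of the singularities, close to `1`
  obtain ⟨α, hα1, hα0, hαθ, hαm⟩ : ∃ α : ℝ, α < 1 ∧ 3 / 4 < α ∧ θ < α ∧
      1 < (2 * δ * t ^ 2) ^ (1 - α) * (1 + r ^ 2 / 128) ^ α := by
    have hid : Tendsto (fun t : ℝ => t) (𝓝[<] 1) (𝓝 1) :=
      tendsto_nhdsWithin_of_tendsto_nhds tendsto_id
    have hcont : Tendsto (fun α : ℝ => (2 * δ * t ^ 2) ^ (1 - α) * (1 + r ^ 2 / 128) ^ α) (𝓝[<] 1)
        (𝓝 ((2 * δ * t ^ 2) ^ (1 - 1 : ℝ) * (1 + r ^ 2 / 128) ^ (1 : ℝ))) :=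
      (tendsto_const_nhds.rpow (hid.const_sub 1) (Or.inl (by positivity))).mul
        (tendsto_const_nhds.rpow hid (Or.inl (by positivity)))
    rw [sub_self, Real.rpow_zero, Real.rpow_one, one_mul] at hcont
    have e1 := hcont.eventually_const_lt (u := 1) (by
      have : 0 < r ^ 2 / 128 := by positivity
      linarith)
    obtain ⟨α, h1, h2, h3, h4⟩ := (e1.and ((hid.eventually_const_lt (u := 3 / 4) (by norm_num)).and
      ((hid.eventually_const_lt hθ).and self_mem_nhdsWithin))).exists
    exact ⟨α, h4, h2, h3, h1⟩
  have hαnn : 0 ≤ α := by linarith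
  have hα1' := hα1.le
  have hnear : 1 < (1 + t) ^ (1 - α) := Real.one_lt_rpow (by linarith) (by linarith)
  refine ⟨min 2 (min ((1 + t) ^ (1 - α)) ((2 * δ * t ^ 2) ^ (1 - α) * (1 + r ^ 2 / 128) ^ α)),
    t * (5 + (t ^ 3)⁻¹)⁻¹, 2 / t ^ 2, lt_min (by norm_num) (lt_min hnear hαm), by positivity,
    by positivity, fun c Lam hc => ?_⟩
  have hid : Tendsto (fun t : ℝ => t) (𝓝[>] 0) (𝓝 0) :=
    tendsto_nhdsWithin_of_tendsto_nhds tendsto_id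
  have hL : 0 < max Lam 2 := lt_of_lt_of_le two_pos (le_max_right _ _)
  have e1 := hid.eventually_lt_const (u := t / 8) (by positivity)
  have e2 := hid.eventually_lt_const (u := 2 - b) (by linarith)
  have e3 : ∀ᶠ ε : ℝ in 𝓝[>] 0, (1 + (t ^ 3)⁻¹) * ε < δ * r ^ 3 / 512 := by
    have := hid.const_mul (1 + (t ^ 3)⁻¹)
    rw [mul_zero] at this
    exact this.eventually_lt_const (by positivity)
  have e4 : ∀ᶠ ε : ℝ in 𝓝[>] 0, 10 * √ε < δ := by
    have := (Real.continuous_sqrt.tendsto 0).comp hid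
    have := this.const_mul 10
    rw [Real.sqrt_zero, mul_zero] at this
    exact this.eventually_lt_const hδ
  have e5 : ∀ᶠ ε : ℝ in 𝓝[>] 0,
      ε ^ (α - θ) < c * t ^ 3 / (max Lam 2 * (101 + (t ^ 3)⁻¹)) := by
    have h1 : Tendsto (fun ε : ℝ => ε ^ (α - θ)) (𝓝[>] 0) (𝓝 (0 ^ (α - θ))) :=
      hid.rpow_const (Or.inr (by linarith))
    rw [Real.zero_rpow (by linarith)] at h1
    exact h1.eventually_lt_const (by positivity)
  filter_upwards [e1, e2, e3, e4, e5, self_mem_nhdsWithin] with ε h1 h2 h3 h4 h5 hε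
  have hε : 0 < ε := hε
  have hcore : ∀ x y, |x| ≤ b → |y| ≤ b → |y - quad a₀ x| ≤ ε → c * ε ^ θ ≤ |x| →
      |x| ≤ 10 * √ε →
      max Lam 2 * density a₀ t W α ε x ≤ 2 * |x| * density a₀ t W α ε y :=
    fun x y hx hy hxy hcx hxε => density_expand_core hpre h hαnn hα1' hε hc hL (hy.trans_lt hb)
      hxy (hxε.trans (h4.le.trans hδt)) hxε hcx h5.le
  have hdpos : ∀ x, |x| < 2 → 0 ≤ density a₀ t W α ε x := fun x hx =>
    mul_nonneg (Real.rpow_nonneg (h.weight_pos x).le _)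
      (Real.rpow_nonneg (softRadius_pos hpre h hε hx).le _)
  refine ⟨density a₀ t W α ε, t⁻¹ * (ε / t) ^ (-α), fun x hx => ?_, fun x hx => ?_, fun x hx => ?_,
    fun x y hx hy hxy hcx => ?_, fun x y hx hy hxy hcx hxε => ?_⟩
  · have hs := softRadius_pos hpre h hε hx
    have h6 : softRadius a₀ t W ε x ≤ 5 + (t ^ 3)⁻¹ := by
      have h7 := softRadius_le h hε x
      have h8 := hS.hypRadius_le_dist hx hS.two_mem
      have h9 : |x - 2| ≤ 4 := by
        rw [abs_le]; constructor <;> linarith [(abs_lt.1 hx).1, (abs_lt.1 hx).2]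
      have h10 : ε / t ^ 3 ≤ (t ^ 3)⁻¹ := by
        rw [div_eq_mul_inv]
        exact mul_le_of_le_one_left (by positivity) (by linarith)
      linarith
    have hG : (1 : ℝ) ≤ 5 + (t ^ 3)⁻¹ := by
      have : 0 < (t ^ 3)⁻¹ := by positivity
      linarith
    unfold density
    refine mul_le_mul ?_ ?_ (by positivity) (Real.rpow_nonneg (h.weight_pos x).le _)
    · calc t = t ^ (1 : ℝ) := (Real.rpow_one t).symm
        _ ≤ t ^ (1 - α) := Real.rpow_le_rpow_of_exponent_ge ht ht1 (by linarith)
        _ ≤ _ := Real.rpow_le_rpow ht.le (h.le_weight x) (by linarith)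
    · rw [← Real.rpow_neg_one]
      calc (5 + (t ^ 3)⁻¹) ^ (-1 : ℝ) ≤ (5 + (t ^ 3)⁻¹) ^ (-α) :=
            Real.rpow_le_rpow_of_exponent_le hG (by linarith)
        _ ≤ _ := Real.rpow_le_rpow_of_nonpos hs h6 (by linarith)
  · have hs := softRadius_pos hpre h hε hx
    unfold density
    refine mul_le_mul ?_ (Real.rpow_le_rpow_of_nonpos (by positivity)
      (le_softRadius hpre h hε hx) (by linarith)) (by positivity) (by positivity)
    calc W x ^ (1 - α) ≤ (t⁻¹) ^ (1 - α) :=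
          Real.rpow_le_rpow (h.weight_pos x).le (h.weight_le x) (by linarith)
      _ ≤ (t⁻¹) ^ (1 : ℝ) :=
          Real.rpow_le_rpow_of_exponent_le ((one_le_inv₀ ht).2 ht1) (by linarith)
      _ = _ := Real.rpow_one _
  · exact density_le_of_abs_le hpre h hαnn hα1' hε (hx.trans (h4.le.trans hδt))
  · have hx2 : |x| < 2 := hx.trans_lt hb
    have hy2 : |y| < 2 := hy.trans_lt hb
    have hd := hdpos x hx2
    by_cases hxε : |x| ≤ 10 * √ε
    · refine le_trans ?_ (hcore x y hx hy hxy hcx hxε)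
      gcongr
      exact (min_le_left _ _).trans (le_max_right _ _)
    by_cases hxδ : |x| ≤ δ
    · refine le_trans ?_ (density_expand_near_critical_point hpre h hα0.le hα1' hε hy2 hxy hxδ ?_)
      · gcongr
        exact min_le_left _ _
      · have h7 : √ε ≤ |x| := by
          have := Real.sqrt_nonneg ε
          linarith
        calc ε = √ε ^ 2 := (Real.sq_sqrt hε.le).symm
          _ ≤ |x| ^ 2 := by gcongr
          _ = x ^ 2 := sq_abs x
    have hq : -2 < quad a₀ x := by
      have := (abs_le.1 hxy).2
      have := (abs_le.1 hy).1
      linarith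
    by_cases hP : ∃ p ∈ postcritical a₀, |x - p| ≤ t / 8
    · obtain ⟨p, hp, hxp⟩ := hP
      refine le_trans ?_ (density_expand_near ha hpre h hαnn hα1' hε h1.le hx2 hy2 hxy hq hp hxp)
      gcongr
      exact (min_le_right _ _).trans (min_le_left _ _)
    · push Not at hP
      refine le_trans ?_ (density_expand_middle ha hpre h hαnn hα1' hδ hr hr1 hε h3.le hx2 hy2 hxy hq
        (not_le.1 hxδ).le ?_)
      · gcongr
        exact (min_le_right _ _).trans (min_le_right _ _)
      · rintro s (rfl | rfl | hs)
        · refine (min_le_right _ _).trans ?_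
          rw [abs_sub_comm]
          exact le_trans (by linarith [le_abs_self x]) (le_abs_self _)
        · refine (min_le_right _ _).trans ?_
          exact le_trans (by linarith [neg_abs_le x]) (le_abs_self _)
        · exact (min_le_left _ _).trans (hP s hs).le
  · refine le_trans ?_ (hcore x y hx hy hxy hcx hxε)
    have := hdpos x (hx.trans_lt hb)
    gcongr
    exact le_max_left _ _

/-! ### Rectangles in lifted coordinates -/

theorem coe_injOn_Ioo {θ θ' : ℝ} (h : θ ∈ Ioo (0 : ℝ) 1) (h' : θ' ∈ Ioo (0 : ℝ) 1)
    (e : (θ : UnitAddCircle) = θ') : θ = θ' :=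
  (AddCircle.coe_eq_coe_iff_of_mem_Ico (p := (1 : ℝ)) (a := 0) (by simpa using Ioo_subset_Ico_self h)
    (by simpa using Ioo_subset_Ico_self h')).1 e

theorem Rectangle.Ioo_subset {K : Set ℝ} (R : Rectangle K) : Ioo R.left R.right ⊆ Ioo 0 1 :=
  Ioo_subset_Ioo R.left_nonneg R.right_le_one

theorem Rectangle.mem_carrier_iff {K : Set ℝ} (R : Rectangle K) {θ x : ℝ} (h : θ ∈ Ioo (0 : ℝ) 1) :
    ((θ : UnitAddCircle), x) ∈ R.carrier ↔
      θ ∈ Ioo R.left R.right ∧ x ∈ Ioo (R.bottom θ) (R.top θ) := by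
  constructor
  · rintro ⟨θ', h1, h2, h3⟩
    obtain rfl := coe_injOn_Ioo h (R.Ioo_subset h1) h2
    exact ⟨h1, h3⟩
  · rintro ⟨h1, h2⟩
    exact ⟨θ, h1, rfl, h2⟩

theorem Rectangle.exists_of_mem_carrier {K : Set ℝ} (R : Rectangle K) {p : Phase}
    (h : p ∈ R.carrier) : ∃ θ ∈ Ioo R.left R.right, ∃ x ∈ Ioo (R.bottom θ) (R.top θ),
      p = ((θ : UnitAddCircle), x) := by
  obtain ⟨θ, h1, h2, h3⟩ := h
  exact ⟨θ, h1, p.2, h3, Prod.ext h2 rfl⟩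

theorem Rectangle.bottom_le_top {K : Set ℝ} (R : Rectangle K) {θ : ℝ}
    (h : θ ∈ Icc R.left R.right) : R.bottom θ ≤ R.top θ := by
  rw [← closure_Ioo R.left_lt_right.ne] at h
  refine le_on_closure (fun x hx => (R.bottom_lt_top x hx).le) ?_ ?_ h
  · rw [closure_Ioo R.left_lt_right.ne]; exact R.continuousOn_bottom
  · rw [closure_Ioo R.left_lt_right.ne]; exact R.continuousOn_top

/-- Inclusion of carriers gives the inequalities between the sides, up to the boundary. -/
theorem Rectangle.le_of_carrier_subset {K K' : Set ℝ} {P : Rectangle K} {Q : Rectangle K'}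
    (h : P.carrier ⊆ Q.carrier) :
    Q.left ≤ P.left ∧ P.right ≤ Q.right ∧
      ∀ θ ∈ Icc P.left P.right, Q.bottom θ ≤ P.bottom θ ∧ P.top θ ≤ Q.top θ := by
  have key : ∀ θ ∈ Ioo P.left P.right,
      θ ∈ Ioo Q.left Q.right ∧ Q.bottom θ ≤ P.bottom θ ∧ P.top θ ≤ Q.top θ := by
    intro θ hθ
    have hlt := P.bottom_lt_top θ hθ
    have hsub : ∀ x ∈ Ioo (P.bottom θ) (P.top θ),
        θ ∈ Ioo Q.left Q.right ∧ x ∈ Ioo (Q.bottom θ) (Q.top θ) := fun x hx =>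
      (Q.mem_carrier_iff (P.Ioo_subset hθ)).1
        (h ((P.mem_carrier_iff (P.Ioo_subset hθ)).2 ⟨hθ, hx⟩))
    have h1 := (Ioo_subset_Ioo_iff hlt).1 fun x hx => (hsub x hx).2
    obtain ⟨x, hx⟩ := exists_between hlt
    exact ⟨(hsub x hx).1, h1⟩
  have hI : Icc P.left P.right ⊆ Icc Q.left Q.right := by
    rw [← closure_Ioo P.left_lt_right.ne, ← closure_Ioo Q.left_lt_right.ne]
    exact closure_mono fun θ hθ => (key θ hθ).1
  have hcl := closure_Ioo P.left_lt_right.ne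
  have h2 := (Icc_subset_Icc_iff P.left_lt_right.le).1 hI
  refine ⟨h2.1, h2.2, fun θ hθ => ?_⟩
  have hθ' := hθ
  rw [← hcl] at hθ'
  constructor
  · refine le_on_closure (fun x hx => (key x hx).2.1) ?_ ?_ hθ' <;> rw [hcl]
    · exact Q.continuousOn_bottom.mono hI
    · exact P.continuousOn_bottom
  · refine le_on_closure (fun x hx => (key x hx).2.2) ?_ ?_ hθ' <;> rw [hcl]
    · exact P.continuousOn_top
    · exact Q.continuousOn_top.mono hI

theorem phi_coe (d : ℕ) (a₀ ε : ℝ) (k : ℕ) (θ x : ℝ) :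
    phi d a₀ ε ((θ : UnitAddCircle), x) =
      (((d * θ - k : ℝ) : UnitAddCircle), a₀ + ε * Real.sin (2 * Real.pi * θ) - x ^ 2) := by
  have h := phi_proj d a₀ ε (θ, x)
  have hk : ((k : ℝ) : UnitAddCircle) = 0 := by
    rw [← nsmul_one, AddCircle.coe_nsmul, AddCircle.coe_period, smul_zero]
  simp only [proj, phiLift] at h
  rw [h, AddCircle.coe_sub, hk, sub_zero]

/-! ### Dissections into returning rectangles -/

section Splits

variable {K : Set ℝ}

/-- `φ^t` maps the rectangle `P` bijectively onto `T`, along orbits that stay at distance at least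
`c` from the critical point before time `t`; and `P` is not too thin. -/
structure ReturnsTo (d : ℕ) (a₀ ε c h : ℝ) (P : Rectangle K) (T : Set Phase) (t : ℕ) : Prop where
  bij : BijOn (phi d a₀ ε)^[t] P.carrier T
  away : ∀ p ∈ P.carrier, ∀ j < t, c ≤ |((phi d a₀ ε)^[j] p).2|
  width : ((d : ℝ)⁻¹) ^ t ≤ P.right - P.left
  height : ∀ θ ∈ Ioo P.left P.right, h * (1 / 4) ^ t ≤ P.top θ - P.bottom θ

/-- `R` is dissected into finitely many rectangles, each of which is labelled by a boolean `β` and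
mapped within time `q` onto one of the targets `𝒯 β`. The part of `R` that is left over has
countable fibres over all but countably many base points. All labels in `L` are used. -/
def Splits (d : ℕ) (a₀ ε c h : ℝ) (𝒯 : Bool → Set (Set Phase)) (q : ℕ) (L : Set Bool)
    (R : Rectangle K) : Prop :=
  ∃ (ι : Type) (_ : Finite ι) (P : ι → Rectangle K) (β : ι → Bool),
    Pairwise (fun i j => Disjoint (P i).carrier (P j).carrier) ∧
    (∀ i, (P i).carrier ⊆ R.carrier) ∧
    (∃ D : Set ℝ, D.Countable ∧ ∀ θ ∈ Ioo (0 : ℝ) 1, θ ∉ D →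
      {x : ℝ | ((θ : UnitAddCircle), x) ∈ R.carrier \ ⋃ i, (P i).carrier}.Countable) ∧
    (∀ i, ∃ t ≤ q, ∃ T ∈ 𝒯 (β i), ReturnsTo d a₀ ε c h (P i) T t) ∧
    ∀ b ∈ L, ∃ i, β i = b

variable {d : ℕ} {a₀ ε c h : ℝ} {𝒯 : Bool → Set (Set Phase)} {q : ℕ} {L : Set Bool}

theorem Splits.mono {R : Rectangle K} {q' : ℕ} {L' : Set Bool} (hR : Splits d a₀ ε c h 𝒯 q L R)
    (hq : q ≤ q') (hL : L' ⊆ L) : Splits d a₀ ε c h 𝒯 q' L' R := by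
  obtain ⟨ι, hι, P, β, h1, h2, h3, h4, h5⟩ := hR
  refine ⟨ι, hι, P, β, h1, h2, h3, fun i => ?_, fun b hb => h5 b (hL hb)⟩
  obtain ⟨t, ht, h6⟩ := h4 i
  exact ⟨t, ht.trans hq, h6⟩

/-- A target is dissected trivially. -/
theorem splits_of_mem {R : Rectangle K} {b : Bool} (hfull : R.HasFullBasis)
    (hR : R.carrier ∈ 𝒯 b) (hh : ∀ θ ∈ Ioo (0 : ℝ) 1, h ≤ R.top θ - R.bottom θ) :
    Splits d a₀ ε c h 𝒯 q {b} R := by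
  obtain ⟨hl, hr⟩ := hfull
  refine ⟨Unit, inferInstance, fun _ => R, fun _ => b, fun i j hij => absurd rfl hij,
    fun _ => Subset.rfl, ⟨∅, countable_empty, fun θ _ _ => ?_⟩, fun _ => ⟨0, q.zero_le, _, hR, ?_⟩,
    fun b' hb' => ⟨(), hb'.symm⟩⟩
  · simp [iUnion_const]
  · refine ⟨bijOn_id _, fun p _ j hj => absurd hj j.not_lt_zero, ?_, ?_⟩
    · simp [hl, hr]
    · simpa [hl, hr] using hh

/-- The part of `R` below the horizontal line at level `e`. -/
def Rectangle.below (R : Rectangle K) (e : ℝ) (he : e ∈ K)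
    (h : ∀ θ ∈ Ioo R.left R.right, R.bottom θ < e) : Rectangle K :=
  { R with
    top := fun _ => e
    continuousOn_top := continuousOn_const
    top_mem := fun _ _ => he
    bottom_lt_top := h }

/-- The part of `R` above the horizontal line at level `e`. -/
def Rectangle.above (R : Rectangle K) (e : ℝ) (he : e ∈ K)
    (h : ∀ θ ∈ Ioo R.left R.right, e < R.top θ) : Rectangle K :=
  { R with
    bottom := fun _ => e
    continuousOn_bottom := continuousOn_const
    bottom_mem := fun _ _ => he
    bottom_lt_top := h }

/-- Dissections of the two parts into which a horizontal segment cuts a rectangle form a dissection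
of the rectangle. The segment itself is met by every vertical line in a single point. -/
theorem splits_of_cut {R : Rectangle K} {e : ℝ} (he : e ∈ K)
    (hb : ∀ θ ∈ Ioo R.left R.right, R.bottom θ < e) (ht : ∀ θ ∈ Ioo R.left R.right, e < R.top θ)
    {L₁ L₂ : Set Bool} (h₁ : Splits d a₀ ε c h 𝒯 q L₁ (R.below e he hb))
    (h₂ : Splits d a₀ ε c h 𝒯 q L₂ (R.above e he ht)) :
    Splits d a₀ ε c h 𝒯 q (L₁ ∪ L₂) R := by
  obtain ⟨ι, hι, P, β, p1, p2, ⟨D, hD, p3⟩, p4, p5⟩ := h₁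
  obtain ⟨κ, hκ, Q, γ, q1, q2, ⟨E, hE, q3⟩, q4, q5⟩ := h₂
  have hdis : Disjoint (R.below e he hb).carrier (R.above e he ht).carrier := by
    rw [Set.disjoint_left]
    rintro p ⟨θ, -, -, h1⟩ ⟨θ', -, -, h2⟩
    exact lt_irrefl _ (h1.2.trans h2.1)
  have hsub₁ : (R.below e he hb).carrier ⊆ R.carrier := by
    rintro p ⟨θ, h0, h1, h2⟩
    exact ⟨θ, h0, h1, h2.1, h2.2.trans (ht θ h0)⟩
  have hsub₂ : (R.above e he ht).carrier ⊆ R.carrier := by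
    rintro p ⟨θ, h0, h1, h2⟩
    exact ⟨θ, h0, h1, (hb θ h0).trans h2.1, h2.2⟩
  refine ⟨ι ⊕ κ, inferInstance, Sum.elim P Q, Sum.elim β γ, ?_, ?_, ?_, ?_, ?_⟩
  · rintro (i | i) (j | j) hij
    · exact p1 fun h => hij (h ▸ rfl)
    · exact hdis.mono (p2 i) (q2 j)
    · exact (hdis.mono (p2 j) (q2 i)).symm
    · exact q1 fun h => hij (h ▸ rfl)
  · rintro (i | i)
    · exact (p2 i).trans hsub₁
    · exact (q2 i).trans hsub₂
  · refine ⟨D ∪ E, hD.union hE, fun θ hθ hn => ?_⟩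
    rw [mem_union, not_or] at hn
    refine (((p3 θ hθ hn.1).union (q3 θ hθ hn.2)).union (countable_singleton e)).mono ?_
    rintro x ⟨hx, hx'⟩
    rw [R.mem_carrier_iff hθ] at hx
    rw [mem_iUnion, not_exists] at hx'
    rcases lt_trichotomy x e with h | h | h
    · refine Or.inl (Or.inl ⟨?_, ?_⟩)
      · exact ((R.below e he hb).mem_carrier_iff hθ).2 ⟨hx.1, hx.2.1, h⟩
      · rw [mem_iUnion, not_exists]
        exact fun i => hx' (Sum.inl i)
    · exact Or.inr h
    · refine Or.inl (Or.inr ⟨?_, ?_⟩)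
      · exact ((R.above e he ht).mem_carrier_iff hθ).2 ⟨hx.1, h, hx.2.2⟩
      · rw [mem_iUnion, not_exists]
        exact fun i => hx' (Sum.inr i)
  · rintro (i | i)
    · exact p4 i
    · exact q4 i
  · rintro b (hb | hb)
    · obtain ⟨i, hi⟩ := p5 b hb
      exact ⟨Sum.inl i, hi⟩
    · obtain ⟨i, hi⟩ := q5 b hb
      exact ⟨Sum.inr i, hi⟩

/-! ### One step of the dynamics on the columns of a rectangle -/

/-- `P'` is the lift of `P` by the inverse branch of `φ` over the `k`-th column, on the side of
`S¹ × {0}` given by the sign `s`. -/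
structure IsLift (d : ℕ) (a₀ ε : ℝ) (k : ℕ) (s : ℝ) (P P' : Rectangle K) : Prop where
  left_eq : P'.left = (P.left + k) / d
  right_eq : P'.right = (P.right + k) / d
  mem_iff : ∀ θ ∈ Ioo P'.left P'.right, ∀ x, x ∈ Ioo (P'.bottom θ) (P'.top θ) ↔
    0 < s * x ∧ a₀ + ε * Real.sin (2 * Real.pi * θ) - x ^ 2 ∈
      Ioo (P.bottom (d * θ - k)) (P.top (d * θ - k))
  top_le : ∀ θ ∈ Ioo P'.left P'.right, P.top (d * θ - k) ≤ a₀ + ε * Real.sin (2 * Real.pi * θ)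
  height : ∀ θ ∈ Ioo P'.left P'.right,
    (P.top (d * θ - k) - P.bottom (d * θ - k)) / 4 ≤ P'.top θ - P'.bottom θ

theorem column_mem {d k : ℕ} (hd : 0 < d) {l r θ : ℝ} :
    θ ∈ Ioo ((l + k) / d) ((r + k) / d) ↔ d * θ - k ∈ Ioo l r := by
  have : (0 : ℝ) < d := by exact_mod_cast hd
  rw [mem_Ioo, mem_Ioo, div_lt_iff₀ this, lt_div_iff₀ this]
  constructor <;> rintro ⟨h1, h2⟩ <;> constructor <;> linarith

theorem column_mem_Icc {d k : ℕ} (hd : 0 < d) {l r θ : ℝ} :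
    θ ∈ Icc ((l + k) / d) ((r + k) / d) ↔ d * θ - k ∈ Icc l r := by
  have : (0 : ℝ) < d := by exact_mod_cast hd
  rw [mem_Icc, mem_Icc, div_le_iff₀ this, le_div_iff₀ this]
  constructor <;> rintro ⟨h1, h2⟩ <;> constructor <;> linarith

/-- Existence of lifts, on the positive side and on the negative side. -/
theorem exists_isLift {k : ℕ} {s : ℝ} (hd : 0 < d) (hk : k < d) (hK : ∀ x ∈ K, |x| ≤ 2)
    (hs : s = 1 ∨ s = -1) (P : Rectangle K)
    (hpos : ∀ θ, (d * θ - k : ℝ) ∈ Icc P.left P.right →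
      0 ≤ a₀ + ε * Real.sin (2 * Real.pi * θ) - P.top (d * θ - k))
    (hbot : ∀ θ, (d * θ - k : ℝ) ∈ Icc P.left P.right →
      s * √(a₀ + ε * Real.sin (2 * Real.pi * θ) - P.bottom (d * θ - k)) ∈ K)
    (htop : ∀ θ, (d * θ - k : ℝ) ∈ Icc P.left P.right →
      s * √(a₀ + ε * Real.sin (2 * Real.pi * θ) - P.top (d * θ - k)) ∈ K) :
    ∃ P' : Rectangle K, IsLift d a₀ ε k s P P' := by
  have hd' : (0 : ℝ) < d := by exact_mod_cast hd
  set B : ℝ → ℝ := fun θ => √(a₀ + ε * Real.sin (2 * Real.pi * θ) - P.bottom (d * θ - k)) with hB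
  set T : ℝ → ℝ := fun θ => √(a₀ + ε * Real.sin (2 * Real.pi * θ) - P.top (d * θ - k)) with hT
  have hl0 : 0 ≤ (P.left + k) / d := div_nonneg (add_nonneg P.left_nonneg k.cast_nonneg) hd'.le
  have hlr : (P.left + k) / d < (P.right + k) / d := by
    have := P.left_lt_right
    gcongr
  have hr1 : (P.right + k) / d ≤ 1 := by
    rw [div_le_one hd']
    have h1 : (k : ℝ) + 1 ≤ d := by exact_mod_cast hk
    linarith [P.right_le_one]
  have hmaps : MapsTo (fun θ : ℝ => d * θ - k) (Icc ((P.left + k) / d) ((P.right + k) / d))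
      (Icc P.left P.right) := fun θ hθ => (column_mem_Icc hd).1 hθ
  have hcB : ContinuousOn B (Icc ((P.left + k) / d) ((P.right + k) / d)) := by
    apply ContinuousOn.sqrt
    exact (by fun_prop : Continuous fun θ => a₀ + ε * Real.sin (2 * Real.pi * θ)).continuousOn.sub
      (P.continuousOn_bottom.comp (by fun_prop) hmaps)
  have hcT : ContinuousOn T (Icc ((P.left + k) / d) ((P.right + k) / d)) := by
    apply ContinuousOn.sqrt
    exact (by fun_prop : Continuous fun θ => a₀ + ε * Real.sin (2 * Real.pi * θ)).continuousOn.sub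
      (P.continuousOn_top.comp (by fun_prop) hmaps)
  have hTB : ∀ θ ∈ Ioo ((P.left + k) / d) ((P.right + k) / d), T θ < B θ := by
    intro θ hθ
    have h1 := (column_mem hd).1 hθ
    exact Real.sqrt_lt_sqrt (hpos θ (Ioo_subset_Icc_self h1)) (by linarith [P.bottom_lt_top _ h1])
  have hmem : ∀ θ ∈ Ioo ((P.left + k) / d) ((P.right + k) / d), ∀ x, 0 < x →
      (x ∈ Ioo (T θ) (B θ) ↔ a₀ + ε * Real.sin (2 * Real.pi * θ) - x ^ 2 ∈
        Ioo (P.bottom (d * θ - k)) (P.top (d * θ - k))) := by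
    intro θ hθ x hx
    have h1 := (column_mem hd).1 hθ
    rw [mem_Ioo, mem_Ioo, Real.sqrt_lt' hx, Real.lt_sqrt hx.le]
    constructor <;> rintro ⟨h2, h3⟩ <;> constructor <;> linarith
  have hheight : ∀ θ ∈ Ioo ((P.left + k) / d) ((P.right + k) / d),
      (P.top (d * θ - k) - P.bottom (d * θ - k)) / 4 ≤ B θ - T θ := by
    intro θ hθ
    have h1 := (column_mem hd).1 hθ
    have h1' := Ioo_subset_Icc_self h1
    have h2 := hpos θ h1'
    have h3 := P.bottom_lt_top _ h1
    have hTs : T θ ^ 2 = a₀ + ε * Real.sin (2 * Real.pi * θ) - P.top (d * θ - k) :=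
      Real.sq_sqrt h2
    have hBs : B θ ^ 2 = a₀ + ε * Real.sin (2 * Real.pi * θ) - P.bottom (d * θ - k) :=
      Real.sq_sqrt (by linarith)
    have hs1 : |s| = 1 := by rcases hs with rfl | rfl <;> simp
    have hT2 : T θ ≤ 2 := by
      have := hK _ (htop θ h1')
      rwa [abs_mul, hs1, one_mul, abs_of_nonneg (Real.sqrt_nonneg _)] at this
    have hB2 : B θ ≤ 2 := by
      have := hK _ (hbot θ h1')
      rwa [abs_mul, hs1, one_mul, abs_of_nonneg (Real.sqrt_nonneg _)] at this
    have := hTB θ hθ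
    nlinarith
  have htople : ∀ θ ∈ Ioo ((P.left + k) / d) ((P.right + k) / d),
      P.top (d * θ - k) ≤ a₀ + ε * Real.sin (2 * Real.pi * θ) := fun θ hθ =>
    sub_nonneg.1 (hpos θ (Ioo_subset_Icc_self ((column_mem hd).1 hθ)))
  rcases hs with rfl | rfl
  · refine ⟨⟨(P.left + k) / d, (P.right + k) / d, T, B, hl0, hlr, hr1, hcT, hcB, fun θ hθ => ?_,
      fun θ hθ => ?_, hTB⟩, ⟨rfl, rfl, fun θ hθ x => ?_, htople, hheight⟩⟩
    · simpa using htop θ (hmaps hθ)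
    · simpa using hbot θ (hmaps hθ)
    · by_cases hx : 0 < x
      · rw [one_mul]
        exact (hmem θ hθ x hx).trans (and_iff_right hx).symm
      · rw [one_mul]
        refine iff_of_false (fun h1 => hx ?_) fun h1 => hx h1.1
        exact (Real.sqrt_nonneg _).trans_lt h1.1
  · refine ⟨⟨(P.left + k) / d, (P.right + k) / d, fun θ => -B θ, fun θ => -T θ, hl0, hlr, hr1,
      hcB.neg, hcT.neg, fun θ hθ => ?_, fun θ hθ => ?_, fun θ hθ => neg_lt_neg (hTB θ hθ)⟩,
      ⟨rfl, rfl, fun θ hθ x => ?_, htople, fun θ hθ => ?_⟩⟩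
    · simpa using hbot θ (hmaps hθ)
    · simpa using htop θ (hmaps hθ)
    · by_cases hx : 0 < -x
      · rw [neg_one_mul]
        rw [and_iff_right hx, ← neg_sq x, ← hmem θ hθ (-x) hx]
        simp only [mem_Ioo]
        constructor <;> rintro ⟨h1, h2⟩ <;> constructor <;> linarith
      · rw [neg_one_mul]
        refine iff_of_false (fun h1 => hx ?_) fun h1 => hx h1.1
        have h2 : x < -T θ := h1.2
        have : 0 ≤ T θ := Real.sqrt_nonneg _
        linarith
    · have := hheight θ hθ
      show _ ≤ -T θ - -B θ
      linarith

theorem IsLift.mem_carrier_iff {k : ℕ} {s : ℝ} {P P' : Rectangle K} (h : IsLift d a₀ ε k s P P')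
    (hd : 0 < d) {θ x : ℝ} (hθ : θ ∈ Ioo (0 : ℝ) 1) :
    ((θ : UnitAddCircle), x) ∈ P'.carrier ↔ d * θ - k ∈ Ioo P.left P.right ∧ 0 < s * x ∧
      a₀ + ε * Real.sin (2 * Real.pi * θ) - x ^ 2 ∈
      Ioo (P.bottom (d * θ - k)) (P.top (d * θ - k)) := by
  rw [P'.mem_carrier_iff hθ, ← column_mem hd, ← h.left_eq, ← h.right_eq]
  exact and_congr_right fun h1 => h.mem_iff θ h1 x

theorem IsLift.bijOn {k : ℕ} {s : ℝ} {P P' : Rectangle K} (h : IsLift d a₀ ε k s P P')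
    (hd : 0 < d) (hs : s = 1 ∨ s = -1) : BijOn (phi d a₀ ε) P'.carrier P.carrier := by
  have hd' : (0 : ℝ) < d := by exact_mod_cast hd
  refine ⟨?_, ?_, ?_⟩
  · intro p hp
    obtain ⟨θ, hθ, x, hx, rfl⟩ := P'.exists_of_mem_carrier hp
    have h1 := (h.mem_carrier_iff hd (P'.Ioo_subset hθ)).1 hp
    rw [phi_coe d a₀ ε k]
    exact (P.mem_carrier_iff (P.Ioo_subset h1.1)).2 ⟨h1.1, h1.2.2⟩
  · intro p hp p' hp' e
    obtain ⟨θ, hθ, x, hx, rfl⟩ := P'.exists_of_mem_carrier hp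
    obtain ⟨θ', hθ', x', hx', rfl⟩ := P'.exists_of_mem_carrier hp'
    have h1 := (h.mem_carrier_iff hd (P'.Ioo_subset hθ)).1 hp
    have h1' := (h.mem_carrier_iff hd (P'.Ioo_subset hθ')).1 hp'
    rw [phi_coe d a₀ ε k, phi_coe d a₀ ε k, Prod.mk.injEq] at e
    have e1 := coe_injOn_Ioo (P.Ioo_subset h1.1) (P.Ioo_subset h1'.1) e.1
    have e2 : θ = θ' := by
      have : (d : ℝ) * θ = d * θ' := by linarith
      exact mul_left_cancel₀ hd'.ne' this
    subst e2
    have e3 : x ^ 2 = x' ^ 2 := by linarith [e.2]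
    have e4 : x = x' := by
      rcases sq_eq_sq_iff_eq_or_eq_neg.1 e3 with e4 | e4
      · exact e4
      · have h2 := h1.2.1
        have h3 := h1'.2.1
        rw [e4] at h2
        linarith
    rw [e4]
  · intro p hp
    obtain ⟨ω, hω, y, hy, rfl⟩ := P.exists_of_mem_carrier hp
    set θ : ℝ := (ω + k) / d with hθdef
    have hω' : d * θ - k = ω := by rw [hθdef]; field_simp; ring
    have hθ : θ ∈ Ioo P'.left P'.right := by
      rw [h.left_eq, h.right_eq, column_mem hd, hω']; exact hω
    have htop := h.top_le θ hθ
    rw [hω'] at htop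
    have hy0 : 0 < a₀ + ε * Real.sin (2 * Real.pi * θ) - y := by linarith [hy.2]
    have hs2 : s * s = 1 := by rcases hs with rfl | rfl <;> norm_num
    refine ⟨((θ : UnitAddCircle), s * √(a₀ + ε * Real.sin (2 * Real.pi * θ) - y)), ?_, ?_⟩
    · rw [h.mem_carrier_iff hd (P'.Ioo_subset hθ), hω', mul_pow, Real.sq_sqrt hy0.le, ← mul_assoc,
        sq, hs2, one_mul, one_mul]
      exact ⟨hω, Real.sqrt_pos.2 hy0, by simpa using hy⟩
    · rw [phi_coe d a₀ ε k, hω', mul_pow, Real.sq_sqrt hy0.le, sq, hs2]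
      simp

theorem mul_sqrt_mem_Icc {s b t w : ℝ} (hs : s = 1 ∨ s = -1) (hb : 0 < s * b) (ht : 0 < s * t)
    (hbt : b ≤ t) (h1 : min (b ^ 2) (t ^ 2) ≤ w) (h2 : w ≤ max (b ^ 2) (t ^ 2)) :
    s * √w ∈ Icc b t := by
  rcases hs with rfl | rfl
  · rw [one_mul] at *
    rw [min_eq_left (by gcongr)] at h1
    rw [max_eq_right (by gcongr)] at h2
    exact ⟨Real.le_sqrt_of_sq_le h1, Real.sqrt_le_iff.2 ⟨ht.le, h2⟩⟩
  · rw [neg_one_mul] at *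
    have h : t ^ 2 ≤ b ^ 2 := by nlinarith
    rw [min_eq_right h] at h1
    rw [max_eq_left h] at h2
    have h3 : -t ≤ √w := Real.le_sqrt_of_sq_le (by rwa [neg_sq])
    have h4 : √w ≤ -b := Real.sqrt_le_iff.2 ⟨hb.le, by rwa [neg_sq]⟩
    constructor <;> linarith

theorem mem_Ioo_iff_sq {s b t x : ℝ} (hs : s = 1 ∨ s = -1) (hb : 0 < s * b) (ht : 0 < s * t)
    (hbt : b ≤ t) (hx : 0 < s * x) :
    x ^ 2 ∈ Ioo (min (b ^ 2) (t ^ 2)) (max (b ^ 2) (t ^ 2)) ↔ x ∈ Ioo b t := by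
  rcases hs with rfl | rfl
  · rw [one_mul] at *
    rw [min_eq_left (by gcongr), max_eq_right (by gcongr), mem_Ioo, mem_Ioo,
      pow_lt_pow_iff_left₀ hb.le hx.le two_ne_zero, pow_lt_pow_iff_left₀ hx.le ht.le two_ne_zero]
  · rw [neg_one_mul] at *
    have h : t ^ 2 ≤ b ^ 2 := by nlinarith
    rw [min_eq_right h, max_eq_left h, ← neg_sq b, ← neg_sq t, ← neg_sq x, mem_Ioo, mem_Ioo,
      pow_lt_pow_iff_left₀ ht.le hx.le two_ne_zero, pow_lt_pow_iff_left₀ hx.le hb.le two_ne_zero]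
    constructor <;> rintro ⟨h1, h2⟩ <;> constructor <;> linarith

/-- `Q` is the image under `φ` of the `k`-th column of `R`. -/
def IsColumnImage (d : ℕ) (a₀ ε : ℝ) (k : ℕ) (R Q : Rectangle K) : Prop :=
  ∀ θ : ℝ, (d * θ - k : ℝ) ∈ Icc (0 : ℝ) 1 →
    Q.bottom (d * θ - k) = a₀ + ε * Real.sin (2 * Real.pi * θ) -
      max (R.bottom θ ^ 2) (R.top θ ^ 2) ∧
    Q.top (d * θ - k) = a₀ + ε * Real.sin (2 * Real.pi * θ) - min (R.bottom θ ^ 2) (R.top θ ^ 2)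

theorem ReturnsTo.lift {k : ℕ} {s : ℝ} {P P' : Rectangle K} (h' : IsLift d a₀ ε k s P P')
    (hd : 0 < d) (hs : s = 1 ∨ s = -1) (haway : ∀ p ∈ P'.carrier, c ≤ |p.2|) {T : Set Phase}
    {t : ℕ} (h0 : ReturnsTo d a₀ ε c h P T t) : ReturnsTo d a₀ ε c h P' T (t + 1) := by
  have hb := h'.bijOn hd hs
  have hd' : (0 : ℝ) < d := by exact_mod_cast hd
  refine ⟨?_, ?_, ?_, ?_⟩
  · rw [iterate_succ]
    exact h0.bij.comp hb
  · intro p hp j hj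
    cases j with
    | zero => exact haway p hp
    | succ j =>
      rw [iterate_succ_apply]
      exact h0.away _ (hb.mapsTo hp) j (by omega)
  · rw [h'.left_eq, h'.right_eq, ← sub_div, add_sub_add_right_eq_sub, pow_succ, div_eq_mul_inv]
    exact mul_le_mul_of_nonneg_right h0.width (by positivity)
  · intro θ hθ
    have h1 := h0.height (d * θ - k) (by
      rw [h'.left_eq, h'.right_eq, column_mem hd] at hθ; exact hθ)
    have h2 := h'.height θ hθ
    rw [pow_succ]
    linarith

/-- If the images of all columns of `R` are dissected within time `q`, then `R` is dissected within
time `q + 1`: pull the dissections back by the inverse branches. -/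
theorem splits_of_columns (hd : 0 < d) (hK : ∀ x ∈ K, |x| ≤ 2) (hconn : K.OrdConnected)
    {R : Rectangle K} (hfull : R.HasFullBasis) {s : ℝ} (hs : s = 1 ∨ s = -1)
    (hsign : ∀ θ ∈ Icc (0 : ℝ) 1, 0 < s * R.bottom θ ∧ 0 < s * R.top θ)
    (haway : ∀ p ∈ R.carrier, c ≤ |p.2|)
    (Q : Fin d → Rectangle K) (hQfull : ∀ k, (Q k).HasFullBasis)
    (hQ : ∀ k : Fin d, IsColumnImage d a₀ ε k R (Q k))
    (hsplit : ∀ k, Splits d a₀ ε c h 𝒯 q L (Q k)) : Splits d a₀ ε c h 𝒯 (q + 1) L R := by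
  have hd' : (0 : ℝ) < d := by exact_mod_cast hd
  obtain ⟨hl, hr⟩ := hfull
  have hcol : ∀ (k : Fin d) (θ : ℝ), (d * θ - (k : ℕ) : ℝ) ∈ Icc (0 : ℝ) 1 → θ ∈ Icc (0 : ℝ) 1 := by
    intro k θ hθ
    have h1 : ((k : ℕ) : ℝ) + 1 ≤ d := by exact_mod_cast k.2
    have h2 : (0 : ℝ) ≤ (k : ℕ) := Nat.cast_nonneg _
    constructor <;> by_contra! h3 <;> nlinarith [hθ.1, hθ.2]
  have hcol' : ∀ (k : Fin d) (θ : ℝ), (d * θ - (k : ℕ) : ℝ) ∈ Ioo (0 : ℝ) 1 → θ ∈ Ioo (0 : ℝ) 1 := by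
    intro k θ hθ
    have h1 : ((k : ℕ) : ℝ) + 1 ≤ d := by exact_mod_cast k.2
    have h2 : (0 : ℝ) ≤ (k : ℕ) := Nat.cast_nonneg _
    constructor <;> by_contra! h3 <;> nlinarith [hθ.1, hθ.2]
  have hbt : ∀ θ ∈ Icc (0 : ℝ) 1, R.bottom θ ≤ R.top θ := fun θ hθ =>
    R.bottom_le_top (by rwa [hl, hr])
  choose ι hι P β p1 p2 p3 p4 p5 using hsplit
  choose D hD p3 using p3
  have hlift : ∀ (k : Fin d) (i : ι k), ∃ P' : Rectangle K, IsLift d a₀ ε k s (P k i) P' := by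
    intro k i
    obtain ⟨c1, c2, c3⟩ := Rectangle.le_of_carrier_subset (p2 k i)
    rw [(hQfull k).1] at c1
    rw [(hQfull k).2] at c2
    have key : ∀ θ, (d * θ - (k : ℕ) : ℝ) ∈ Icc (P k i).left (P k i).right →
        ∀ z ∈ Icc ((P k i).bottom (d * θ - (k : ℕ))) ((P k i).top (d * θ - (k : ℕ))),
        0 ≤ a₀ + ε * Real.sin (2 * Real.pi * θ) - z ∧
        s * √(a₀ + ε * Real.sin (2 * Real.pi * θ) - z) ∈ K := by
      intro θ hθ z hz
      have h1 := Icc_subset_Icc c1 c2 hθ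
      have hθ1 := hcol k θ h1
      obtain ⟨e1, e2⟩ := hQ k θ h1
      obtain ⟨f1, f2⟩ := c3 _ hθ
      have h2 : min (R.bottom θ ^ 2) (R.top θ ^ 2) ≤
          a₀ + ε * Real.sin (2 * Real.pi * θ) - z := by linarith [hz.2]
      refine ⟨le_trans (by positivity) h2, ?_⟩
      refine hconn.out (R.bottom_mem θ (by rwa [hl, hr])) (R.top_mem θ (by rwa [hl, hr]))
        (mul_sqrt_mem_Icc hs (hsign θ hθ1).1 (hsign θ hθ1).2 (hbt θ hθ1) h2 ?_)
      linarith [hz.1]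
    have hbt' := fun θ (hθ : (d * θ - (k : ℕ) : ℝ) ∈ Icc (P k i).left (P k i).right) =>
      (P k i).bottom_le_top hθ
    exact exists_isLift hd k.2 hK hs (P k i)
      (fun θ hθ => (key θ hθ _ (right_mem_Icc.2 (hbt' θ hθ))).1)
      (fun θ hθ => (key θ hθ _ (left_mem_Icc.2 (hbt' θ hθ))).2)
      (fun θ hθ => (key θ hθ _ (right_mem_Icc.2 (hbt' θ hθ))).2)
  choose P' hP' using hlift
  -- the part of `R` over the `k`-th column is the preimage of `Q k` on the side `s`
  have hcolumn : ∀ (k : Fin d) (θ x : ℝ), (d * θ - (k : ℕ) : ℝ) ∈ Ioo (0 : ℝ) 1 → 0 < s * x →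
      (x ∈ Ioo (R.bottom θ) (R.top θ) ↔ a₀ + ε * Real.sin (2 * Real.pi * θ) - x ^ 2 ∈
        Ioo ((Q k).bottom (d * θ - (k : ℕ))) ((Q k).top (d * θ - (k : ℕ)))) := by
    intro k θ x hθ hx
    have h1 := Ioo_subset_Icc_self hθ
    have hθ1 := hcol k θ h1
    rw [(hQ k θ h1).1, (hQ k θ h1).2,
      ← mem_Ioo_iff_sq hs (hsign θ hθ1).1 (hsign θ hθ1).2 (hbt θ hθ1) hx]
    simp only [mem_Ioo]
    constructor <;> rintro ⟨h2, h3⟩ <;> constructor <;> linarith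
  have hQiff : ∀ (k : Fin d) (ω y : ℝ), ω ∈ Ioo (0 : ℝ) 1 →
      (((ω : UnitAddCircle), y) ∈ (Q k).carrier ↔ y ∈ Ioo ((Q k).bottom ω) ((Q k).top ω)) := by
    intro k ω y hω
    rw [(Q k).mem_carrier_iff hω, (hQfull k).1, (hQfull k).2]
    exact and_iff_right hω
  have hRiff : ∀ θ x : ℝ, θ ∈ Ioo (0 : ℝ) 1 →
      (((θ : UnitAddCircle), x) ∈ R.carrier ↔ x ∈ Ioo (R.bottom θ) (R.top θ)) := by
    intro θ x hθ
    rw [R.mem_carrier_iff hθ, hl, hr]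
    exact and_iff_right hθ
  have hPsub : ∀ (k : Fin d) (i : ι k), ∀ p ∈ (P' k i).carrier,
      ∃ θ x : ℝ, p = ((θ : UnitAddCircle), x) ∧
      (d * θ - (k : ℕ) : ℝ) ∈ Ioo (0 : ℝ) 1 ∧ p ∈ R.carrier := by
    intro k i p hp
    obtain ⟨θ, hθ, x, hx, rfl⟩ := (P' k i).exists_of_mem_carrier hp
    have hθ1 := (P' k i).Ioo_subset hθ
    obtain ⟨h1, h2, h3⟩ := ((hP' k i).mem_carrier_iff hd hθ1).1 hp
    have hω := (P k i).Ioo_subset h1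
    refine ⟨θ, x, rfl, hω, (hRiff θ x hθ1).2 ((hcolumn k θ x hω h2).2 ?_)⟩
    exact (hQiff k _ _ hω).1 (p2 k i (((P k i).mem_carrier_iff hω).2 ⟨h1, h3⟩))
  refine ⟨Σ k, ι k, inferInstance, fun a => P' a.1 a.2, fun a => β a.1 a.2, ?_, ?_, ?_, ?_, ?_⟩
  · rintro ⟨k, i⟩ ⟨k', j⟩ hij
    rw [Set.disjoint_left]
    intro p hp hp'
    obtain ⟨θ, x, e, hk, hR⟩ := hPsub k i p hp
    obtain ⟨θ', x', e', hk', -⟩ := hPsub k' j p hp'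
    have hθ : θ = θ' := coe_injOn_Ioo (hcol' k θ hk) (hcol' k' θ' hk')
      (by rw [e] at e'; exact (Prod.mk.inj e').1)
    subst hθ
    have hkk : k = k' := by
      have h1 : ((k : ℕ) : ℝ) < (k' : ℕ) + 1 := by linarith [hk.1, hk'.2]
      have h2 : ((k' : ℕ) : ℝ) < (k : ℕ) + 1 := by linarith [hk.2, hk'.1]
      have h1' : (k : ℕ) < k' + 1 := by exact_mod_cast h1
      have h2' : (k' : ℕ) < k + 1 := by exact_mod_cast h2
      exact Fin.ext (by omega)
    subst hkk
    have hne : i ≠ j := fun h => hij (h ▸ rfl)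
    exact Set.disjoint_left.1 (p1 k hne) (((hP' k i).bijOn hd hs).mapsTo hp)
      (((hP' k j).bijOn hd hs).mapsTo hp')
  · rintro ⟨k, i⟩ p hp
    obtain ⟨-, -, -, -, hR⟩ := hPsub k i p hp
    exact hR
  · refine ⟨⋃ k : Fin d, (fun θ : ℝ => d * θ - (k : ℕ)) ⁻¹' (insert 0 (D k)), ?_, ?_⟩
    · refine countable_iUnion fun k => ((hD k).insert 0).preimage_of_injOn fun x _ y _ e => ?_
      have : (d : ℝ) * x = d * y := by simpa using e
      exact mul_left_cancel₀ hd'.ne' this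
    · intro θ hθ hn
      have hk : ⌊d * θ⌋₊ < d := by
        rw [Nat.floor_lt (by have := hθ.1; positivity)]
        nlinarith [hθ.2]
      obtain ⟨k, hkθ⟩ : ∃ k : Fin d, (k : ℕ) = ⌊d * θ⌋₊ := ⟨⟨_, hk⟩, rfl⟩
      rw [mem_iUnion, not_exists] at hn
      have hn := hn k
      rw [mem_preimage, mem_insert_iff, not_or] at hn
      have hω : (d * θ - (k : ℕ) : ℝ) ∈ Ioo (0 : ℝ) 1 := by
        have h1 := Nat.floor_le (show 0 ≤ d * θ by have := hθ.1; positivity)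
        have h2 := Nat.lt_floor_add_one (d * θ)
        rw [← hkθ] at h1 h2
        exact ⟨lt_of_le_of_ne (by linarith) (Ne.symm hn.1), by linarith⟩
      have h3 := p3 k (d * θ - (k : ℕ)) hω hn.2
      have hx : ∀ x ∈ {x : ℝ | ((θ : UnitAddCircle), x) ∈ R.carrier \
          ⋃ a : Σ k, ι k, (P' a.1 a.2).carrier}, 0 < s * x := by
        rintro x ⟨hx, -⟩
        rw [hRiff θ x hθ] at hx
        have h4 := hsign θ (Ioo_subset_Icc_self hθ)
        rcases hs with rfl | rfl
        · have := hx.1; linarith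
        · have := hx.2; linarith
      refine countable_of_injective_of_countable_image
        (f := fun x => a₀ + ε * Real.sin (2 * Real.pi * θ) - x ^ 2) ?_ (h3.mono ?_)
      · intro x h1 y h2 e
        have e3 : x ^ 2 = y ^ 2 := by
          have e : a₀ + ε * Real.sin (2 * Real.pi * θ) - x ^ 2
            = a₀ + ε * Real.sin (2 * Real.pi * θ) - y ^ 2 := e
          linarith
        rcases sq_eq_sq_iff_eq_or_eq_neg.1 e3 with e4 | e4
        · exact e4
        · have h5 := hx x h1
          have h6 := hx y h2
          rw [e4] at h5
          linarith
      · rintro _ ⟨x, hxm, rfl⟩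
        have hsx := hx x hxm
        obtain ⟨h4, h5⟩ := hxm
        rw [hRiff θ x hθ, hcolumn k θ x hω hsx] at h4
        refine ⟨(hQiff k _ _ hω).2 h4, fun h6 => h5 ?_⟩
        obtain ⟨i, hi⟩ := mem_iUnion.1 h6
        rw [(P k i).mem_carrier_iff hω] at hi
        exact mem_iUnion.2 ⟨⟨k, i⟩, ((hP' k i).mem_carrier_iff hd hθ).2 ⟨hi.1, hsx, hi.2⟩⟩
  · rintro ⟨k, i⟩
    obtain ⟨t, ht, T, hT, h1⟩ := p4 k i
    refine ⟨t + 1, by omega, T, hT, h1.lift (hP' k i) hd hs fun p hp => haway p ?_⟩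
    obtain ⟨-, -, -, -, hR⟩ := hPsub k i p hp
    exact hR
  · intro b hb
    obtain ⟨i, hi⟩ := p5 ⟨0, hd⟩ b hb
    exact ⟨⟨⟨0, hd⟩, i⟩, hi⟩

end Splits

/-! ### Admissible curves -/

theorem AdmissibleCurve.hasDerivAt {ε a b : ℝ} {X : ℝ → ℝ} (hX : AdmissibleCurve ε a b X) {θ : ℝ}
    (hθ : θ ∈ Ioo a b) : HasDerivAt X (deriv X θ) θ :=
  ((hX.1.differentiableOn (by norm_num)).differentiableAt (isOpen_Ioo.mem_nhds hθ)).hasDerivAt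

theorem AdmissibleCurve.hasDerivAt_deriv {ε a b : ℝ} {X : ℝ → ℝ} (hX : AdmissibleCurve ε a b X)
    {θ : ℝ} (hθ : θ ∈ Ioo a b) : HasDerivAt (deriv X) (deriv (deriv X) θ) θ := by
  have h1 : ContDiffOn ℝ (1 + 1) X (Ioo a b) := hX.1
  have h2 := ((contDiffOn_succ_iff_deriv_of_isOpen isOpen_Ioo).1 h1).2.2
  exact ((h2.differentiableOn (by norm_num)).differentiableAt (isOpen_Ioo.mem_nhds hθ)).hasDerivAt

theorem admissibleCurve_const {ε : ℝ} (hε : 0 ≤ ε) (a b e : ℝ) :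
    AdmissibleCurve ε a b fun _ => e := by
  refine ⟨contDiffOn_const, fun θ _ => ?_⟩
  simp [hε]

/-- Over the whole circle, an admissible curve varies by at most `ε`. -/
theorem AdmissibleCurve.abs_sub_le {ε : ℝ} {X : ℝ → ℝ} (hε : 0 ≤ ε) (hX : AdmissibleCurve ε 0 1 X)
    (hc : ContinuousOn X (Icc 0 1)) {θ θ' : ℝ} (hθ : θ ∈ Icc (0 : ℝ) 1)
    (hθ' : θ' ∈ Icc (0 : ℝ) 1) : |X θ - X θ'| ≤ ε := by
  wlog h : θ < θ' generalizing θ θ'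
  · rcases (not_lt.1 h).eq_or_lt with e | e
    · simpa [e] using hε
    · rw [abs_sub_comm]
      exact this hθ' hθ e
  have hsub : Ioo θ θ' ⊆ Ioo 0 1 := Ioo_subset_Ioo hθ.1 hθ'.2
  obtain ⟨ξ, hξ, e⟩ := exists_deriv_eq_slope X h (hc.mono (Icc_subset_Icc hθ.1 hθ'.2))
    fun x hx => (hX.hasDerivAt (hsub hx)).differentiableAt.differentiableWithinAt
  have h1 := (hX.2 ξ (hsub hξ)).1
  have hpos : 0 < θ' - θ := by linarith
  have h2 : X θ' - X θ = deriv X ξ * (θ' - θ) := by rw [e]; field_simp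
  rw [abs_sub_comm, h2, abs_mul, abs_of_pos hpos]
  have h3 : θ' - θ ≤ 1 := by linarith [hθ.1, hθ'.2]
  calc |deriv X ξ| * (θ' - θ) ≤ ε * 1 := by gcongr
    _ = ε := mul_one ε

/-- The image under `φ` of the part over the `k`-th column of the graph of `X`. -/
def pushCurve (d : ℕ) (a₀ ε : ℝ) (k : ℕ) (X : ℝ → ℝ) (ω : ℝ) : ℝ :=
  a₀ + ε * Real.sin (2 * Real.pi * ((ω + k) / d)) - X ((ω + k) / d) ^ 2

theorem column_Ioo {d k : ℕ} (hk : k < d) {ω : ℝ} (hω : ω ∈ Ioo (0 : ℝ) 1) :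
    (ω + k) / d ∈ Ioo (0 : ℝ) 1 := by
  have hd : (0 : ℝ) < d := by exact_mod_cast (Nat.zero_le k).trans_lt hk
  have h1 : (k : ℝ) + 1 ≤ d := by exact_mod_cast hk
  have h2 : (0 : ℝ) ≤ k := Nat.cast_nonneg _
  constructor
  · have := hω.1; positivity
  · rw [div_lt_one hd]; linarith [hω.2]

theorem column_Icc {d k : ℕ} (hk : k < d) {ω : ℝ} (hω : ω ∈ Icc (0 : ℝ) 1) :
    (ω + k) / d ∈ Icc (0 : ℝ) 1 := by
  have hd : (0 : ℝ) < d := by exact_mod_cast (Nat.zero_le k).trans_lt hk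
  have h1 : (k : ℝ) + 1 ≤ d := by exact_mod_cast hk
  have h2 : (0 : ℝ) ≤ k := Nat.cast_nonneg _
  constructor
  · have := hω.1; positivity
  · rw [div_le_one hd]; linarith [hω.2]

/-- For `d ≥ 16` the horizontal expansion dominates, and the image of an admissible curve consists
of admissible curves. -/
theorem AdmissibleCurve.push {d k : ℕ} (hd : 16 ≤ d) (hk : k < d) (a₀ : ℝ) {ε : ℝ} (hε : 0 < ε)
    (hε1 : ε ≤ 1) {X : ℝ → ℝ} (hX : AdmissibleCurve ε 0 1 X) (h2 : ∀ θ ∈ Ioo (0 : ℝ) 1, |X θ| ≤ 2) :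
    AdmissibleCurve ε 0 1 (pushCurve d a₀ ε k X) := by
  have hd16 : (16 : ℝ) ≤ d := by exact_mod_cast hd
  have hd0 : (0 : ℝ) < d := by linarith
  have hπ := Real.pi_lt_d2
  have hπ0 := Real.pi_pos
  have hmaps : MapsTo (fun ω : ℝ => (ω + k) / d) (Ioo 0 1) (Ioo 0 1) := fun ω hω => column_Ioo hk hω
  have hcol : ∀ ω : ℝ, HasDerivAt (fun ω : ℝ => (ω + k) / d) (1 / d) ω := fun ω =>
    ((hasDerivAt_id ω).add_const _).div_const _
  have hang : ∀ ω : ℝ, HasDerivAt (fun ω : ℝ => 2 * Real.pi * ((ω + k) / d))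
      (2 * Real.pi * (1 / d)) ω := fun ω => (hcol ω).const_mul _
  have hder : ∀ ω ∈ Ioo (0 : ℝ) 1, HasDerivAt (pushCurve d a₀ ε k X)
      ((ε * (2 * Real.pi) * Real.cos (2 * Real.pi * ((ω + k) / d))
        - 2 * (X ((ω + k) / d) * deriv X ((ω + k) / d))) / d) ω := by
    intro ω hω
    have hXω := (hX.hasDerivAt (hmaps hω)).comp ω (hcol ω)
    have h3 := (((hang ω).sin.const_mul ε).const_add a₀).sub (hXω.pow 2)
    refine h3.congr_deriv ?_
    simp only [comp_apply]
    field_simp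
    push_cast
    ring
  have hderiv : ∀ ω ∈ Ioo (0 : ℝ) 1, deriv (pushCurve d a₀ ε k X) ω =
      (ε * (2 * Real.pi) * Real.cos (2 * Real.pi * ((ω + k) / d))
        - 2 * (X ((ω + k) / d) * deriv X ((ω + k) / d))) / d := fun ω hω => (hder ω hω).deriv
  have hderiv2 : ∀ ω ∈ Ioo (0 : ℝ) 1, deriv (deriv (pushCurve d a₀ ε k X)) ω =
      (-(ε * (2 * Real.pi) ^ 2 * Real.sin (2 * Real.pi * ((ω + k) / d)))
        - 2 * (deriv X ((ω + k) / d) ^ 2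
          + X ((ω + k) / d) * deriv (deriv X) ((ω + k) / d))) / d ^ 2 := by
    intro ω hω
    have he : deriv (pushCurve d a₀ ε k X) =ᶠ[𝓝 ω] fun ω =>
        (ε * (2 * Real.pi) * Real.cos (2 * Real.pi * ((ω + k) / d))
        - 2 * (X ((ω + k) / d) * deriv X ((ω + k) / d))) / d := by
      filter_upwards [isOpen_Ioo.mem_nhds hω] with ω' hω' using hderiv ω' hω'
    rw [he.deriv_eq]
    have hXω := (hX.hasDerivAt (hmaps hω)).comp ω (hcol ω)
    have hXω' := (hX.hasDerivAt_deriv (hmaps hω)).comp ω (hcol ω)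
    have h3 := (((hang ω).cos.const_mul (ε * (2 * Real.pi))).sub
      ((hXω.mul hXω').const_mul 2)).div_const (d : ℝ)
    refine (h3.congr_deriv ?_).deriv
    simp only [comp_apply]
    field_simp
  refine ⟨?_, fun ω hω => ?_⟩
  · unfold pushCurve
    have h3 : ContDiff ℝ 2 fun ω : ℝ => (ω + k) / d := by fun_prop
    have h4 : ContDiff ℝ 2 fun ω : ℝ => a₀ + ε * Real.sin (2 * Real.pi * ((ω + k) / d)) := by
      fun_prop
    exact h4.contDiffOn.sub ((hX.1.comp h3.contDiffOn hmaps).pow 2)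
  · rw [hderiv ω hω, hderiv2 ω hω]
    set θ := (ω + k) / d
    have hθ : θ ∈ Ioo (0 : ℝ) 1 := hmaps hω
    obtain ⟨b1, b2⟩ := hX.2 θ hθ
    have b0 := h2 θ hθ
    have hc : |Real.cos (2 * Real.pi * θ)| ≤ 1 := Real.abs_cos_le_one _
    have hs : |Real.sin (2 * Real.pi * θ)| ≤ 1 := Real.abs_sin_le_one _
    constructor
    · rw [abs_div, abs_of_pos hd0, div_le_iff₀ hd0]
      calc |ε * (2 * Real.pi) * Real.cos (2 * Real.pi * θ) - 2 * (X θ * deriv X θ)|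
          ≤ |ε * (2 * Real.pi) * Real.cos (2 * Real.pi * θ)| + |2 * (X θ * deriv X θ)| := abs_sub _ _
        _ = ε * (2 * Real.pi) * |Real.cos (2 * Real.pi * θ)| + 2 * (|X θ| * |deriv X θ|) := by
          rw [abs_mul, abs_mul 2, abs_mul (X θ), abs_of_pos (by positivity : 0 < ε * (2 * Real.pi)),
            abs_of_pos (two_pos : (0 : ℝ) < 2)]
        _ ≤ ε * (2 * Real.pi) * 1 + 2 * (2 * ε) := by gcongr
        _ ≤ ε * d := by nlinarith
    · have hd2 : (256 : ℝ) ≤ d ^ 2 := by nlinarith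
      rw [abs_div, abs_of_pos (by positivity : (0 : ℝ) < d ^ 2), div_le_iff₀ (by positivity)]
      calc |-(ε * (2 * Real.pi) ^ 2 * Real.sin (2 * Real.pi * θ))
            - 2 * (deriv X θ ^ 2 + X θ * deriv (deriv X) θ)|
          ≤ |-(ε * (2 * Real.pi) ^ 2 * Real.sin (2 * Real.pi * θ))|
            + |2 * (deriv X θ ^ 2 + X θ * deriv (deriv X) θ)| := abs_sub _ _
        _ ≤ |-(ε * (2 * Real.pi) ^ 2 * Real.sin (2 * Real.pi * θ))|
            + 2 * (|deriv X θ| ^ 2 + |X θ| * |deriv (deriv X) θ|) := by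
          gcongr
          rw [abs_mul 2, abs_of_pos (two_pos : (0 : ℝ) < 2)]
          gcongr
          refine (abs_add_le _ _).trans ?_
          rw [abs_mul, abs_pow]
        _ = ε * (2 * Real.pi) ^ 2 * |Real.sin (2 * Real.pi * θ)|
            + 2 * (|deriv X θ| ^ 2 + |X θ| * |deriv (deriv X) θ|) := by
          rw [abs_neg, abs_mul, abs_of_pos (by positivity : 0 < ε * (2 * Real.pi) ^ 2)]
        _ ≤ ε * (2 * Real.pi) ^ 2 * 1 + 2 * (ε ^ 2 + 2 * ε) := by gcongr
        _ ≤ ε * 40 * 1 + 2 * (ε * 1 + 2 * ε) := by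
          have h5 : (2 * Real.pi) ^ 2 ≤ 40 := by nlinarith
          rw [sq ε]
          gcongr
        _ ≤ ε * d ^ 2 := by nlinarith

/-! ### Growth of the fibres -/

/-- The standing assumptions on the parameters and on the invariant interval `[u, v]`. -/
structure Setting (d : ℕ) (a₀ ε u v b : ℝ) : Prop where
  sixteen_le : 16 ≤ d
  eps_pos : 0 < ε
  eps_le_one : ε ≤ 1
  bound_lt_two : b < 2
  abs_le : ∀ x ∈ Icc u v, |x| ≤ b
  invariant : ∀ θ : ℝ, ∀ x ∈ Icc u v, a₀ + ε * Real.sin (2 * Real.pi * θ) - x ^ 2 ∈ Icc u v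

/-- Every fibre of `R` has length at least `ℓ` in the metric `ρ |dx|`. -/
def HasMass {K : Set ℝ} (ρ : ℝ → ℝ) (ℓ : ℝ) (R : Rectangle K) : Prop :=
  ∀ θ ∈ Icc (0 : ℝ) 1, ENNReal.ofReal ℓ ≤ ∫⁻ x in Icc (R.bottom θ) (R.top θ), ENNReal.ofReal (ρ x)

/-- The change of variables `y = F - x²` on an interval that does not contain `0`. -/
theorem mul_lintegral_le_of_expand {ρ : ℝ → ℝ} {Λ F p q : ℝ} (hΛ : 0 ≤ Λ) (hpq : 0 < p ∨ q < 0)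
    (hle : p ≤ q) (h : ∀ x ∈ Icc p q, Λ * ρ x ≤ 2 * |x| * ρ (F - x ^ 2)) :
    ENNReal.ofReal Λ * ∫⁻ x in Icc p q, ENNReal.ofReal (ρ x) ≤
      ∫⁻ y in Icc (F - max (p ^ 2) (q ^ 2)) (F - min (p ^ 2) (q ^ 2)), ENNReal.ofReal (ρ y) := by
  have hder : ∀ x ∈ Icc p q, HasDerivWithinAt (fun x : ℝ => F - x ^ 2) (-(2 * x)) (Icc p q) x := by
    intro x _
    have h1 : HasDerivAt (fun x : ℝ => F - x ^ 2) (-(2 * x)) x := by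
      simpa using (hasDerivAt_pow 2 x).const_sub F
    exact h1.hasDerivWithinAt
  have hinj : InjOn (fun x : ℝ => F - x ^ 2) (Icc p q) := by
    intro x hx y hy e
    have e3 : x ^ 2 = y ^ 2 := by
      have e : F - x ^ 2 = F - y ^ 2 := e
      linarith
    rcases sq_eq_sq_iff_eq_or_eq_neg.1 e3 with e4 | e4
    · exact e4
    · rcases hpq with h0 | h0
      · linarith [hx.1, hy.1]
      · linarith [hx.2, hy.2]
  have himg : (fun x : ℝ => F - x ^ 2) '' Icc p q ⊆
      Icc (F - max (p ^ 2) (q ^ 2)) (F - min (p ^ 2) (q ^ 2)) := by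
    rintro _ ⟨x, hx, rfl⟩
    have h1 : min (p ^ 2) (q ^ 2) ≤ x ^ 2 := by
      rcases hpq with h0 | h0
      · exact (min_le_left _ _).trans (by nlinarith [hx.1])
      · exact (min_le_right _ _).trans (by nlinarith [hx.2])
    have h2 : x ^ 2 ≤ max (p ^ 2) (q ^ 2) := by
      rcases hpq with h0 | h0
      · exact le_trans (by nlinarith [hx.1, hx.2]) (le_max_right _ _)
      · exact le_trans (by nlinarith [hx.1, hx.2]) (le_max_left _ _)
    exact ⟨by simp only; linarith, by simp only; linarith⟩
  calc ENNReal.ofReal Λ * ∫⁻ x in Icc p q, ENNReal.ofReal (ρ x)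
      = ∫⁻ x in Icc p q, ENNReal.ofReal Λ * ENNReal.ofReal (ρ x) :=
        (lintegral_const_mul' _ _ ENNReal.ofReal_ne_top).symm
    _ ≤ ∫⁻ x in Icc p q, ENNReal.ofReal |-(2 * x)| * ENNReal.ofReal (ρ (F - x ^ 2)) := by
        refine setLIntegral_mono' measurableSet_Icc fun x hx => ?_
        rw [← ENNReal.ofReal_mul hΛ, ← ENNReal.ofReal_mul (abs_nonneg _), abs_neg, abs_mul,
          abs_of_pos (two_pos : (0 : ℝ) < 2)]
        exact ENNReal.ofReal_le_ofReal (h x hx)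
    _ = ∫⁻ y in (fun x : ℝ => F - x ^ 2) '' Icc p q, ENNReal.ofReal (ρ y) :=
        (lintegral_image_eq_lintegral_abs_deriv_mul measurableSet_Icc hder hinj
          fun y => ENNReal.ofReal (ρ y)).symm
    _ ≤ _ := lintegral_mono_set himg

section Step

variable {d : ℕ} {a₀ ε u v b c h : ℝ} {𝒯 : Bool → Set (Set Phase)} {q : ℕ} {L : Set Bool}

/-- A rectangle over the circle whose horizontal sides are admissible. -/
structure IsFull (ε : ℝ) {K : Set ℝ} (R : Rectangle K) : Prop where
  full : R.HasFullBasis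
  adm : R.Admissible ε

theorem IsFull.bottom_adm {K : Set ℝ} {R : Rectangle K} (hR : IsFull ε R) :
    AdmissibleCurve ε 0 1 R.bottom := by
  have := hR.adm.1
  rwa [hR.full.1, hR.full.2] at this

theorem IsFull.top_adm {K : Set ℝ} {R : Rectangle K} (hR : IsFull ε R) :
    AdmissibleCurve ε 0 1 R.top := by
  have := hR.adm.2
  rwa [hR.full.1, hR.full.2] at this

theorem IsFull.mem_Icc {K : Set ℝ} {R : Rectangle K} (hR : IsFull ε R) {θ : ℝ} :
    θ ∈ Icc R.left R.right ↔ θ ∈ Icc (0 : ℝ) 1 := by rw [hR.full.1, hR.full.2]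

theorem IsFull.mem_Ioo {K : Set ℝ} {R : Rectangle K} (hR : IsFull ε R) {θ : ℝ} :
    θ ∈ Ioo R.left R.right ↔ θ ∈ Ioo (0 : ℝ) 1 := by rw [hR.full.1, hR.full.2]

theorem IsFull.abs_bottom_sub_le {K : Set ℝ} {R : Rectangle K} (hR : IsFull ε R) (hε : 0 ≤ ε)
    {θ θ' : ℝ} (hθ : θ ∈ Icc (0 : ℝ) 1) (hθ' : θ' ∈ Icc (0 : ℝ) 1) :
    |R.bottom θ - R.bottom θ'| ≤ ε := by
  have := R.continuousOn_bottom
  rw [hR.full.1, hR.full.2] at this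
  exact hR.bottom_adm.abs_sub_le hε this hθ hθ'

theorem IsFull.abs_top_sub_le {K : Set ℝ} {R : Rectangle K} (hR : IsFull ε R) (hε : 0 ≤ ε)
    {θ θ' : ℝ} (hθ : θ ∈ Icc (0 : ℝ) 1) (hθ' : θ' ∈ Icc (0 : ℝ) 1) :
    |R.top θ - R.top θ'| ≤ ε := by
  have := R.continuousOn_top
  rw [hR.full.1, hR.full.2] at this
  exact hR.top_adm.abs_sub_le hε this hθ hθ'

/-- If a rectangle stays away from the critical point, then its columns are mapped to
full admissible rectangles, and the length of the fibres grows with the expansion factor. -/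
theorem splits_of_images (S : Setting d a₀ ε u v b) {ρ : ℝ → ℝ} {Λ ℓ : ℝ} (hΛ : 0 ≤ Λ)
    (hεc : ε < c) {R : Rectangle (Icc u v)} (hR : IsFull ε R) (hm : HasMass ρ ℓ R)
    (haway : ∀ θ ∈ Icc (0 : ℝ) 1, ∀ x ∈ Icc (R.bottom θ) (R.top θ), c ≤ |x|)
    (hexp : ∀ θ ∈ Icc (0 : ℝ) 1, ∀ x ∈ Icc (R.bottom θ) (R.top θ),
      Λ * ρ x ≤ 2 * |x| * ρ (a₀ + ε * Real.sin (2 * Real.pi * θ) - x ^ 2))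
    (hQ : ∀ Q : Rectangle (Icc u v), IsFull ε Q → HasMass ρ (Λ * ℓ) Q →
      Splits d a₀ ε c h 𝒯 q L Q) :
    Splits d a₀ ε c h 𝒯 (q + 1) L R := by
  have hε := S.eps_pos
  have hc : 0 < c := hε.trans hεc
  have hd : 0 < d := by have := S.sixteen_le; omega
  have hd' : (0 : ℝ) < d := by exact_mod_cast hd
  have hbt : ∀ θ ∈ Icc (0 : ℝ) 1, R.bottom θ ≤ R.top θ := fun θ hθ =>
    R.bottom_le_top (hR.mem_Icc.2 hθ)
  have h0mem : (0 : ℝ) ∈ Icc (0 : ℝ) 1 := by simp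
  -- the side of `S¹ × {0}` on which `R` lies
  obtain ⟨s, hs, hsign⟩ : ∃ s : ℝ, (s = 1 ∨ s = -1) ∧
      ∀ θ ∈ Icc (0 : ℝ) 1, 0 < s * R.bottom θ ∧ 0 < s * R.top θ := by
    have h0 : 0 < R.bottom 0 ∨ R.top 0 < 0 := by
      by_contra! h1
      have := haway 0 h0mem 0 h1
      simp at this
      linarith
    rcases h0 with h0 | h0
    · refine ⟨1, Or.inl rfl, fun θ hθ => ?_⟩
      have h1 := haway 0 h0mem _ (left_mem_Icc.2 (hbt 0 h0mem))
      rw [abs_of_pos h0] at h1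
      have h2 := (abs_le.1 (hR.abs_bottom_sub_le hε.le hθ h0mem)).1
      have := hbt θ hθ
      constructor <;> linarith
    · refine ⟨-1, Or.inr rfl, fun θ hθ => ?_⟩
      have h1 := haway 0 h0mem _ (right_mem_Icc.2 (hbt 0 h0mem))
      rw [abs_of_neg h0] at h1
      have h2 := (abs_le.1 (hR.abs_top_sub_le hε.le hθ h0mem)).2
      have := hbt θ hθ
      constructor <;> linarith
  have hside : ∀ θ ∈ Icc (0 : ℝ) 1, 0 < R.bottom θ ∨ R.top θ < 0 := by
    intro θ hθ
    rcases hs with rfl | rfl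
    · exact Or.inl (by linarith [(hsign θ hθ).1])
    · exact Or.inr (by linarith [(hsign θ hθ).2])
  have hb2 : ∀ θ ∈ Icc (0 : ℝ) 1, |R.bottom θ| ≤ 2 := fun θ hθ =>
    (S.abs_le _ (R.bottom_mem θ (hR.mem_Icc.2 hθ))).trans S.bound_lt_two.le
  have ht2 : ∀ θ ∈ Icc (0 : ℝ) 1, |R.top θ| ≤ 2 := fun θ hθ =>
    (S.abs_le _ (R.top_mem θ (hR.mem_Icc.2 hθ))).trans S.bound_lt_two.le
  -- the images of the columns
  have himg : ∀ k : Fin d, ∃ Q : Rectangle (Icc u v), IsFull ε Q ∧ IsColumnImage d a₀ ε k R Q := by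
    intro k
    have hcont : ∀ X : ℝ → ℝ, ContinuousOn X (Icc 0 1) →
        ContinuousOn (pushCurve d a₀ ε k X) (Icc 0 1) := by
      intro X hX
      unfold pushCurve
      refine ContinuousOn.sub (by fun_prop) (ContinuousOn.pow ?_ 2)
      exact hX.comp (by fun_prop) fun ω hω => column_Icc k.2 hω
    have hmem : ∀ X : ℝ → ℝ, (∀ θ ∈ Icc (0 : ℝ) 1, X θ ∈ Icc u v) →
        ∀ ω ∈ Icc (0 : ℝ) 1, pushCurve d a₀ ε k X ω ∈ Icc u v := fun X hX ω hω =>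
      S.invariant _ _ (hX _ (column_Icc k.2 hω))
    have hcb := R.continuousOn_bottom
    have hct := R.continuousOn_top
    have hmb := R.bottom_mem
    have hmt := R.top_mem
    rw [hR.full.1, hR.full.2] at hcb hct hmb hmt
    have hab := hR.bottom_adm.push S.sixteen_le k.2 a₀ hε S.eps_le_one fun θ hθ =>
      hb2 θ (Ioo_subset_Icc_self hθ)
    have hat := hR.top_adm.push S.sixteen_le k.2 a₀ hε S.eps_le_one fun θ hθ =>
      ht2 θ (Ioo_subset_Icc_self hθ)
    have hinv : ∀ θ : ℝ, (d * θ - (k : ℕ) + (k : ℕ) : ℝ) / d = θ := fun θ => by field_simp; ring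
    have hcolθ : ∀ θ : ℝ, (d * θ - (k : ℕ) : ℝ) ∈ Icc (0 : ℝ) 1 → θ ∈ Icc (0 : ℝ) 1 := fun θ hθ => by
      have := column_Icc k.2 hθ
      rwa [hinv] at this
    rcases hs with rfl | rfl
    · refine ⟨⟨0, 1, pushCurve d a₀ ε k R.top, pushCurve d a₀ ε k R.bottom, le_rfl, one_pos, le_rfl,
        hcont _ hct, hcont _ hcb, hmem _ hmt, hmem _ hmb, fun ω hω => ?_⟩, ⟨⟨rfl, rfl⟩, hat, hab⟩,
        fun θ hθ => ?_⟩
      · have h1 := column_Ioo k.2 hω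
        have h2 := (hsign _ (Ioo_subset_Icc_self h1)).1
        have h3 := R.bottom_lt_top _ (hR.mem_Ioo.2 h1)
        unfold pushCurve
        rw [one_mul] at h2
        gcongr
      · have h1 := hcolθ θ hθ
        have h2 := (hsign θ h1).1
        have h3 := hbt θ h1
        rw [one_mul] at h2
        have h4 : R.bottom θ ^ 2 ≤ R.top θ ^ 2 := by gcongr
        rw [max_eq_right h4, min_eq_left h4]
        simp only [pushCurve, hinv, and_self]
    · refine ⟨⟨0, 1, pushCurve d a₀ ε k R.bottom, pushCurve d a₀ ε k R.top, le_rfl, one_pos, le_rfl,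
        hcont _ hcb, hcont _ hct, hmem _ hmb, hmem _ hmt, fun ω hω => ?_⟩, ⟨⟨rfl, rfl⟩, hab, hat⟩,
        fun θ hθ => ?_⟩
      · have h1 := column_Ioo k.2 hω
        have h2 := (hsign _ (Ioo_subset_Icc_self h1)).2
        have h3 := R.bottom_lt_top _ (hR.mem_Ioo.2 h1)
        unfold pushCurve
        have h4 : R.top ((ω + (k : ℕ)) / d) ^ 2 < R.bottom ((ω + (k : ℕ)) / d) ^ 2 := by nlinarith
        linarith
      · have h1 := hcolθ θ hθ
        have h2 := (hsign θ h1).2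
        have h3 := hbt θ h1
        have h4 : R.top θ ^ 2 ≤ R.bottom θ ^ 2 := by nlinarith
        rw [max_eq_left h4, min_eq_right h4]
        simp only [pushCurve, hinv, and_self]
  choose Q hQfull hQimg using himg
  refine splits_of_columns hd (fun x hx => (S.abs_le x hx).trans S.bound_lt_two.le) ordConnected_Icc
    hR.full hs hsign ?_ Q (fun k => (hQfull k).full) hQimg fun k => hQ _ (hQfull k) ?_
  · intro p hp
    obtain ⟨θ, hθ, x, hx, rfl⟩ := R.exists_of_mem_carrier hp
    exact haway θ (Ioo_subset_Icc_self (hR.mem_Ioo.1 hθ)) x (Ioo_subset_Icc_self hx)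
  · intro ω hω
    have hθ := column_Icc k.2 hω
    have hω' : (d * ((ω + (k : ℕ)) / d) - (k : ℕ) : ℝ) = ω := by field_simp; ring
    have h1 := hQimg k ((ω + (k : ℕ)) / d) (by rw [hω']; exact hω)
    rw [hω'] at h1
    rw [h1.1, h1.2, ENNReal.ofReal_mul hΛ]
    refine le_trans ?_ (mul_lintegral_le_of_expand hΛ (hside _ hθ) (hbt _ hθ) (hexp _ hθ))
    gcongr
    exact hm _ hθ

end Step

/-! ### Gentle rectangles and the decomposition near the critical circle -/

/-- The targets of a dissection: the strips `S¹ × I₁`, `S¹ × I₋₁` for the label `true`, and the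
admissible gentle rectangles with left side at least `c` for the label `false`. -/
def target (ε u v c : ℝ) : Bool → Set (Set Phase)
  | true => {strip (core ε 1), strip (coreNeg ε 1)}
  | false => {T | ∃ Q : Rectangle (Icc u v),
      T = Q.carrier ∧ Q.Admissible ε ∧ Gentle ε Q.carrier ∧ c ≤ Q.leftSize}

/-- The endpoints `√ε e^{-m}` of the intervals `I_r`. -/
def coreScale (ε : ℝ) (m : ℕ) : ℝ := √ε * Real.exp (-(m : ℝ))

theorem core_succ (ε : ℝ) (r : ℕ) : core ε (r + 1) = Ioo (coreScale ε (r + 1)) (coreScale ε r) := by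
  simp [core, coreScale]

theorem coreScale_zero (ε : ℝ) : coreScale ε 0 = √ε := by simp [coreScale]

theorem coreScale_pos {ε : ℝ} (hε : 0 < ε) (m : ℕ) : 0 < coreScale ε m :=
  mul_pos (Real.sqrt_pos.2 hε) (Real.exp_pos _)

theorem coreScale_add (ε : ℝ) (m k : ℕ) :
    Real.exp k * coreScale ε (m + k) = coreScale ε m := by
  unfold coreScale
  rw [mul_left_comm, ← Real.exp_add]
  congr 2
  push_cast
  ring

theorem coreScale_anti {ε : ℝ} {m k : ℕ} (h : m ≤ k) : coreScale ε k ≤ coreScale ε m := by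
  unfold coreScale
  gcongr

theorem two_mul_coreScale_succ_le {ε : ℝ} (hε : 0 < ε) (m : ℕ) :
    2 * coreScale ε (m + 1) ≤ coreScale ε m := by
  rw [← coreScale_add ε m 1]
  have h1 := Real.add_one_le_exp (1 : ℝ)
  have := coreScale_pos hε (m + 1)
  push_cast
  gcongr
  linarith

theorem two_mul_coreScale_le {ε : ℝ} (hε : 0 < ε) {m k : ℕ} (h : m < k) :
    2 * coreScale ε k ≤ coreScale ε m :=
  le_trans (by gcongr; exact coreScale_anti h) (two_mul_coreScale_succ_le hε m)

/-- Every small positive number is comparable to one of the scales `√ε e^{-m}`. -/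
theorem exists_coreScale_le {ε w : ℝ} (hε : 0 < ε) (hw : 0 < w) :
    ∃ m : ℕ, coreScale ε m ≤ w ∧ min w (√ε) ≤ Real.exp 1 * coreScale ε m := by
  have hs := Real.sqrt_pos.2 hε
  have hex : ∃ m : ℕ, coreScale ε m ≤ w := by
    obtain ⟨m, hm⟩ := exists_nat_ge (√ε / w)
    refine ⟨m, ?_⟩
    unfold coreScale
    rw [Real.exp_neg, ← div_eq_mul_inv, div_le_iff₀ (Real.exp_pos _)]
    rw [div_le_iff₀ hw] at hm
    have := Real.add_one_le_exp (m : ℝ)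
    nlinarith
  classical
  refine ⟨Nat.find hex, Nat.find_spec hex, ?_⟩
  rcases h : Nat.find hex with _ | m
  · rw [coreScale_zero]
    have := Real.add_one_le_exp (1 : ℝ)
    exact (min_le_right _ _).trans (by nlinarith)
  · have h1 : ¬ coreScale ε m ≤ w := Nat.find_min hex (by omega)
    have h2 := coreScale_add ε m 1
    rw [Nat.cast_one] at h2
    rw [h2]
    exact (min_le_left _ _).trans (not_le.1 h1).le

section Sides

variable {K : Set ℝ}

/-- The lower side of `R` in the coordinate `x` if `s`, in the coordinate `-x` otherwise. -/
def Rectangle.inner (s : Bool) (R : Rectangle K) (θ : ℝ) : ℝ := if s then R.bottom θ else -R.top θ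

/-- The upper side of `R` in the coordinate `x` if `s`, in the coordinate `-x` otherwise. -/
def Rectangle.outer (s : Bool) (R : Rectangle K) (θ : ℝ) : ℝ := if s then R.top θ else -R.bottom θ

theorem Rectangle.outer_sub_inner (s : Bool) (R : Rectangle K) (θ : ℝ) :
    R.outer s θ - R.inner s θ = R.top θ - R.bottom θ := by
  cases s <;> simp [Rectangle.outer, Rectangle.inner]; ring

theorem Rectangle.exists_signed_mem (s : Bool) (R : Rectangle K) {θ x : ℝ}
    (hx : x ∈ Icc (R.bottom θ) (R.top θ)) :
    ∃ y ∈ Icc (R.inner s θ) (R.outer s θ), |x| = |y| := by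
  cases s
  · exact ⟨-x, ⟨neg_le_neg hx.2, neg_le_neg hx.1⟩, (abs_neg x).symm⟩
  · exact ⟨x, hx, rfl⟩

variable {d : ℕ} {a₀ ε c h : ℝ} {𝒯 : Bool → Set (Set Phase)} {q : ℕ}

/-- Cutting a full rectangle at the signed level `e`. -/
theorem splits_of_signed_cut {u v : ℝ} (hε : 0 ≤ ε) (s : Bool) {R : Rectangle (Icc u v)}
    (hR : IsFull ε R) {e : ℝ}
    (hi : ∀ θ ∈ Icc (0 : ℝ) 1, R.inner s θ < e) (ho : ∀ θ ∈ Icc (0 : ℝ) 1, e < R.outer s θ)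
    {L₁ L₂ : Set Bool}
    (h₁ : ∀ Q : Rectangle (Icc u v), IsFull ε Q → Q.inner s = R.inner s →
      (∀ θ, Q.outer s θ = e) → Splits d a₀ ε c h 𝒯 q L₁ Q)
    (h₂ : ∀ Q : Rectangle (Icc u v), IsFull ε Q → Q.outer s = R.outer s →
      (∀ θ, Q.inner s θ = e) → Splits d a₀ ε c h 𝒯 q L₂ Q) :
    Splits d a₀ ε c h 𝒯 q (L₁ ∪ L₂) R := by
  have h0 : (0 : ℝ) ∈ Icc (0 : ℝ) 1 := by simp
  have hbK := R.bottom_mem 0 (hR.mem_Icc.2 h0)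
  have htK := R.top_mem 0 (hR.mem_Icc.2 h0)
  cases s
  · have hb : ∀ θ ∈ Icc (0 : ℝ) 1, R.bottom θ < -e := fun θ hθ => by
      have : e < -R.bottom θ := ho θ hθ
      linarith
    have ht : ∀ θ ∈ Icc (0 : ℝ) 1, -e < R.top θ := fun θ hθ => by
      have : -R.top θ < e := hi θ hθ
      linarith
    rw [union_comm]
    have he : -e ∈ Icc u v := ⟨hbK.1.trans (hb 0 h0).le, (ht 0 h0).le.trans htK.2⟩
    have hb' := fun θ hθ => hb θ (Ioo_subset_Icc_self (hR.mem_Ioo.1 hθ))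
    have ht' := fun θ hθ => ht θ (Ioo_subset_Icc_self (hR.mem_Ioo.1 hθ))
    refine splits_of_cut he hb' ht'
      (h₂ (R.below (-e) he hb') ⟨hR.full, hR.adm.1, admissibleCurve_const hε _ _ _⟩ rfl fun θ => ?_)
      (h₁ (R.above (-e) he ht') ⟨hR.full, admissibleCurve_const hε _ _ _, hR.adm.2⟩ rfl fun θ => ?_)
    · simp [Rectangle.inner, Rectangle.below]
    · simp [Rectangle.outer, Rectangle.above]
  · have hb : ∀ θ ∈ Icc (0 : ℝ) 1, R.bottom θ < e := hi
    have ht : ∀ θ ∈ Icc (0 : ℝ) 1, e < R.top θ := ho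
    have he : e ∈ Icc u v := ⟨hbK.1.trans (hb 0 h0).le, (ht 0 h0).le.trans htK.2⟩
    have hb' := fun θ hθ => hb θ (Ioo_subset_Icc_self (hR.mem_Ioo.1 hθ))
    have ht' := fun θ hθ => ht θ (Ioo_subset_Icc_self (hR.mem_Ioo.1 hθ))
    refine splits_of_cut he hb' ht'
      (h₁ (R.below e he hb') ⟨hR.full, hR.adm.1, admissibleCurve_const hε _ _ _⟩ rfl fun θ => ?_)
      (h₂ (R.above e he ht') ⟨hR.full, admissibleCurve_const hε _ _ _, hR.adm.2⟩ rfl fun θ => ?_)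
    · simp [Rectangle.outer, Rectangle.below]
    · simp [Rectangle.inner, Rectangle.above]

/-- The carrier of a full rectangle, reflected if `s` is false. -/
theorem IsFull.mem_signed_carrier {R : Rectangle K} (hR : IsFull ε R) (s : Bool) {θ x : ℝ}
    (hθ : θ ∈ Ioo (0 : ℝ) 1) :
    ((θ : UnitAddCircle), if s then x else -x) ∈ R.carrier ↔
      x ∈ Ioo (R.inner s θ) (R.outer s θ) := by
  rw [R.mem_carrier_iff hθ, hR.mem_Ioo, and_iff_right hθ]
  cases s
  · simp only [Rectangle.inner, Rectangle.outer, Bool.false_eq_true, if_false]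
    constructor <;> rintro ⟨h1, h2⟩ <;> constructor <;> linarith
  · simp [Rectangle.inner, Rectangle.outer]

theorem gentle_of_gentleAbove {A : Set Phase} (s : Bool)
    (hA : GentleAbove ε {p | (p.1, if s then p.2 else -p.2) ∈ A}) : Gentle ε A := by
  cases s
  · exact Or.inr (by simpa using hA)
  · exact Or.inl (by simpa using hA)

/-- A full rectangle that covers six consecutive scales is gentle. -/
theorem splits_of_covers {u v : ℝ} (hε : 0 < ε) (s : Bool) {R : Rectangle (Icc u v)}
    (hR : IsFull ε R) (m : ℕ) (hi : ∀ θ ∈ Icc (0 : ℝ) 1, R.inner s θ ≤ coreScale ε (m + 6))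
    (ho : ∀ θ ∈ Icc (0 : ℝ) 1, coreScale ε m ≤ R.outer s θ) (hc : c ≤ coreScale ε (m + 6)) :
    Splits d a₀ ε c c (target ε u v c) q {false} R := by
  have h2 := two_mul_coreScale_le hε (show m < m + 6 by omega)
  have hheight : ∀ θ ∈ Icc (0 : ℝ) 1, c ≤ R.top θ - R.bottom θ := fun θ hθ => by
    rw [← R.outer_sub_inner s]
    linarith [hi θ hθ, ho θ hθ]
  refine splits_of_mem hR.full ⟨R, rfl, hR.adm, gentle_of_gentleAbove s (Or.inr ⟨m + 1, by omega,
    fun j hj => ?_⟩), ?_⟩ fun θ hθ => hheight θ (Ioo_subset_Icc_self hθ)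
  · rintro ⟨_, x⟩ ⟨⟨θ, hθ, rfl⟩, hx⟩
    refine (hR.mem_signed_carrier s hθ).2 ?_
    have hθ' := Ioo_subset_Icc_self hθ
    rw [show m + 1 + j = (m + j) + 1 by omega, core_succ] at hx
    exact ⟨((hi θ hθ').trans (coreScale_anti (by omega))).trans_lt hx.1,
      hx.2.trans_le ((coreScale_anti (by omega)).trans (ho θ hθ'))⟩
  · unfold Rectangle.leftSize
    rw [hR.full.1]
    exact hheight 0 (by simp)

/-- A full rectangle between the levels `√ε` and `1` that reaches `2√ε` is gentle. -/
theorem splits_of_outside {u v : ℝ} (s : Bool) {R : Rectangle (Icc u v)}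
    (hR : IsFull ε R) (hi : ∀ θ ∈ Icc (0 : ℝ) 1, R.inner s θ = √ε)
    (ho : ∀ θ ∈ Icc (0 : ℝ) 1, 2 * √ε ≤ R.outer s θ)
    (ho1 : ∀ θ ∈ Icc (0 : ℝ) 1, R.outer s θ ≤ 1) (hc : c ≤ √ε) :
    Splits d a₀ ε c c (target ε u v c) q {false} R := by
  have hheight : ∀ θ ∈ Icc (0 : ℝ) 1, c ≤ R.top θ - R.bottom θ := fun θ hθ => by
    rw [← R.outer_sub_inner s]
    linarith [hi θ hθ, ho θ hθ]
  refine splits_of_mem hR.full ⟨R, rfl, hR.adm, gentle_of_gentleAbove s (Or.inl ⟨?_, ?_⟩), ?_⟩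
    fun θ hθ => hheight θ (Ioo_subset_Icc_self hθ)
  · rintro ⟨ω, x⟩ hp
    obtain ⟨θ, hθ, y, -, e⟩ := R.exists_of_mem_carrier hp
    have hθ1 := R.Ioo_subset hθ
    obtain rfl : ω = (θ : UnitAddCircle) := (Prod.mk.inj e).1
    have h1 := (hR.mem_signed_carrier s hθ1).1 hp
    have hθ' := Ioo_subset_Icc_self hθ1
    rw [hi θ hθ'] at h1
    exact ⟨⟨θ, hθ1, rfl⟩, h1.1, h1.2.trans_le (ho1 θ hθ')⟩
  · rintro ⟨_, x⟩ ⟨⟨θ, hθ, rfl⟩, hx⟩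
    have hθ' := Ioo_subset_Icc_self hθ
    refine (hR.mem_signed_carrier s hθ).2 ?_
    rw [hi θ hθ']
    exact ⟨hx.1, hx.2.trans_le (ho θ hθ')⟩
  · unfold Rectangle.leftSize
    rw [hR.full.1]
    exact hheight 0 (by simp)

theorem splits_of_core {u v : ℝ} (s : Bool) {R : Rectangle (Icc u v)}
    (hR : IsFull ε R) (hi : ∀ θ, R.inner s θ = coreScale ε 1)
    (ho : ∀ θ, R.outer s θ = coreScale ε 0) (hc : c ≤ coreScale ε 0 - coreScale ε 1) :
    Splits d a₀ ε c c (target ε u v c) q {true} R := by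
  refine splits_of_mem hR.full ?_ fun θ hθ => ?_
  · have hmem : ∀ (ω : UnitAddCircle) (x : ℝ), (ω, if s then x else -x) ∈ R.carrier ↔
        (ω, x) ∈ strip (core ε 1) := by
      intro ω x
      constructor
      · intro hp
        obtain ⟨θ, hθ, y, -, e⟩ := R.exists_of_mem_carrier hp
        have hθ1 := R.Ioo_subset hθ
        obtain rfl : ω = (θ : UnitAddCircle) := (Prod.mk.inj e).1
        have h1 := (hR.mem_signed_carrier s hθ1).1 hp
        rw [hi, ho, ← core_succ] at h1
        exact ⟨⟨θ, hθ1, rfl⟩, h1⟩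
      · rintro ⟨⟨θ, hθ, rfl⟩, hx⟩
        refine (hR.mem_signed_carrier s hθ).2 ?_
        rw [hi, ho, ← core_succ]
        exact hx
    cases s
    · right
      ext ⟨ω, x⟩
      have := hmem ω (-x)
      simp only [Bool.false_eq_true, if_false, neg_neg] at this
      rw [this]
      simp [strip, coreNeg]
    · left
      ext ⟨ω, x⟩
      exact hmem ω x
  · rw [← R.outer_sub_inner s, hi, ho]
    exact hc

theorem hasMass_of_height {ρ : ℝ → ℝ} {κ δ : ℝ} (hκ0 : 0 ≤ κ) {R : Rectangle K}
    (hρ : ∀ θ ∈ Icc (0 : ℝ) 1, ∀ x ∈ Icc (R.bottom θ) (R.top θ), κ ≤ ρ x)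
    (hδ : ∀ θ ∈ Icc (0 : ℝ) 1, δ ≤ R.top θ - R.bottom θ) : HasMass ρ (κ * δ) R := by
  intro θ hθ
  calc ENNReal.ofReal (κ * δ) ≤ ENNReal.ofReal κ * volume (Icc (R.bottom θ) (R.top θ)) := by
        rw [Real.volume_Icc, ENNReal.ofReal_mul hκ0]
        gcongr
        exact hδ θ hθ
    _ = ∫⁻ _ in Icc (R.bottom θ) (R.top θ), ENNReal.ofReal κ := (setLIntegral_const _ _).symm
    _ ≤ _ := setLIntegral_mono' measurableSet_Icc fun x hx =>
        ENNReal.ofReal_le_ofReal (hρ θ hθ x hx)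

theorem HasMass.mono {ρ : ℝ → ℝ} {ℓ ℓ' : ℝ} {R : Rectangle K} (hm : HasMass ρ ℓ R) (h : ℓ' ≤ ℓ) :
    HasMass ρ ℓ' R := fun θ hθ => (ENNReal.ofReal_le_ofReal h).trans (hm θ hθ)

theorem HasMass.le_of_bound {ρ : ℝ → ℝ} {ℓ C : ℝ} {R : Rectangle K} (hm : HasMass ρ ℓ R) {θ : ℝ}
    (hθ : θ ∈ Icc (0 : ℝ) 1) (hC : 0 ≤ C) (hbt : R.bottom θ ≤ R.top θ)
    (hρ : ∀ x ∈ Icc (R.bottom θ) (R.top θ), ρ x ≤ C) : ℓ ≤ C * (R.top θ - R.bottom θ) := by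
  have h1 : ENNReal.ofReal ℓ ≤ ENNReal.ofReal (C * (R.top θ - R.bottom θ)) :=
    calc ENNReal.ofReal ℓ ≤ ∫⁻ x in Icc (R.bottom θ) (R.top θ), ENNReal.ofReal (ρ x) := hm θ hθ
      _ ≤ ∫⁻ _ in Icc (R.bottom θ) (R.top θ), ENNReal.ofReal C :=
        setLIntegral_mono' measurableSet_Icc fun x hx => ENNReal.ofReal_le_ofReal (hρ x hx)
      _ = _ := by rw [setLIntegral_const, Real.volume_Icc, ENNReal.ofReal_mul hC]
  exact (ENNReal.ofReal_le_ofReal_iff (mul_nonneg hC (by linarith))).1 h1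

end Sides

/-! ### The two recursions -/

/-- The relations between the scales: `c` is the distance from the critical circle at which
the expansion begins, and `ℓ₀` the least length of fibres under consideration. -/
structure Scales (ε c κ C lam Lam ℓ₀ : ℝ) : Prop where
  eps_lt : ε < c
  le_sqrt : 4 * Real.exp 14 * c ≤ √ε
  sqrt_le : 4 * √ε ≤ 1
  kappa_pos : 0 < κ
  C_pos : 0 < C
  one_lt_lam : 1 < lam
  mass_pos : 0 < ℓ₀
  mass_ge : 8 * Real.exp 14 * C * c ≤ ℓ₀
  mass_le : ℓ₀ ≤ κ / 4
  Lam_ge : 8 * Real.exp 8 * C * lam ≤ Lam * κ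

section Recursion

variable {d : ℕ} {a₀ ε u v b c κ C lam Lam ℓ₀ M : ℝ} {ρ : ℝ → ℝ}

/-- A rectangle with long fibres that touches the `c`-neighbourhood of the critical circle
reaches out, on one side, to a distance `w` which is much larger than `c`. -/
theorem exists_reach (S : Setting d a₀ ε u v b) (hsc : Scales ε c κ C lam Lam ℓ₀)
    (hρ : IsExpanding a₀ b ε c lam Lam κ C M ρ) {R : Rectangle (Icc u v)} (hR : IsFull ε R) {ℓ : ℝ}
    (hℓ : ℓ₀ ≤ ℓ) (hm : HasMass ρ ℓ R)
    (htouch : ∃ θ ∈ Icc (0 : ℝ) 1, ∃ x ∈ Icc (R.bottom θ) (R.top θ), |x| < c) :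
    ∃ (s : Bool) (w : ℝ), 4 * Real.exp 14 * c ≤ w ∧ (10 * √ε ≤ w ∨ ℓ ≤ 2 * C * w) ∧
      ∀ θ ∈ Icc (0 : ℝ) 1, R.inner s θ < 2 * c ∧ w - ε ≤ R.outer s θ := by
  obtain ⟨θ, hθ, x, hx, hxc⟩ := htouch
  have hε := S.eps_pos
  have hεc := hsc.eps_lt
  have hbt := R.bottom_le_top (hR.mem_Icc.2 hθ)
  obtain ⟨hx1, hx2⟩ := abs_lt.1 hxc
  -- the more distant end of the fibre over `θ`
  obtain ⟨s, hs⟩ : ∃ s, R.outer s θ = max (R.top θ) (-R.bottom θ) := by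
    rcases le_total (R.top θ) (-R.bottom θ) with h | h
    · exact ⟨false, (max_eq_right h).symm⟩
    · exact ⟨true, (max_eq_left h).symm⟩
  set w := max (R.top θ) (-R.bottom θ) with hw
  have hw1 : R.top θ ≤ w := le_max_left _ _
  have hw2 : -R.bottom θ ≤ w := le_max_right _ _
  have hlarge : 10 * √ε ≤ w ∨ ℓ ≤ 2 * C * w := by
    by_cases h : 10 * √ε ≤ w
    · exact Or.inl h
    · right
      have h1 := hm.le_of_bound hθ hsc.C_pos.le hbt fun y hy =>
        hρ.le_near y (abs_le.2 ⟨by linarith [hy.1], by linarith [hy.2]⟩)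
      have := hsc.C_pos
      nlinarith
  refine ⟨s, w, ?_, hlarge, fun θ' hθ' => ?_⟩
  · rcases hlarge with h | h
    · have := hsc.le_sqrt
      have := Real.sqrt_nonneg ε
      linarith
    · have h1 := hsc.mass_ge
      have h2 : (2 * C) * (4 * Real.exp 14 * c) ≤ (2 * C) * w := by linarith
      exact le_of_mul_le_mul_left h2 (by have := hsc.C_pos; positivity)
  · have hb := abs_le.1 (hR.abs_bottom_sub_le hε.le hθ' hθ)
    have ht := abs_le.1 (hR.abs_top_sub_le hε.le hθ' hθ)
    cases s
    · have hs : -R.bottom θ = w := hs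
      show -R.top θ' < 2 * c ∧ w - ε ≤ -R.bottom θ'
      constructor <;> linarith [hx.1, hx.2]
    · have hs : R.top θ = w := hs
      show R.bottom θ' < 2 * c ∧ w - ε ≤ R.top θ'
      constructor <;> linarith [hx.1, hx.2]

theorem HasMass.le_bound (S : Setting d a₀ ε u v b) (hsc : Scales ε c κ C lam Lam ℓ₀)
    (hρ : IsExpanding a₀ b ε c lam Lam κ C M ρ) {R : Rectangle (Icc u v)} (hR : IsFull ε R) {ℓ : ℝ}
    (hm : HasMass ρ ℓ R) : ℓ ≤ 4 * M := by
  have h0 : (0 : ℝ) ∈ Icc (0 : ℝ) 1 := by simp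
  have hbK := R.bottom_mem 0 (hR.mem_Icc.2 h0)
  have htK := R.top_mem 0 (hR.mem_Icc.2 h0)
  have hM : 0 ≤ M := by
    have h1 := hρ.le 0 (by norm_num)
    have h2 := hρ.le_bound 0 (by norm_num)
    linarith [hsc.kappa_pos]
  have h1 := hm.le_of_bound h0 hM (R.bottom_le_top (hR.mem_Icc.2 h0)) fun x hx =>
    hρ.le_bound x ((S.abs_le x ⟨hbK.1.trans hx.1, hx.2.trans htK.2⟩).trans_lt S.bound_lt_two)
  have h2 := abs_le.1 (S.abs_le _ hbK)
  have h3 := abs_le.1 (S.abs_le _ htK)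
  nlinarith [S.bound_lt_two]

theorem Scales.c_pos (hsc : Scales ε c κ C lam Lam ℓ₀) (S : Setting d a₀ ε u v b) : 0 < c :=
  S.eps_pos.trans hsc.eps_lt

/-- One step of the dynamics for a rectangle that keeps away from the critical circle. -/
theorem splits_of_away {𝒯 : Bool → Set (Set Phase)} {q : ℕ} {L : Set Bool} {h : ℝ}
    (S : Setting d a₀ ε u v b) (hsc : Scales ε c κ C lam Lam ℓ₀)
    (hρ : IsExpanding a₀ b ε c lam Lam κ C M ρ) {R : Rectangle (Icc u v)} (hR : IsFull ε R) {ℓ : ℝ}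
    (hm : HasMass ρ ℓ R)
    (haway : ∀ θ ∈ Icc (0 : ℝ) 1, ∀ x ∈ Icc (R.bottom θ) (R.top θ), c ≤ |x|)
    (hQ : ∀ Q : Rectangle (Icc u v), IsFull ε Q → HasMass ρ (lam * ℓ) Q →
      Splits d a₀ ε c h 𝒯 q L Q) :
    Splits d a₀ ε c h 𝒯 (q + 1) L R := by
  refine splits_of_images S (zero_le_one.trans hsc.one_lt_lam.le) hsc.eps_lt hR hm haway ?_ hQ
  intro θ hθ x hx
  have hxK : x ∈ Icc u v := ⟨(R.bottom_mem θ (hR.mem_Icc.2 hθ)).1.trans hx.1,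
    hx.2.trans (R.top_mem θ (hR.mem_Icc.2 hθ)).2⟩
  refine hρ.expand x _ (S.abs_le x hxK) (S.abs_le _ (S.invariant θ x hxK)) ?_ (haway θ hθ x hx)
  have h1 : a₀ + ε * Real.sin (2 * Real.pi * θ) - x ^ 2 - quad a₀ x
      = ε * Real.sin (2 * Real.pi * θ) := by simp only [quad]; ring
  rw [h1, abs_mul, abs_of_pos S.eps_pos]
  exact mul_le_of_le_one_right S.eps_pos.le (Real.abs_sin_le_one _)

/-- Every rectangle with long fibres can be dissected into rectangles that return as gentle
rectangles: follow the dynamics until the critical circle is approached. The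
expansion bounds the time this takes. -/
theorem splits_gentle (S : Setting d a₀ ε u v b) (hsc : Scales ε c κ C lam Lam ℓ₀)
    (hρ : IsExpanding a₀ b ε c lam Lam κ C M ρ) (n : ℕ) :
    ∀ (R : Rectangle (Icc u v)) (ℓ : ℝ), IsFull ε R → ℓ₀ ≤ ℓ → HasMass ρ ℓ R →
      4 * M < lam ^ n * ℓ → Splits d a₀ ε c c (target ε u v c) n {false} R := by
  induction n with
  | zero =>
    intro R ℓ hR _ hm hn
    have := hm.le_bound S hsc hρ hR
    rw [pow_zero, one_mul] at hn
    linarith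
  | succ n ih =>
    intro R ℓ hR hℓ hm hn
    have hε := S.eps_pos
    have hc := hsc.c_pos S
    by_cases htouch : ∃ θ ∈ Icc (0 : ℝ) 1, ∃ x ∈ Icc (R.bottom θ) (R.top θ), |x| < c
    · obtain ⟨s, w, hw, -, hreach⟩ := exists_reach S hsc hρ hR hℓ hm htouch
      have hE : 4 * c ≤ 4 * Real.exp 14 * c := by
        have := Real.add_one_le_exp (14 : ℝ)
        nlinarith
      have hwc : 2 * Real.exp 14 * c ≤ w - ε := by linarith [hsc.eps_lt]
      have hcc : 0 < 2 * Real.exp 14 * c := by positivity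
      obtain ⟨m, hm1, hm2⟩ := exists_coreScale_le hε (hcc.trans_le hwc)
      have hm3 : 2 * Real.exp 14 * c ≤ Real.exp 1 * coreScale ε m :=
        (le_min hwc (by linarith [hsc.le_sqrt])).trans hm2
      have hm4 : 2 * c ≤ coreScale ε (m + 6) := by
        have h1 : Real.exp 14 = Real.exp 7 * (Real.exp 1 * Real.exp 6) := by
          rw [← Real.exp_add, ← Real.exp_add]; norm_num
        have h2 := coreScale_add ε m 6
        push_cast at h2
        rw [← h2, h1] at hm3
        have h3 : (Real.exp 1 * Real.exp 6) * (2 * c * Real.exp 7) ≤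
            (Real.exp 1 * Real.exp 6) * coreScale ε (m + 6) := by linarith
        have h4 := le_of_mul_le_mul_left h3 (by positivity)
        have := Real.add_one_le_exp (7 : ℝ)
        nlinarith
      exact splits_of_covers hε s hR m (fun θ hθ => (hreach θ hθ).1.le.trans hm4)
        (fun θ hθ => hm1.trans (hreach θ hθ).2) (by linarith)
    · push Not at htouch
      refine splits_of_away S hsc hρ hR hm htouch fun Q hQ hQm => ih Q _ hQ ?_ hQm ?_
      · nlinarith [hsc.one_lt_lam, hsc.mass_pos]
      · rw [pow_succ, mul_assoc] at hn
        exact hn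

/-- If a full rectangle covers everything between `2c` and `2√ε` then a strip `S¹ × I_{±1}` can be
cut out of it. -/
theorem splits_all_of_crossing (S : Setting d a₀ ε u v b) (hsc : Scales ε c κ C lam Lam ℓ₀)
    (hρ : IsExpanding a₀ b ε c lam Lam κ C M ρ) {N : ℕ} (hN : 4 * M < lam ^ N * ℓ₀) (s : Bool)
    {R : Rectangle (Icc u v)} (hR : IsFull ε R)
    (hi : ∀ θ ∈ Icc (0 : ℝ) 1, R.inner s θ < 2 * c)
    (ho : ∀ θ ∈ Icc (0 : ℝ) 1, 2 * √ε ≤ R.outer s θ) :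
    Splits d a₀ ε c c (target ε u v c) N univ R := by
  have hε := S.eps_pos
  have hc := hsc.c_pos S
  have hs := Real.sqrt_pos.2 hε
  have h01 := two_mul_coreScale_succ_le hε 0
  have hE7 : 2 * c ≤ coreScale ε 7 := by
    have h1 := coreScale_add ε 0 7
    rw [coreScale_zero, zero_add] at h1
    push_cast at h1
    have h2 := hsc.le_sqrt
    have h3 : Real.exp 14 = Real.exp 7 * Real.exp 7 := by
      rw [← Real.exp_add]; norm_num
    rw [← h1, h3] at h2
    have h4 : Real.exp 7 * (4 * Real.exp 7 * c) ≤ Real.exp 7 * coreScale ε 7 := by linarith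
    have h5 := le_of_mul_le_mul_left h4 (Real.exp_pos 7)
    have := Real.add_one_le_exp (7 : ℝ)
    nlinarith
  have h71 : coreScale ε 7 ≤ coreScale ε 1 := coreScale_anti (by norm_num)
  have h00 := coreScale_zero ε
  rw [zero_add] at h01
  have hL : (univ : Set Bool) ⊆ {false} ∪ ({true} ∪ ∅) := by
    intro b _
    cases b <;> simp
  refine Splits.mono ?_ le_rfl hL
  refine splits_of_signed_cut hε.le s hR (e := coreScale ε 1) (fun θ hθ => ?_) (fun θ hθ => ?_)
    (fun Q hQ e1 e2 => ?_) (fun Q hQ e1 e2 => ?_)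
  · linarith [hi θ hθ]
  · linarith [ho θ hθ]
  · exact splits_of_covers hε s hQ 1 (fun θ hθ => by rw [e1]; linarith [hi θ hθ])
      (fun θ _ => (e2 θ).ge) (by show c ≤ coreScale ε 7; linarith)
  refine splits_of_signed_cut hε.le s hQ (e := coreScale ε 0) (fun θ hθ => ?_) (fun θ hθ => ?_)
    (fun P hP f1 f2 => ?_) (fun P hP f1 f2 => ?_)
  · rw [e2]; linarith
  · rw [e1]; linarith [ho θ hθ]
  · exact splits_of_core s hP (fun θ => by rw [f1, e2]) f2 (by linarith)
  -- the part beyond `√ε` is gentle unless it reaches beyond `1`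
  refine Splits.mono (L := {false}) ?_ le_rfl (empty_subset _)
  have hcs : c ≤ √ε := by linarith
  by_cases htop : ∀ θ ∈ Icc (0 : ℝ) 1, P.outer s θ ≤ 1
  · exact splits_of_outside s hP (fun θ _ => by rw [f2, h00])
      (fun θ hθ => by rw [f1, e1]; exact ho θ hθ) htop hcs
  · push Not at htop
    obtain ⟨θ₁, hθ₁, h1⟩ := htop
    have hεs : ε ≤ 1 / 16 := by
      have := Real.sq_sqrt hε.le
      nlinarith [hsc.sqrt_le]
    have hvar : ∀ θ ∈ Icc (0 : ℝ) 1, 3 / 4 ≤ P.outer s θ := by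
      intro θ hθ
      have hb := abs_le.1 (hP.abs_bottom_sub_le hε.le hθ hθ₁)
      have ht := abs_le.1 (hP.abs_top_sub_le hε.le hθ hθ₁)
      cases s
      · have h1 : 1 < -P.bottom θ₁ := h1
        show 3 / 4 ≤ -P.bottom θ
        linarith
      · have h1 : 1 < P.top θ₁ := h1
        show 3 / 4 ≤ P.top θ
        linarith
    refine Splits.mono (L := {false} ∪ {false}) ?_ le_rfl (by simp)
    have h4 := hsc.sqrt_le
    refine splits_of_signed_cut hε.le s hP (e := 1 / 2) (fun θ hθ => ?_) (fun θ hθ => ?_)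
      (fun A hA g1 g2 => ?_) (fun A hA g1 g2 => ?_)
    · rw [f2]; linarith
    · linarith [hvar θ hθ]
    · exact splits_of_outside s hA (fun θ _ => by rw [g1, f2, h00])
        (fun θ _ => by rw [g2]; linarith) (fun θ _ => by rw [g2]; norm_num) hcs
    · refine splits_gentle S hsc hρ N A (κ * (1 / 4)) hA ?_ ?_ ?_
      · linarith [hsc.mass_le]
      · refine hasMass_of_height hsc.kappa_pos.le (fun θ hθ x hx => hρ.le x ?_) fun θ hθ => ?_
        · have hxK : x ∈ Icc u v := ⟨(A.bottom_mem θ (hA.mem_Icc.2 hθ)).1.trans hx.1,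
            hx.2.trans (A.top_mem θ (hA.mem_Icc.2 hθ)).2⟩
          exact (S.abs_le x hxK).trans_lt S.bound_lt_two
        · rw [← A.outer_sub_inner s, g2, g1]
          linarith [hvar θ hθ]
      · refine hN.trans_le ?_
        have := hsc.one_lt_lam
        gcongr
        linarith [hsc.mass_le]

/-- Every rectangle with long fibres has a dissection in which both labels occur. When the
critical circle is approached and no strip `S¹ × I_{±1}` is covered, a strip `S¹ × I_{±r}` is cut out
between two gentle rectangles; under one more iterate its fibres become longer than those of the
given rectangle. -/
theorem splits_all (S : Setting d a₀ ε u v b) (hsc : Scales ε c κ C lam Lam ℓ₀)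
    (hρ : IsExpanding a₀ b ε c lam Lam κ C M ρ) {N : ℕ} (hN : 4 * M < lam ^ N * ℓ₀) (n : ℕ) :
    ∀ (R : Rectangle (Icc u v)) (ℓ : ℝ), IsFull ε R → ℓ₀ ≤ ℓ → HasMass ρ ℓ R →
      4 * M < lam ^ n * ℓ → Splits d a₀ ε c c (target ε u v c) (N + n) univ R := by
  induction n with
  | zero =>
    intro R ℓ hR _ hm hn
    have := hm.le_bound S hsc hρ hR
    rw [pow_zero, one_mul] at hn
    linarith
  | succ n ih =>
    intro R ℓ hR hℓ hm hn
    have hε := S.eps_pos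
    have hc := hsc.c_pos S
    have hs := Real.sqrt_pos.2 hε
    have hlamℓ : ℓ₀ ≤ lam * ℓ := by nlinarith [hsc.one_lt_lam, hsc.mass_pos]
    have hn' : 4 * M < lam ^ n * (lam * ℓ) := by rwa [pow_succ, mul_assoc] at hn
    by_cases htouch : ∃ θ ∈ Icc (0 : ℝ) 1, ∃ x ∈ Icc (R.bottom θ) (R.top θ), |x| < c
    · obtain ⟨s, w, hw, hlarge, hreach⟩ := exists_reach S hsc hρ hR hℓ hm htouch
      by_cases hcross : 2 * √ε ≤ w - ε
      · exact (splits_all_of_crossing S hsc hρ hN s hR (fun θ hθ => (hreach θ hθ).1)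
          fun θ hθ => hcross.trans (hreach θ hθ).2).mono (by omega) Subset.rfl
      push Not at hcross
      have hE : 4 * c ≤ 4 * Real.exp 14 * c := by
        have := Real.add_one_le_exp (14 : ℝ)
        nlinarith
      have hwc : 2 * Real.exp 14 * c ≤ w - ε := by linarith [hsc.eps_lt]
      have hcc : 0 < 2 * Real.exp 14 * c := by positivity
      obtain ⟨m, hm1, hm2⟩ := exists_coreScale_le hε (hcc.trans_le hwc)
      have hm3 : 2 * Real.exp 14 * c ≤ Real.exp 1 * coreScale ε m :=
        (le_min hwc (by linarith [hsc.le_sqrt])).trans hm2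
      have hm4 : 2 * c ≤ coreScale ε (m + 13) := by
        have h1 : Real.exp 14 = Real.exp 1 * Real.exp 13 := by
          rw [← Real.exp_add]; norm_num
        have h2 := coreScale_add ε m 13
        push_cast at h2
        rw [← h2, h1] at hm3
        have h3 : (Real.exp 1 * Real.exp 13) * (2 * c) ≤
            (Real.exp 1 * Real.exp 13) * coreScale ε (m + 13) := by linarith
        exact le_of_mul_le_mul_left h3 (by positivity)
      have hεw : 2 * ε ≤ w := by linarith [hsc.eps_lt]
      have hℓw : ℓ ≤ 2 * C * w := by
        rcases hlarge with h | h
        · linarith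
        · exact h
      -- the strip cut out is not much thinner than `R`
      have hthick : w ≤ 4 * Real.exp 8 * coreScale ε (m + 7) := by
        have h1 : (w - ε) / 2 ≤ min (w - ε) (√ε) := le_min (by linarith) (by linarith)
        have h2 := coreScale_add ε m 7
        have h3 : Real.exp 8 = Real.exp 1 * Real.exp 7 := by
          rw [← Real.exp_add]; norm_num
        push_cast at h2
        rw [← h2] at hm2
        rw [h3]
        linarith
      have i1 := coreScale_anti (ε := ε) (show m + 7 ≤ m + 13 by omega)
      have i2 := two_mul_coreScale_succ_le hε (m + 6)
      have i3 := two_mul_coreScale_le hε (show m < m + 6 by omega)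
      have i4 := coreScale_pos hε (m + 7)
      have i5 : coreScale ε (m + 6) ≤ √ε := by
        rw [← coreScale_zero]; exact coreScale_anti (Nat.zero_le _)
      refine Splits.mono (L := {false} ∪ (univ ∪ {false})) ?_ le_rfl
        (subset_union_of_subset_right subset_union_left _)
      refine splits_of_signed_cut hε.le s hR (e := coreScale ε (m + 7)) (fun θ hθ => ?_)
        (fun θ hθ => ?_) (fun Q hQ e1 e2 => ?_) (fun Q hQ e1 e2 => ?_)
      · linarith [(hreach θ hθ).1]
      · linarith [(hreach θ hθ).2, i2, i3]
      · exact splits_of_covers hε s hQ (m + 7)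
          (fun θ hθ => by rw [e1]; exact ((hreach θ hθ).1.le).trans hm4)
          (fun θ _ => (e2 θ).ge) (by show c ≤ coreScale ε (m + 13); linarith)
      refine splits_of_signed_cut hε.le s hQ (e := coreScale ε (m + 6)) (fun θ hθ => ?_)
        (fun θ hθ => ?_) (fun G hG f1 f2 => ?_) (fun A hA f1 f2 => ?_)
      · rw [e2]; linarith
      · rw [e1]; linarith [(hreach θ hθ).2]
      · have hGabs : ∀ θ ∈ Icc (0 : ℝ) 1, ∀ x ∈ Icc (G.bottom θ) (G.top θ),
            c ≤ |x| ∧ |x| ≤ 10 * √ε := by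
          intro θ hθ x hx
          obtain ⟨y, hy, hxy⟩ := G.exists_signed_mem s hx
          rw [f2, f1, e2] at hy
          rw [hxy, abs_of_pos (i4.trans_le hy.1)]
          constructor <;> linarith [hy.1, hy.2]
        have hGK : ∀ θ ∈ Icc (0 : ℝ) 1, ∀ x ∈ Icc (G.bottom θ) (G.top θ), x ∈ Icc u v :=
          fun θ hθ x hx => ⟨(G.bottom_mem θ (hG.mem_Icc.2 hθ)).1.trans hx.1,
            hx.2.trans (G.top_mem θ (hG.mem_Icc.2 hθ)).2⟩
        have hGm : HasMass ρ (κ * coreScale ε (m + 7)) G := by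
          refine hasMass_of_height hsc.kappa_pos.le (fun θ hθ x hx => hρ.le x
            ((S.abs_le x (hGK θ hθ x hx)).trans_lt S.bound_lt_two)) fun θ hθ => ?_
          rw [← G.outer_sub_inner s, f2, f1, e2]
          linarith
        have hLam := hsc.Lam_ge
        have hκ := hsc.kappa_pos
        have hC := hsc.C_pos
        have hlam := hsc.one_lt_lam
        have hLam0 : 0 ≤ Lam := by
          by_contra! h
          have h1 : 0 < 8 * Real.exp 8 * C * lam := by positivity
          nlinarith
        refine splits_of_images (q := N + n) S hLam0 hsc.eps_lt hG hGm
          (fun θ hθ x hx => (hGabs θ hθ x hx).1) (fun θ hθ x hx => ?_) fun B hB hBm =>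
            ih B (lam * ℓ) hB hlamℓ (hBm.mono ?_) hn'
        · have hxK := hGK θ hθ x hx
          refine hρ.expand_near x _ (S.abs_le x hxK) (S.abs_le _ (S.invariant θ x hxK)) ?_
            (hGabs θ hθ x hx).1 (hGabs θ hθ x hx).2
          have h1 : a₀ + ε * Real.sin (2 * Real.pi * θ) - x ^ 2 - quad a₀ x
              = ε * Real.sin (2 * Real.pi * θ) := by simp only [quad]; ring
          rw [h1, abs_mul, abs_of_pos hε]
          exact mul_le_of_le_one_right hε.le (Real.abs_sin_le_one _)
        · calc lam * ℓ ≤ lam * (2 * C * w) := by gcongr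
            _ ≤ lam * (2 * C * (4 * Real.exp 8 * coreScale ε (m + 7))) := by gcongr
            _ = (8 * Real.exp 8 * C * lam) * coreScale ε (m + 7) := by ring
            _ ≤ (Lam * κ) * coreScale ε (m + 7) := by gcongr
            _ = _ := by ring
      · exact splits_of_covers hε s hA m (fun θ _ => (f2 θ).le)
          (fun θ hθ => by rw [f1, e1]; exact hm1.trans (hreach θ hθ).2)
          (by have := coreScale_anti (ε := ε) (show m + 6 ≤ m + 13 by omega); linarith)
    · push Not at htouch
      exact splits_of_away (q := N + n) S hsc hρ hR hm htouch fun Q hQ hQm =>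
        ih Q _ hQ hlamℓ hQm hn'

end Recursion

/-! ### Distortion -/

theorem abs_det_fderiv_phiLift (d : ℕ) (a₀ ε : ℝ) (z : ℝ × ℝ) :
    DifferentiableAt ℝ (phiLift d a₀ ε) z ∧
      |(fderiv ℝ (phiLift d a₀ ε) z).det| = d * (2 * |z.2|) := by
  have h1 : HasFDerivAt (fun z : ℝ × ℝ => (d : ℝ) * z.1)
      ((d : ℝ) • ContinuousLinearMap.fst ℝ ℝ ℝ) z :=
    (ContinuousLinearMap.fst ℝ ℝ ℝ).hasFDerivAt.const_mul (d : ℝ)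
  have h2 : HasFDerivAt (fun z : ℝ × ℝ => 2 * Real.pi * z.1)
      ((2 * Real.pi) • ContinuousLinearMap.fst ℝ ℝ ℝ) z :=
    (ContinuousLinearMap.fst ℝ ℝ ℝ).hasFDerivAt.const_mul (2 * Real.pi)
  have h3 : HasFDerivAt (fun z : ℝ × ℝ => z.2) (ContinuousLinearMap.snd ℝ ℝ ℝ) z :=
    (ContinuousLinearMap.snd ℝ ℝ ℝ).hasFDerivAt
  have h4 := h1.prodMk (((h2.sin.const_mul ε).const_add a₀).sub (h3.pow 2))
  have h5 : HasFDerivAt (phiLift d a₀ ε) _ z := h4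
  refine ⟨h5.differentiableAt, ?_⟩
  rw [h5.fderiv, ContinuousLinearMap.det, ← LinearMap.det_toMatrix (Module.Basis.finTwoProd ℝ),
    Matrix.det_fin_two]
  simp [LinearMap.toMatrix_apply, abs_mul]

theorem proj_iterate (d : ℕ) (a₀ ε : ℝ) (j : ℕ) (z : ℝ × ℝ) :
    (phi d a₀ ε)^[j] (proj z) = proj ((phiLift d a₀ ε)^[j] z) := by
  induction j generalizing z with
  | zero => rfl
  | succ j ih => rw [iterate_succ_apply, iterate_succ_apply, phi_proj, ih]

theorem differentiable_phiLift (d : ℕ) (a₀ ε : ℝ) : Differentiable ℝ (phiLift d a₀ ε) :=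
  fun z => (abs_det_fderiv_phiLift d a₀ ε z).1

theorem abs_det_fderiv_iterate (d : ℕ) (a₀ ε : ℝ) (t : ℕ) (z : ℝ × ℝ) :
    |(fderiv ℝ (phiLift d a₀ ε)^[t] z).det| =
      ∏ j ∈ Finset.range t, (d * (2 * |((phi d a₀ ε)^[j] (proj z)).2|)) := by
  induction t with
  | zero => simp [ContinuousLinearMap.det, fderiv_id]
  | succ t ih =>
    rw [Finset.prod_range_succ, ← ih, iterate_succ',
      fderiv_comp z (differentiable_phiLift d a₀ ε _)
        ((differentiable_phiLift d a₀ ε).iterate t z), proj_iterate,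
      ← show |(fderiv ℝ (phiLift d a₀ ε) ((phiLift d a₀ ε)^[t] z)).det| =
        d * (2 * |(proj ((phiLift d a₀ ε)^[t] z)).2|) from
        (abs_det_fderiv_phiLift d a₀ ε _).2, mul_comm, ← abs_mul]
    simp [ContinuousLinearMap.det]

/-- The distortion is bounded along orbits that stay at a definite distance from the critical circle
for a bounded time. -/
theorem distortionLE_of_away {d : ℕ} {a₀ ε c C : ℝ} {t q : ℕ} (hd : 0 < d) {A : Set Phase}
    (hc : 0 < c) (hc2 : c ≤ 2) (htq : t ≤ q)
    (haway : ∀ p ∈ A, ∀ j < t, c ≤ |((phi d a₀ ε)^[j] p).2|)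
    (hbd : ∀ p ∈ A, ∀ j, |((phi d a₀ ε)^[j] p).2| ≤ 2) (hC : (2 / c) ^ q ≤ C) :
    DistortionLE d a₀ ε t A C := by
  intro z w hz hw
  have hd' : (0 : ℝ) < d := by exact_mod_cast hd
  rw [abs_det_fderiv_iterate, abs_det_fderiv_iterate]
  have h1 : (2 / c) ^ t ≤ C :=
    (pow_le_pow_right₀ ((one_le_div hc).2 hc2) htq).trans hC
  calc ∏ j ∈ Finset.range t, (d * (2 * |((phi d a₀ ε)^[j] (proj z)).2|))
      ≤ ∏ j ∈ Finset.range t, (2 / c * (d * (2 * |((phi d a₀ ε)^[j] (proj w)).2|))) := by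
        refine Finset.prod_le_prod (fun j _ => by positivity) fun j hj => ?_
        have h2 := hbd _ hz j
        have h3 := haway _ hw j (Finset.mem_range.1 hj)
        calc (d : ℝ) * (2 * |((phi d a₀ ε)^[j] (proj z)).2|) ≤ d * (2 * 2) := by gcongr
          _ = 2 / c * (d * (2 * c)) := by field_simp
          _ ≤ _ := by gcongr
    _ = (2 / c) ^ t * ∏ j ∈ Finset.range t, (d * (2 * |((phi d a₀ ε)^[j] (proj w)).2|)) := by
        rw [Finset.prod_mul_distrib, Finset.prod_const, Finset.card_range]
    _ ≤ _ := by
        gcongr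

/-! ### Lebesgue measure of rectangles -/

section Measure

variable {K : Set ℝ}

theorem Rectangle.isOpen_carrier (R : Rectangle K) : IsOpen R.carrier := by
  have hb : ContinuousOn (fun z : ℝ × ℝ => z.2 - R.bottom z.1) (Ioo R.left R.right ×ˢ univ) :=
    continuousOn_snd.sub (R.continuousOn_bottom.comp continuousOn_fst
      fun z hz => Ioo_subset_Icc_self hz.1)
  have ht : ContinuousOn (fun z : ℝ × ℝ => R.top z.1 - z.2) (Ioo R.left R.right ×ˢ univ) :=
    (R.continuousOn_top.comp continuousOn_fst
      fun z hz => Ioo_subset_Icc_self hz.1).sub continuousOn_snd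
  have ho : IsOpen (Ioo R.left R.right ×ˢ (univ : Set ℝ)) := isOpen_Ioo.prod isOpen_univ
  have hU := (hb.isOpen_inter_preimage ho isOpen_Ioi (t := Ioi 0)).inter
    (ht.isOpen_inter_preimage ho isOpen_Ioi (t := Ioi 0))
  have hmap : IsOpenMap (Prod.map (fun θ : ℝ => (θ : UnitAddCircle)) (id : ℝ → ℝ)) :=
    QuotientAddGroup.isOpenMap_coe.prodMap IsOpenMap.id
  convert hmap _ hU using 1
  ext ⟨ω, x⟩
  constructor
  · rintro ⟨θ, hθ, h1, h2⟩
    refine ⟨(θ, x), ⟨⟨⟨hθ, trivial⟩, ?_⟩, ⟨⟨hθ, trivial⟩, ?_⟩⟩, Prod.ext h1.symm rfl⟩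
    · exact sub_pos.2 h2.1
    · exact sub_pos.2 h2.2
  · rintro ⟨⟨θ, y⟩, ⟨⟨⟨hθ, -⟩, h1⟩, ⟨-, h2⟩⟩, e⟩
    obtain ⟨rfl, rfl⟩ := Prod.mk.inj e
    exact ⟨θ, hθ, rfl, sub_pos.1 h1, sub_pos.1 h2⟩

/-- The covering projection preserves Lebesgue measure over a fundamental interval. -/
theorem measurePreserving_proj :
    MeasurePreserving proj ((volume.restrict (Ioc (0 : ℝ) 1)).prod volume) volume := by
  have h1 := UnitAddCircle.measurePreserving_mk 0
  rw [zero_add] at h1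
  exact h1.prod (MeasurePreserving.id (volume : Measure ℝ))

theorem Rectangle.le_volume_carrier (R : Rectangle K) {δ δ' : ℝ} (hδ0 : 0 ≤ δ)
    (hw : δ ≤ R.right - R.left)
    (hh : ∀ θ ∈ Ioo R.left R.right, δ' ≤ R.top θ - R.bottom θ) :
    ENNReal.ofReal (δ' * δ) ≤ volume R.carrier := by
  have hsub : Ioo R.left R.right ⊆ Icc R.left R.right := Ioo_subset_Icc_self
  have h1 := volume_regionBetween_eq_lintegral (μ := volume.restrict (Ioc (0 : ℝ) 1))
    (f := R.bottom) (g := R.top) (s := Ioo R.left R.right)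
    ((R.continuousOn_bottom.mono hsub).aemeasurable measurableSet_Ioo)
    ((R.continuousOn_top.mono hsub).aemeasurable measurableSet_Ioo) measurableSet_Ioo
  calc ENNReal.ofReal (δ' * δ)
      ≤ ENNReal.ofReal δ' * volume.restrict (Ioc (0 : ℝ) 1) (Ioo R.left R.right) := by
        rw [ENNReal.ofReal_mul' hδ0, Measure.restrict_apply measurableSet_Ioo,
          inter_eq_left.2 (R.Ioo_subset.trans Ioo_subset_Ioc_self), Real.volume_Ioo]
        gcongr
    _ = ∫⁻ _ in Ioo R.left R.right, ENNReal.ofReal δ' ∂volume.restrict (Ioc (0 : ℝ) 1) :=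
        (setLIntegral_const _ _).symm
    _ ≤ ∫⁻ θ in Ioo R.left R.right, ENNReal.ofReal ((R.top - R.bottom) θ)
          ∂volume.restrict (Ioc (0 : ℝ) 1) :=
        setLIntegral_mono' measurableSet_Ioo fun θ hθ => ENNReal.ofReal_le_ofReal (hh θ hθ)
    _ = (volume.restrict (Ioc (0 : ℝ) 1)).prod volume
          (regionBetween R.bottom R.top (Ioo R.left R.right)) := h1.symm
    _ ≤ (volume.restrict (Ioc (0 : ℝ) 1)).prod volume (proj ⁻¹' R.carrier) :=
        measure_mono fun z hz => ⟨z.1, hz.1, rfl, hz.2⟩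
    _ ≤ Measure.map proj ((volume.restrict (Ioc (0 : ℝ) 1)).prod volume) R.carrier :=
        Measure.le_map_apply measurePreserving_proj.aemeasurable _
    _ = volume R.carrier := by rw [measurePreserving_proj.map_eq]

theorem Rectangle.snd_mem {u v : ℝ} (R : Rectangle (Icc u v)) {p : Phase} (hp : p ∈ R.carrier) :
    p.2 ∈ Icc u v := by
  obtain ⟨θ, hθ, x, hx, rfl⟩ := R.exists_of_mem_carrier hp
  have hθ' := Ioo_subset_Icc_self hθ
  exact ⟨(R.bottom_mem θ hθ').1.trans hx.1.le, hx.2.le.trans (R.top_mem θ hθ').2⟩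

theorem Rectangle.volume_carrier_le {u v : ℝ} (R : Rectangle (Icc u v)) :
    volume R.carrier ≤ ENNReal.ofReal (v - u) := by
  calc volume R.carrier ≤ volume ((univ : Set UnitAddCircle) ×ˢ Icc u v) :=
        measure_mono fun p hp => ⟨trivial, R.snd_mem hp⟩
    _ = ENNReal.ofReal (v - u) := by
        rw [Measure.volume_eq_prod, Measure.prod_prod, Real.volume_Icc,
          UnitAddCircle.measure_univ, one_mul]

/-- A measurable set with countable fibres over all but countably many points is a null set. -/
theorem volume_eq_zero_of_countable {A : Set Phase} (hA : MeasurableSet A) {D : Set ℝ}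
    (hD : D.Countable)
    (h : ∀ θ ∈ Ioo (0 : ℝ) 1, θ ∉ D → {x : ℝ | ((θ : UnitAddCircle), x) ∈ A}.Countable) :
    volume A = 0 := by
  rw [← measurePreserving_proj.measure_preimage hA.nullMeasurableSet,
    Measure.measure_prod_null (measurePreserving_proj.measurable hA)]
  have h1 : ∀ᵐ θ ∂volume.restrict (Ioc (0 : ℝ) 1), θ ∈ Ioc (0 : ℝ) 1 :=
    ae_restrict_mem measurableSet_Ioc
  have h2 : ∀ᵐ θ ∂volume.restrict (Ioc (0 : ℝ) 1), θ ∉ insert 1 D :=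
    ae_restrict_of_ae ((hD.insert 1).ae_notMem _)
  filter_upwards [h1, h2] with θ h3 h4
  rw [mem_insert_iff, not_or] at h4
  exact (h θ ⟨h3.1, lt_of_le_of_ne h3.2 h4.1⟩ h4.2).measure_zero _

end Measure

/-! ### Invariant intervals and the choice of scales -/

/-- An interval that is invariant under all the fibre maps lies between the fixed points `±b`. -/
theorem setting_of_mapsTo {d : ℕ} {a₀ ε u v b : ℝ} (hd : 16 ≤ d) (hε : 0 < ε) (hε1 : ε ≤ 1)
    (hb1 : 1 < b) (hb2 : b < 2) (hb : b ^ 2 - b = a₀)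
    (h : MapsTo (phi d a₀ ε) (univ ×ˢ Icc u v) (univ ×ˢ Icc u v)) : Setting d a₀ ε u v b := by
  have hinv : ∀ θ : ℝ, ∀ x ∈ Icc u v,
      a₀ + ε * Real.sin (2 * Real.pi * θ) - x ^ 2 ∈ Icc u v := by
    intro θ x hx
    have h1 := h (show ((θ : UnitAddCircle), x) ∈ univ ×ˢ Icc u v from ⟨trivial, hx⟩)
    rw [phi_coe d a₀ ε 0] at h1
    exact h1.2
  refine ⟨hd, hε, hε1, hb2, fun x hx => ?_, hinv⟩
  have huv : u ≤ v := hx.1.trans hx.2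
  have hxm : |x| ≤ max (-u) v :=
    abs_le.2 ⟨by linarith [le_max_left (-u) v, hx.1], hx.2.trans (le_max_right _ _)⟩
  refine hxm.trans ?_
  set m := max (-u) v with hm
  have hm0 : 0 ≤ m := (abs_nonneg x).trans hxm
  -- the driving term takes the value `-ε` at `θ = -1/4`
  have hlow : ∀ w ∈ Icc u v, -m ≤ a₀ - ε - w ^ 2 := by
    intro w hw
    have h1 := (hinv (-(1 / 4)) w hw).1
    have h2 : Real.sin (2 * Real.pi * -(1 / 4)) = -1 := by
      rw [show 2 * Real.pi * -(1 / 4) = -(Real.pi / 2) by ring, Real.sin_neg, Real.sin_pi_div_two]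
    rw [h2] at h1
    have h3 := le_max_left (-u) v
    linarith
  have hm2 : m ^ 2 ≤ a₀ - ε + m := by
    rcases max_choice (-u) v with h1 | h1
    · have h2 := hlow u ⟨le_rfl, huv⟩
      rw [hm, h1] at *
      nlinarith
    · have h2 := hlow v ⟨huv, le_rfl⟩
      rw [hm, h1] at *
      nlinarith
  by_contra! hc
  nlinarith

theorem exists_equiv_fin_succ (α : Type) [Finite α] [Nonempty α] :
    ∃ n : ℕ, Nonempty (Fin (n + 1) ≃ α) := by
  have h : Nat.card α ≠ 0 := Nat.card_pos.ne'
  obtain ⟨n, hn⟩ := Nat.exists_eq_succ_of_ne_zero h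
  exact ⟨n, ⟨(Finite.equivFinOfCardEq hn).symm⟩⟩

/-- The scales are in the required relation for all small `ε`. -/
theorem eventually_scales {κ C lam θ : ℝ} (hκ : 0 < κ) (hC : 0 < C) (hlam : 1 < lam)
    (hθ0 : 1 / 2 < θ) (hθ1 : θ < 1) :
    ∀ᶠ ε in 𝓝[>] (0 : ℝ), ε ≤ 1 ∧ 4 * ε ≤ ε ^ θ ∧
      Scales ε (κ / (16 * Real.exp 14 * C) * ε ^ θ) κ C lam (8 * Real.exp 8 * C * lam / κ)
        (κ * (ε ^ θ / 2)) := by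
  have hid : Tendsto (fun t : ℝ => t) (𝓝[>] 0) (𝓝 0) :=
    tendsto_nhdsWithin_of_tendsto_nhds tendsto_id
  have hpow : ∀ a : ℝ, 0 < a → Tendsto (fun ε : ℝ => ε ^ a) (𝓝[>] 0) (𝓝 0) := by
    intro a ha
    have h1 := hid.rpow_const (p := a) (Or.inr ha.le)
    rwa [Real.zero_rpow ha.ne'] at h1
  have hE := Real.exp_pos 14
  set k : ℝ := κ / (16 * Real.exp 14 * C) with hk
  have hk0 : 0 < k := by positivity
  have e1 := hid.eventually_lt_const (u := 1 / 16) (by norm_num)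
  have e2 := (hpow (1 - θ) (by linarith)).eventually_lt_const (u := min k (1 / 4))
    (lt_min hk0 (by norm_num))
  have e3 := (hpow (θ - 1 / 2) (by linarith)).eventually_lt_const
    (u := 1 / (4 * Real.exp 14 * k)) (by positivity)
  have e4 := (hpow θ (by linarith)).eventually_lt_const (u := 1 / 2) (by norm_num)
  filter_upwards [e1, e2, e3, e4, self_mem_nhdsWithin] with ε h1 h2 h3 h4 hε
  have hε : 0 < ε := hε
  have hsplit : ε = ε ^ (1 - θ) * ε ^ θ := by
    rw [← Real.rpow_add hε]; simp
  have hsqrt : ε ^ θ = ε ^ (θ - 1 / 2) * √ε := by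
    rw [Real.sqrt_eq_rpow, ← Real.rpow_add hε]; congr 1; ring
  have hs : 0 < ε ^ θ := by positivity
  refine ⟨by linarith, ?_, ⟨?_, ?_, ?_, hκ, hC, hlam, by positivity, ?_, ?_, ?_⟩⟩
  · have h5 : ε ^ (1 - θ) ≤ 1 / 4 := h2.le.trans (min_le_right _ _)
    calc 4 * ε = 4 * (ε ^ (1 - θ) * ε ^ θ) := by rw [← hsplit]
      _ ≤ 4 * (1 / 4 * ε ^ θ) := by gcongr
      _ = ε ^ θ := by ring
  · calc ε = ε ^ (1 - θ) * ε ^ θ := hsplit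
      _ < k * ε ^ θ := by
        gcongr
        exact h2.trans_le (min_le_left _ _)
  · rw [hsqrt]
    calc 4 * Real.exp 14 * (k * (ε ^ (θ - 1 / 2) * √ε))
        = (4 * Real.exp 14 * k) * ε ^ (θ - 1 / 2) * √ε := by ring
      _ ≤ (4 * Real.exp 14 * k) * (1 / (4 * Real.exp 14 * k)) * √ε := by gcongr
      _ = √ε := by field_simp
  · have h5 : √ε ≤ 1 / 4 := by
      rw [Real.sqrt_le_left (by norm_num)]
      norm_num
      linarith
    linarith
  · apply le_of_eq
    rw [hk]
    field_simp
    norm_num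
  · have : κ * (ε ^ θ / 2) ≤ κ * (1 / 2 / 2) := by gcongr
    linarith
  · apply le_of_eq
    field_simp

end Viana

end

theorem mainTheorem4
    (a₀ : ℝ) (ha₀ : a₀ ∈ Set.Ioo (1 : ℝ) 2) (hpre : Viana.CriticalPreperiodic a₀)
    (η : ℝ) (hη : 0 < η) (hη' : η < 1 / 3) (d : ℕ) (hd : 16 ≤ d) :
    ∃ ε₀ : ℝ, 0 < ε₀ ∧ ∀ ε : ℝ, 0 < ε → ε < ε₀ →
      ∀ u v : ℝ, u ≤ v →
        Set.MapsTo (Viana.phi d a₀ ε)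
          (Set.univ ×ˢ Set.Icc u v) (Set.univ ×ˢ Set.Icc u v) →
        ∃ (q : ℕ) (C : ℝ), 0 < C ∧
          ∀ R : Viana.Rectangle (Set.Icc u v),
            R.Admissible ε → R.HasFullBasis → ε ^ (1 - 3 / 2 * η) ≤ R.leftSize →
            ∃ (s k : ℕ)
              (P : Fin (s + 1) → Viana.Rectangle (Set.Icc u v))
              (P' : Fin (k + 1) → Viana.Rectangle (Set.Icc u v))
              (t : Fin (s + 1) → ℕ) (t' : Fin (k + 1) → ℕ),
              Viana.IsPartitionModZero
                (Sum.elim (fun i => (P i).carrier) (fun i => (P' i).carrier)) R.carrier ∧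
              (∀ i, t i ≤ q) ∧ (∀ i, t' i ≤ q) ∧
              (∀ i,
                (Set.BijOn (Viana.phi d a₀ ε)^[t i] (P i).carrier
                    (Viana.strip (Viana.core ε 1)) ∨
                  Set.BijOn (Viana.phi d a₀ ε)^[t i] (P i).carrier
                    (Viana.strip (Viana.coreNeg ε 1))) ∧
                Viana.DistortionLE d a₀ ε (t i) (P i).carrier C) ∧
              (∀ i, ∃ Q : Viana.Rectangle (Set.Icc u v),
                Set.BijOn (Viana.phi d a₀ ε)^[t' i] (P' i).carrier Q.carrier ∧
                Q.Admissible ε ∧ Viana.Gentle ε Q.carrier ∧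
                ε ^ (1 - 3 / 2 * η) / C ≤ Q.leftSize ∧
                Viana.DistortionLE d a₀ ε (t' i) (P' i).carrier C) ∧
              MeasureTheory.volume R.carrier / ENNReal.ofReal C ≤
                MeasureTheory.volume (⋃ i, (P i).carrier) := by
  open Viana in
  set θ : ℝ := 1 - 3 / 2 * η with hθ
  -- `b` is the absolute value of the negative fixed point of `h`
  obtain ⟨b, hb1, hb2, hb⟩ : ∃ b : ℝ, 1 < b ∧ b < 2 ∧ b ^ 2 - b = a₀ := by
    have h1 : √(1 + 4 * a₀) ^ 2 = 1 + 4 * a₀ := Real.sq_sqrt (by linarith [ha₀.1])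
    refine ⟨(1 + √(1 + 4 * a₀)) / 2, ?_, ?_, by nlinarith⟩
    · nlinarith [Real.sqrt_nonneg (1 + 4 * a₀), ha₀.1]
    · nlinarith [Real.sqrt_nonneg (1 + 4 * a₀), ha₀.2]
  obtain ⟨lam, κ, C₀, hlam, hκ, hC₀, hρ⟩ :=
    exists_isExpanding (b := b) (θ := θ) ha₀ hpre hb2 (by linarith)
  have hev := (eventually_scales hκ hC₀ hlam (θ := θ) (by linarith) (by linarith)).and
    (hρ (κ / (16 * Real.exp 14 * C₀)) (8 * Real.exp 8 * C₀ * lam / κ)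
      (by have := Real.exp_pos 14; positivity))
  obtain ⟨ε₀, hε₀, hsmall⟩ := mem_nhdsGT_iff_exists_Ioo_subset.1 hev
  refine ⟨ε₀, hε₀, fun ε hε hεε₀ u v _ hmaps => ?_⟩
  obtain ⟨⟨hε1, hεθ, hsc⟩, ρ, M, hρ⟩ := hsmall ⟨hε, hεε₀⟩
  have S := setting_of_mapsTo hd hε hε1 hb1 hb2 hb hmaps
  have hc := hsc.c_pos S
  have hs : 0 < ε ^ θ := Real.rpow_pos_of_pos hε θ
  set c : ℝ := κ / (16 * Real.exp 14 * C₀) * ε ^ θ with hcdef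
  have hd0 : 0 < d := by omega
  have hd' : (0 : ℝ) < d := by exact_mod_cast hd0
  have hc2 : c ≤ 2 := by
    have h1 := Real.add_one_le_exp (14 : ℝ)
    nlinarith [hsc.le_sqrt, hsc.sqrt_le]
  obtain ⟨N, hN⟩ : ∃ N : ℕ, 4 * M < lam ^ N * (κ * (ε ^ θ / 2)) := by
    obtain ⟨N, hN⟩ := pow_unbounded_of_one_lt (4 * M / (κ * (ε ^ θ / 2))) hlam
    exact ⟨N, (div_lt_iff₀ hsc.mass_pos).1 hN⟩
  -- a lower bound for the measure of any piece
  set m : ℝ := c * (1 / 4) ^ (N + N) * ((d : ℝ)⁻¹) ^ (N + N) with hm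
  have hm0 : 0 < m := by positivity
  set C : ℝ := (2 / c) ^ (N + N) + ε ^ θ / c + 4 / m with hC
  have hC1 : 0 < (2 / c) ^ (N + N) := by positivity
  have hC2 : 0 < ε ^ θ / c := by positivity
  have hC3 : 0 < 4 / m := by positivity
  have hCpos : 0 < C := by positivity
  refine ⟨N + N, C, hCpos, fun R hadm hfull hsize => ?_⟩
  have hR : IsFull ε R := ⟨hfull, hadm⟩
  have hinv : ∀ (A : Rectangle (Icc u v)), ∀ p ∈ A.carrier, ∀ j,
      |((phi d a₀ ε)^[j] p).2| ≤ 2 := fun A p hp j =>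
    (S.abs_le _ (hmaps.iterate j (show p ∈ univ ×ˢ Icc u v from ⟨trivial, A.snd_mem hp⟩)).2).trans
      hb2.le
  have hmass : HasMass ρ (κ * (ε ^ θ / 2)) R := by
    refine hasMass_of_height hκ.le (fun ω hω x hx => hρ.le x ?_) fun ω hω => ?_
    · have hxK : x ∈ Icc u v := ⟨(R.bottom_mem ω (hR.mem_Icc.2 hω)).1.trans hx.1,
        hx.2.trans (R.top_mem ω (hR.mem_Icc.2 hω)).2⟩
      exact (S.abs_le x hxK).trans_lt hb2
    · unfold Rectangle.leftSize at hsize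
      rw [hfull.1] at hsize
      have h0 : (0 : ℝ) ∈ Icc (0 : ℝ) 1 := by simp
      have h1 := abs_le.1 (hR.abs_bottom_sub_le hε.le hω h0)
      have h2 := abs_le.1 (hR.abs_top_sub_le hε.le hω h0)
      linarith
  obtain ⟨ι, hι, P, β, h1, h2, ⟨D, hD, h3⟩, h4, h5⟩ :=
    splits_all S hsc hρ hN N R _ hR le_rfl hmass hN
  choose t ht T hT hret using h4
  have hdist : ∀ i, DistortionLE d a₀ ε (t i) (P i).carrier C := fun i =>
    distortionLE_of_away hd0 hc hc2 (ht i) (hret i).away (fun p hp j => hinv _ p hp j)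
      (by linarith)
  -- enumerate the pieces of either kind
  have hne : ∀ b, Nonempty {i // β i = b} := fun b => by
    obtain ⟨i, hi⟩ := h5 b trivial
    exact ⟨⟨i, hi⟩⟩
  have := hne true
  have := hne false
  obtain ⟨s, ⟨e⟩⟩ := exists_equiv_fin_succ {i // β i = true}
  obtain ⟨k, ⟨e'⟩⟩ := exists_equiv_fin_succ {i // β i = false}
  have hcover : ⋃ j, Sum.elim (fun i => (P (e i)).carrier) (fun i => (P (e' i)).carrier) j =
      ⋃ i, (P i).carrier := by
    apply Subset.antisymm
    · refine iUnion_subset ?_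
      rintro (i | i)
      · exact subset_iUnion (fun i => (P i).carrier) _
      · exact subset_iUnion (fun i => (P i).carrier) _
    · refine iUnion_subset fun i => ?_
      cases hi : β i
      · refine subset_iUnion_of_subset (Sum.inr (e'.symm ⟨i, hi⟩)) ?_
        simp
      · refine subset_iUnion_of_subset (Sum.inl (e.symm ⟨i, hi⟩)) ?_
        simp
  refine ⟨s, k, fun i => P (e i), fun i => P (e' i), fun i => t (e i), fun i => t (e' i),
    ⟨?_, ?_, ?_⟩, fun i => ht _, fun i => ht _, fun i => ⟨?_, hdist _⟩, fun i => ?_, ?_⟩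
  · rintro (i | i) (j | j) hij
    · exact h1 fun h => hij (congrArg Sum.inl (e.injective (Subtype.ext h)))
    · refine h1 fun h => ?_
      have := (e i).2.symm.trans ((congrArg β h).trans (e' j).2)
      exact absurd this (by decide)
    · refine h1 fun h => ?_
      have := (e j).2.symm.trans ((congrArg β h.symm).trans (e' i).2)
      exact absurd this (by decide)
    · exact h1 fun h => hij (congrArg Sum.inr (e'.injective (Subtype.ext h)))
  · rintro (i | i) <;> exact h2 _
  · rw [hcover]
    refine volume_eq_zero_of_countable ?_ hD h3
    exact R.isOpen_carrier.measurableSet.diff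
      (isOpen_iUnion fun i => (P i).isOpen_carrier).measurableSet
  · have h6 := hT (e i)
    have h7 := (hret (e i)).bij
    rw [(e i).2] at h6
    rcases h6 with h6 | h6
    · exact Or.inl (h6 ▸ h7)
    · exact Or.inr (h6 ▸ h7)
  · have h6 := hT (e' i)
    have h7 := (hret (e' i)).bij
    rw [(e' i).2] at h6
    obtain ⟨Q, hQT, hQa, hQg, hQl⟩ := h6
    refine ⟨Q, hQT ▸ h7, hQa, hQg, le_trans ?_ hQl, hdist _⟩
    rw [div_le_iff₀ hCpos]
    calc ε ^ θ = c * (ε ^ θ / c) := by field_simp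
      _ ≤ c * C := by gcongr; linarith
  · have h6 := hret (e 0)
    have hq := ht (e 0)
    have hlow : ENNReal.ofReal m ≤ volume (P (e 0)).carrier := by
      refine Rectangle.le_volume_carrier _ (by positivity) (le_trans ?_ h6.width)
        fun ω hω => le_trans ?_ (h6.height ω hω)
      · refine pow_le_pow_of_le_one (by positivity) (inv_le_one_of_one_le₀ ?_) hq
        exact_mod_cast hd0
      · have h7 : ((1 : ℝ) / 4) ^ (N + N) ≤ (1 / 4) ^ t (e 0) :=
          pow_le_pow_of_le_one (by norm_num) (by norm_num) hq
        gcongr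
    refine ENNReal.div_le_of_le_mul ?_
    have huv : v - u ≤ 4 := by
      have hbm := R.bottom_mem 0 (hR.mem_Icc.2 (by simp))
      have huv : u ≤ v := hbm.1.trans hbm.2
      have h8 := abs_le.1 (S.abs_le u ⟨le_rfl, huv⟩)
      have h9 := abs_le.1 (S.abs_le v ⟨huv, le_rfl⟩)
      linarith
    calc volume R.carrier ≤ ENNReal.ofReal (v - u) := R.volume_carrier_le
      _ ≤ ENNReal.ofReal (m * C) := by
        refine ENNReal.ofReal_le_ofReal (huv.trans ?_)
        calc (4 : ℝ) = m * (4 / m) := by field_simp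
          _ ≤ m * C := by gcongr; linarith
      _ = ENNReal.ofReal m * ENNReal.ofReal C := ENNReal.ofReal_mul hm0.le
      _ ≤ volume (⋃ i, (P (e i)).carrier) * ENNReal.ofReal C := by
        gcongr
        exact hlow.trans (measure_mono (subset_iUnion (fun i => (P (e i)).carrier) 0))
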